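/- A \emph{metric Lie algebra} is a finite-dimensional real Lie algebra $\mathfrak g$ with a (positive definite) inner product $\langle\cdot,\cdot\rangle$. Let $\{E_i\}$ be an orthonormal basis of $\mathfrak g$, let $B$ be the Killing form of $\mathfrak g$ (identified with the symmetric operator representing it), let $H\in\mathfrak g$ be defined by $\langle H,X\rangle=\operatorname{Tr}\operatorname{ad}_X$ for all $X\in\mathfrak g$, and put $S(A)=\frac12(A+A^*)$ for $A\in\operatorname{End}(\mathfrak g)$. The Ricci operator of $(\mathfrak g,\langle\cdot,\cdot\rangle)$ is the unique operator $\operatorname{ric}$ such that $$\operatorname{Tr}\Bigl(\bigl(\operatorname{ric}+S(\operatorname{ad}_H)+\tfrac12 B\bigr)\circ A\Bigr)=\tfrac14\sum_{i,j}\bigl\langle A[E_i,E_j]-[AE_i,E_j]-[E_i,AE_j],\,[E_i,E_j]\bigr\rangle$$ for all $A\in\operatorname{End}(\mathfrak g)$; it is the Ricci operator of the corresponding left-invariant Riemannian metric. The metric Lie algebra is \emph{Einstein} if $\operatorname{ric}=c\,\mathrm{id}$ for some $c\in\mathbb R$. A metric solvable Lie algebra is \emph{standard} if the orthogonal complement of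 its derived algebra $[\mathfrak g,\mathfrak g]$ is abelian. The \emph{nilradical} of $\mathfrak g$ is its greatest nilpotent ideal. \textbf{Theorem.} Let $\mathfrak n$ be a finite-dimensional real nilpotent Lie algebra generated by no more than three elements (that is, $\dim\mathfrak n-\dim[\mathfrak n,\mathfrak n]\le 3$). Then every Einstein metric solvable Lie algebra whose nilradical is isomorphic to $\mathfrak n$ is standard. -/

import Mathlib

open Module

/-- An inner product on a real vector space: a symmetric positive definite bilinear form. -/
structure RealInnerProduct (V : Type*) [AddCommGroup V] [Module ℝ V] where
  form : LinearMap.BilinForm ℝ V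
  symm : ∀ x y, form x y = form y x
  pos : ∀ x, x ≠ 0 → 0 < form x x

namespace RealInnerProduct

section LinearAlgebra

variable {V : Type*} [AddCommGroup V] [Module ℝ V] (ip : RealInnerProduct V)

theorem nondegenerate : ip.form.Nondegenerate := by
  constructor
  · intro x hx
    by_contra h
    exact (ip.pos x h).ne' (hx x)
  · intro x hx
    by_contra h
    exact (ip.pos x h).ne' (hx x)

/-- The basis `b` is orthonormal. -/
def IsOrthonormal {ι : Type*} [DecidableEq ι] (b : Basis ι ℝ V) : Prop :=
  ∀ i j, ip.form (b i) (b j) = if i = j then 1 else 0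

/-- The sum `∑ i, f (E i) (E i)` does not depend on the orthonormal basis `E`. -/
theorem sum_eq_sum {ι κ : Type*} [Fintype ι] [Fintype κ] [DecidableEq ι] [DecidableEq κ]
    {b : Basis ι ℝ V} {b' : Basis κ ℝ V} (hb : ip.IsOrthonormal b) (hb' : ip.IsOrthonormal b')
    (f : V →ₗ[ℝ] V →ₗ[ℝ] ℝ) : ∑ i, f (b i) (b i) = ∑ k, f (b' k) (b' k) := by
  have hr : ∀ i k, b.repr (b' k) i = ip.form (b' k) (b i) := by
    intro i k
    have ho : ∀ i j, ip.form (b i) (b j) = if i = j then 1 else 0 := hb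
    have h := congrArg (fun v => ip.form v (b i)) (b.sum_repr (b' k))
    simp only [map_sum, map_smul, LinearMap.sum_apply, LinearMap.smul_apply, ho, smul_eq_mul,
      mul_ite, mul_one, mul_zero, Finset.sum_ite_eq', Finset.mem_univ, if_true] at h
    exact h
  have hr' : ∀ i k, b'.repr (b i) k = ip.form (b' k) (b i) := by
    intro i k
    have ho : ∀ i j, ip.form (b' i) (b' j) = if i = j then 1 else 0 := hb'
    have h := congrArg (fun v => ip.form v (b' k)) (b'.sum_repr (b i))
    simp only [map_sum, map_smul, LinearMap.sum_apply, LinearMap.smul_apply, ho, smul_eq_mul,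
      mul_ite, mul_one, mul_zero, Finset.sum_ite_eq', Finset.mem_univ, if_true] at h
    rw [h, ip.symm]
  calc ∑ i, f (b i) (b i) = ∑ i, ∑ k, ip.form (b' k) (b i) * f (b' k) (b i) := by
        refine Finset.sum_congr rfl fun i _ => ?_
        have h : f (b i) (b i) = f (∑ k, b'.repr (b i) k • b' k) (b i) := by
          rw [b'.sum_repr]
        rw [h]
        simp [hr', smul_eq_mul]
    _ = ∑ k, ∑ i, ip.form (b' k) (b i) * f (b' k) (b i) := Finset.sum_comm
    _ = ∑ k, f (b' k) (b' k) := by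
        refine Finset.sum_congr rfl fun k _ => ?_
        have h : f (b' k) (b' k) = f (b' k) (∑ i, b.repr (b' k) i • b i) := by
          rw [b.sum_repr]
        rw [h]
        simp [hr, smul_eq_mul]

variable [FiniteDimensional ℝ V]

theorem exists_isOrthonormal : ∃ b : Basis (Fin (finrank ℝ V)) ℝ V, ip.IsOrthonormal b := by
  obtain ⟨v, hv⟩ := LinearMap.BilinForm.exists_orthogonal_basis
    (B := ip.form) ⟨fun x y => by simpa using ip.symm x y⟩
  have hp : ∀ i, 0 < ip.form (v i) (v i) := fun i => ip.pos _ (v.ne_zero i)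
  have hs : ∀ i, Real.sqrt (ip.form (v i) (v i)) ≠ 0 := fun i => (Real.sqrt_pos.2 (hp i)).ne'
  refine ⟨v.isUnitSMul (w := fun i => (Real.sqrt (ip.form (v i) (v i)))⁻¹)
    fun i => (inv_ne_zero (hs i)).isUnit, fun i j => ?_⟩
  rw [Basis.isUnitSMul_apply, Basis.isUnitSMul_apply]
  split_ifs with h
  · subst h
    have h2 := Real.mul_self_sqrt (hp i).le
    simp only [map_smul, LinearMap.smul_apply, smul_eq_mul]
    have h3 := hs i
    field_simp
    rw [sq, h2]
  · have h4 : ip.form (v i) (v j) = 0 := hv h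
    simp [h4]

/-- An orthonormal basis. -/
noncomputable def orthonormalBasis : Basis (Fin (finrank ℝ V)) ℝ V :=
  ip.exists_isOrthonormal.choose

theorem isOrthonormal_orthonormalBasis : ip.IsOrthonormal ip.orthonormalBasis :=
  ip.exists_isOrthonormal.choose_spec

/-- The metric adjoint `A^*` of `A`, that is, `⟨A^* x, y⟩ = ⟨x, A y⟩`. -/
noncomputable def adjoint (A : End ℝ V) : End ℝ V :=
  ip.form.leftAdjointOfNondegenerate ip.nondegenerate A

/-- The symmetric part `S(A) = (A + A^*) / 2` of `A`. -/
noncomputable def symmPart (A : End ℝ V) : End ℝ V :=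
  (1 / 2 : ℝ) • (A + ip.adjoint A)

/-- The operator `T` associated with a bilinear form `β`, that is, `⟨T x, y⟩ = β x y`. -/
noncomputable def operatorOf (β : LinearMap.BilinForm ℝ V) : End ℝ V :=
  β.symmCompOfNondegenerate ip.form ip.nondegenerate

end LinearAlgebra

end RealInnerProduct

section TraceForm

variable {V : Type*} [AddCommGroup V] [Module ℝ V] [FiniteDimensional ℝ V]

/-- Every linear functional on `End V` is `A ↦ Tr (R ∘ A)` for exactly one `R`. -/
theorem existsUnique_trace_mul (φ : End ℝ V →ₗ[ℝ] ℝ) :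
    ∃! R : End ℝ V, ∀ A : End ℝ V, LinearMap.trace ℝ V (R * A) = φ A := by
  let T : End ℝ V →ₗ[ℝ] Dual ℝ (End ℝ V) :=
    LinearMap.compr₂ (LinearMap.mul ℝ (End ℝ V)) (LinearMap.trace ℝ V)
  have hT : ∀ R A, T R A = LinearMap.trace ℝ V (R * A) := fun R A => rfl
  have hinj : Function.Injective T := by
    rw [← LinearMap.ker_eq_bot, LinearMap.ker_eq_bot']
    intro R hR
    ext x
    rw [LinearMap.zero_apply, ← Module.forall_dual_apply_eq_zero_iff ℝ]
    intro f
    have h : T R (f.smulRight x) = 0 := by rw [hR]; rfl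
    rw [hT] at h
    have h2 : R * f.smulRight x = f.smulRight (R x) := by
      ext y
      simp
    rw [h2, LinearMap.trace_smulRight] at h
    exact h
  have hbij : Function.Bijective T :=
    ⟨hinj, (LinearMap.injective_iff_surjective_of_finrank_eq_finrank
      Subspace.dual_finrank_eq.symm).1 hinj⟩
  obtain ⟨R, hR, hu⟩ := hbij.existsUnique φ
  refine ⟨R, fun A => by rw [← hT, hR], fun R' hR' => hu R' ?_⟩
  ext A
  rw [hT, hR']

end TraceForm

namespace RealInnerProduct

section MetricLieAlgebra

variable {𝔤 : Type*} [LieRing 𝔤] [LieAlgebra ℝ 𝔤]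

/-- The coboundary `δ(A)(X, Y) = -A[X, Y] + [A X, Y] + [X, A Y]` of an endomorphism `A`. -/
def coboundary (A : End ℝ 𝔤) (X Y : 𝔤) : 𝔤 := -A ⁅X, Y⁆ + ⁅A X, Y⁆ + ⁅X, A Y⁆

/-- The inner product is standard: the orthogonal complement to the derived algebra `[𝔤, 𝔤]`
is abelian. -/
def IsStandard (ip : RealInnerProduct 𝔤) : Prop :=
  ∀ X Y : 𝔤,
    (∀ Z ∈ LieAlgebra.derivedSeries ℝ 𝔤 1, ip.form X Z = 0) →
    (∀ Z ∈ LieAlgebra.derivedSeries ℝ 𝔤 1, ip.form Y Z = 0) → ⁅X, Y⁆ = 0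

variable [FiniteDimensional ℝ 𝔤] (ip : RealInnerProduct 𝔤)

/-- The mean curvature vector `H`, that is, `⟨H, X⟩ = Tr (ad X)`. -/
noncomputable def meanCurvature : 𝔤 :=
  (ip.form.toDual ip.nondegenerate).symm
    (LinearMap.trace ℝ 𝔤 ∘ₗ (LieAlgebra.ad ℝ 𝔤 : 𝔤 →ₗ[ℝ] End ℝ 𝔤))

/-- `Ξ(A₁, A₂) = ∑ i j, ⟨δ(A₁)(E i, E j), δ(A₂)(E i, E j)⟩` for an orthonormal basis `E`. -/
noncomputable def xi (A₁ A₂ : End ℝ 𝔤) : ℝ :=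
  ∑ i, ∑ j, ip.form
    (coboundary A₁ (ip.orthonormalBasis i) (ip.orthonormalBasis j))
    (coboundary A₂ (ip.orthonormalBasis i) (ip.orthonormalBasis j))

/-- `Ξ` does not depend on the choice of the orthonormal basis. -/
theorem xi_eq_sum {ι : Type*} [Fintype ι] [DecidableEq ι] {E : Basis ι ℝ 𝔤}
    (hE : ip.IsOrthonormal E) (A₁ A₂ : End ℝ 𝔤) :
    ip.xi A₁ A₂ = ∑ i, ∑ j, ip.form (coboundary A₁ (E i) (E j)) (coboundary A₂ (E i) (E j)) := by
  let δ : End ℝ 𝔤 → (𝔤 →ₗ[ℝ] 𝔤 →ₗ[ℝ] 𝔤) := fun A =>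
    LinearMap.mk₂ ℝ (coboundary A)
      (fun X X' Y => by simp only [coboundary, map_add, add_lie, neg_add]; abel)
      (fun c X Y => by simp only [coboundary, map_smul, smul_lie, smul_add, smul_neg])
      (fun X Y Y' => by simp only [coboundary, map_add, lie_add, neg_add]; abel)
      (fun c X Y => by simp only [coboundary, map_smul, lie_smul, smul_add, smul_neg])
  have hO := ip.isOrthonormal_orthonormalBasis
  have h1 : ∀ X : 𝔤, ∑ j, ip.form (coboundary A₁ X (ip.orthonormalBasis j))
      (coboundary A₂ X (ip.orthonormalBasis j)) =
      ∑ j, ip.form (coboundary A₁ X (E j)) (coboundary A₂ X (E j)) := fun X =>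
    ip.sum_eq_sum hO hE (ip.form.compl₁₂ (δ A₁ X) (δ A₂ X))
  have h2 : ∀ Y : 𝔤, ∑ i, ip.form (coboundary A₁ (ip.orthonormalBasis i) Y)
      (coboundary A₂ (ip.orthonormalBasis i) Y) =
      ∑ i, ip.form (coboundary A₁ (E i) Y) (coboundary A₂ (E i) Y) := fun Y =>
    ip.sum_eq_sum hO hE (ip.form.compl₁₂ ((δ A₁).flip Y) ((δ A₂).flip Y))
  simp only [xi, h1]
  rw [Finset.sum_comm]
  simp only [h2]
  exact Finset.sum_comm

/-- `R` is the Ricci operator: `Tr ((R + S(ad H) + B / 2) ∘ A) = - Ξ(A, id) / 4` for all `A`,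
where `B` is the operator of the Killing form. -/
def IsRicciOperator (R : End ℝ 𝔤) : Prop :=
  ∀ A : End ℝ 𝔤,
    LinearMap.trace ℝ 𝔤
      ((R + ip.symmPart (LieAlgebra.ad ℝ 𝔤 ip.meanCurvature) +
        (1 / 2 : ℝ) • ip.operatorOf (killingForm ℝ 𝔤)) * A) =
    -(1 / 4 : ℝ) * ip.xi A LinearMap.id

theorem existsUnique_isRicciOperator : ∃! R : End ℝ 𝔤, ip.IsRicciOperator R := by
  let φ : End ℝ 𝔤 →ₗ[ℝ] ℝ :=
    { toFun := fun A => -(1 / 4 : ℝ) * ip.xi A LinearMap.id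
      map_add' := by
        intro A A'
        rw [← mul_add]
        congr 1
        simp only [xi, ← Finset.sum_add_distrib]
        refine Finset.sum_congr rfl fun i _ => Finset.sum_congr rfl fun j _ => ?_
        rw [← LinearMap.add_apply, ← map_add]
        congr 2
        simp only [coboundary, LinearMap.add_apply, add_lie, lie_add]
        abel
      map_smul' := by
        intro c A
        simp only [xi, Finset.mul_sum, RingHom.id_apply, smul_eq_mul]
        refine Finset.sum_congr rfl fun i _ => Finset.sum_congr rfl fun j _ => ?_
        have h : ∀ X Y : 𝔤, coboundary (c • A) X Y = c • coboundary A X Y := by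
          intro X Y
          simp [coboundary, smul_add]
        rw [h, map_smul, LinearMap.smul_apply, smul_eq_mul]
        ring }
  obtain ⟨R, hR, hu⟩ := existsUnique_trace_mul φ
  set K : End ℝ 𝔤 := ip.symmPart (LieAlgebra.ad ℝ 𝔤 ip.meanCurvature) +
    (1 / 2 : ℝ) • ip.operatorOf (killingForm ℝ 𝔤) with hK
  refine ⟨R - K, fun A => ?_, fun R' hR' => ?_⟩
  · rw [add_assoc, ← hK, sub_add_cancel]
    exact hR A
  · rw [eq_sub_iff_add_eq]
    refine hu _ fun A => ?_
    rw [hK, ← add_assoc]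
    exact hR' A

/-- The Ricci operator of the metric Lie algebra `(𝔤, ip)`. -/
noncomputable def ricciOperator : End ℝ 𝔤 :=
  ip.existsUnique_isRicciOperator.choose

theorem isRicciOperator_ricciOperator : ip.IsRicciOperator ip.ricciOperator :=
  ip.existsUnique_isRicciOperator.choose_spec.1

/-- The inner product is Einstein: the Ricci operator is a multiple of the identity. -/
def IsEinstein : Prop :=
  ∃ c : ℝ, ip.ricciOperator = c • LinearMap.id

end MetricLieAlgebra

end RealInnerProduct

/-- `N` is the nilradical of `𝔤`: the greatest ideal that is nilpotent as a Lie algebra. -/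
def IsNilradical {𝔤 : Type*} [LieRing 𝔤] [LieAlgebra ℝ 𝔤] (N : LieIdeal ℝ 𝔤) : Prop :=
  IsGreatest {I : LieIdeal ℝ 𝔤 | LieRing.IsNilpotent I} N

/-!
The theorem holds because every Einstein solvable metric Lie algebra is standard, whatever its
nilradical `𝔫` is; the argument tests the Einstein equation on an operator that is canonically
attached to `𝔫`, in the spirit of Lauret's proof.

Consider weighted bases `(e, lam)` of a complex algebra such that products of basis vectors of the
weights `a` and `b` only involve basis vectors of weight at least `a + b`, and minimize
`∑ (lam i - 1) ^ 2` among them. Only finitely many cones of weights occur, so that a minimum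
exists. Two chains of subspaces have a common adapted basis, and the energy is strictly convex
there, so that all minimizers define the same filtration (`IsOptimal.weightFiltration_eq`). The
filtration is therefore invariant under automorphisms, derivations and complex conjugation, and it
descends to the real Lie algebra `𝔫`, where it has an adapted orthonormal basis. Varying the
weights along the real parts of the eigenvalues of a derivation `D` yields
`∑ (lam i - 1) * D i i ≥ 0`, and scaling the weights yields `∑ lam i ^ 2 = ∑ lam i`
(`exists_isOptimalBasis`).

Let `c` be the Einstein constant and `H` the mean curvature vector. If `H = 0`, tests with
projections show that the metric is flat, with an abelian nilradical and an abelian complement of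
it (`RealInnerProduct.isStandard_of_meanCurvature_eq_zero`). If `H ≠ 0`, the operator `lam` on
`𝔫`, extended by zero, is inserted in the Einstein equation. The quadratic side is nonnegative by
the choice of the weights, while the other side is nonpositive by the trace inequality for
`D = ad H`, the Einstein identity for `ad H` and the Cauchy–Schwarz inequality. The equality case
says that the weight operator `L` is a derivation of the whole algebra, that the symmetric part of
`ad H` is a positive multiple of `L`, and that `c < 0`
(`RealInnerProduct.exists_derivation_of_meanCurvature_ne_zero`).

Vectors orthogonal to the derived algebra lie in the kernel of `L`, and so do their brackets,
which lie in `𝔫`; it remains to see that `L` is injective on `𝔫`. Otherwise the subalgebra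
`𝔫 ⊓ ker L` has a nonzero center. The Einstein equation for the commutators of the operators
`ad z` on `𝔫`, for central `z`, with their adjoints shows that these operators are normal
(`RealInnerProduct.SplitsAlong.lie_eq_zero_of_mem_kerCenter`). Being nilpotent, they vanish, and
the test with the projection onto that center contradicts `c < 0`
(`RealInnerProduct.SplitsAlong.eq_zero_of_mem_ker`).
-/

/-! ### Bases adapted to chains of subspaces -/

section AdaptedBases

variable {k V : Type*} [Field k] [AddCommGroup V] [Module k V]

/-- The basis `b` is adapted to the subspace `C`: the basis vectors that occur in the expansions of
elements of `C` lie in `C`, that is, `C` is spanned by a part of `b`. -/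
def BasisAdaptedTo {ι : Type*} (b : Basis ι k V) (C : Submodule k V) : Prop :=
  ∀ x ∈ C, ∀ i, b.repr x i ≠ 0 → b i ∈ C

/-- A basis of a hyperplane `ker ξ` is completed by a vector `x` with `ξ x = 1`. The completed basis
is adapted to every subspace `C` that contains `x` or lies in the hyperplane, provided that the basis
of the hyperplane is adapted to the trace of `C`. -/
theorem exists_basis_cons {n : ℕ} {x : V} {ξ : V →ₗ[k] k} (hx : ξ x = 1)
    (bU : Basis (Fin n) k (LinearMap.ker ξ)) :
    ∃ b : Basis (Fin (n + 1)) k V, b 0 = x ∧ (∀ i, b (Fin.succ i) = bU i) ∧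
      ∀ C : Submodule k V, (x ∈ C ∨ C ≤ LinearMap.ker ξ) →
        BasisAdaptedTo bU (C.comap (LinearMap.ker ξ).subtype) → BasisAdaptedTo b C := by
  have hmem : ∀ z : V, z - ξ z • x ∈ LinearMap.ker ξ := by
    intro z
    simp [hx]
  let b : Basis (Fin (n + 1)) k V := Basis.mkFinCons x bU
    (by
      intro c y hy h
      have := congrArg ξ h
      simpa [hx, LinearMap.mem_ker.1 hy] using this)
    (fun z => ⟨-ξ z, by simpa [sub_eq_add_neg] using hmem z⟩)
  have hb0 : b 0 = x := by simp [b]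
  have hbs : ∀ i, b (Fin.succ i) = bU i := by intro i; simp [b]
  refine ⟨b, hb0, hbs, ?_⟩
  have hrepr : ∀ z, ∀ i, b.repr z i =
      (Fin.cons (ξ z) (fun j => bU.repr ⟨z - ξ z • x, hmem z⟩ j) : Fin (n + 1) → k) i := by
    intro z i
    have h1 : z = ∑ i, (Fin.cons (ξ z) (fun j => bU.repr ⟨z - ξ z • x, hmem z⟩ j) :
        Fin (n + 1) → k) i • b i := by
      rw [Fin.sum_univ_succ]
      simp only [Fin.cons_zero, Fin.cons_succ, hb0, hbs]
      have h2 := congrArg (Submodule.subtype _) (bU.sum_repr ⟨z - ξ z • x, hmem z⟩)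
      simp only [map_sum, map_smul, Submodule.subtype_apply] at h2
      rw [h2]
      simp
    conv_lhs => rw [h1]
    rw [Basis.repr_sum_self]
  intro C hC hU z hz i hi
  rw [hrepr] at hi
  by_cases hξ : ξ z = 0
  · have hz' : z - ξ z • x ∈ C := by simpa [hξ] using hz
    refine Fin.cases (fun h => ?_) (fun j h => ?_) i hi
    · simp [hξ] at h
    · rw [hbs]
      exact hU ⟨z - ξ z • x, hmem z⟩ hz' j (by simpa using h)
  · have hxC : x ∈ C := hC.resolve_right fun h => hξ (h hz)
    refine Fin.cases (fun _ => ?_) (fun j h => ?_) i hi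
    · rwa [hb0]
    · rw [hbs]
      exact hU ⟨z - ξ z • x, hmem z⟩ (C.sub_mem hz (C.smul_mem _ hxC)) j (by simpa using h)

theorem finrank_ker_of_apply_eq_one [FiniteDimensional k V] {x : V} {ξ : V →ₗ[k] k} (hx : ξ x = 1)
    {n : ℕ} (hn : finrank k V = n + 1) : finrank k (LinearMap.ker ξ) = n := by
  have h := LinearMap.finrank_range_add_finrank_ker ξ
  have hr : LinearMap.range ξ = ⊤ := by
    rw [LinearMap.range_eq_top]
    intro c
    exact ⟨c • x, by simp [hx]⟩
  rw [hr, finrank_top, finrank_self] at h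
  omega

/-- A chain of subspaces has a nonzero vector that lies in all nonzero members. -/
theorem exists_ne_zero_mem_of_isChain [FiniteDimensional k V] [Nontrivial V]
    {S : Set (Submodule k V)} (hS : IsChain (· ≤ ·) S) :
    ∃ x : V, x ≠ 0 ∧ ∀ C ∈ S, C ≠ ⊥ → x ∈ C := by
  by_cases h : ∃ C ∈ S, C ≠ ⊥
  · obtain ⟨C₀, ⟨hC₀, hne⟩, hmin⟩ := WellFounded.has_min (wellFounded_lt (α := Submodule k V))
      {C | C ∈ S ∧ C ≠ ⊥} h
    obtain ⟨x, hx, hx0⟩ := Submodule.exists_mem_ne_zero_of_ne_bot hne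
    refine ⟨x, hx0, fun C hC hCne => ?_⟩
    rcases hS.total hC₀ hC with h1 | h1
    · exact h1 hx
    · rcases h1.lt_or_eq with h2 | h2
      · exact absurd h2 (hmin C ⟨hC, hCne⟩)
      · exact h2 ▸ hx
  · push Not at h
    obtain ⟨x, hx⟩ := exists_ne (0 : V)
    exact ⟨x, hx, fun C hC hne => absurd (h C hC) hne⟩

/-- For a nonzero vector `x`, the members of a chain that avoid `x` lie in a common hyperplane
that avoids `x`. -/
theorem exists_functional_of_isChain [FiniteDimensional k V]
    {S : Set (Submodule k V)} (hS : IsChain (· ≤ ·) S) {x : V} (hx : x ≠ 0) :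
    ∃ ξ : V →ₗ[k] k, ξ x = 1 ∧ ∀ C ∈ S, x ∈ C ∨ C ≤ LinearMap.ker ξ := by
  obtain ⟨Q, hxQ, hQ⟩ : ∃ Q : Submodule k V, x ∉ Q ∧ ∀ C ∈ S, x ∉ C → C ≤ Q := by
    by_cases h : ∃ C ∈ S, x ∉ C
    · obtain ⟨C₀, ⟨hC₀, hne⟩, hmax⟩ := WellFounded.has_min (wellFounded_gt (α := Submodule k V))
        {C | C ∈ S ∧ x ∉ C} h
      refine ⟨C₀, hne, fun C hC hCne => ?_⟩
      rcases hS.total hC₀ hC with h1 | h1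
      · rcases h1.lt_or_eq with h2 | h2
        · exact absurd h2 (hmax C ⟨hC, hCne⟩)
        · exact h2.ge
      · exact h1
    · push Not at h
      exact ⟨⊥, by simpa using hx, fun C hC hne => absurd (h C hC) hne⟩
  obtain ⟨f, hf, hQf⟩ := Submodule.exists_le_ker_of_notMem hxQ
  refine ⟨(f x)⁻¹ • f, by simp [hf], fun C hC => ?_⟩
  by_cases hxC : x ∈ C
  · exact Or.inl hxC
  · refine Or.inr fun y hy => ?_
    have := LinearMap.mem_ker.1 (hQf (hQ C hC hxC hy))
    simp [this]

/-- Two chains of subspaces have a common adapted basis. -/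
theorem exists_basis_adaptedTo_of_isChain [FiniteDimensional k V] {n : ℕ} (hn : finrank k V = n)
    {S T : Set (Submodule k V)} (hS : IsChain (· ≤ ·) S) (hT : IsChain (· ≤ ·) T) :
    ∃ b : Basis (Fin n) k V,
      (∀ C ∈ S, BasisAdaptedTo b C) ∧ ∀ C ∈ T, BasisAdaptedTo b C := by
  induction n generalizing V with
  | zero =>
    have : Subsingleton V := finrank_zero_iff.1 hn
    refine ⟨Basis.empty V, ?_, ?_⟩ <;> exact fun C _ x _ i => i.elim0
  | succ n ih =>
    have : Nontrivial V := nontrivial_of_finrank_pos (R := k) (by omega)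
    obtain ⟨x, hx0, hxS⟩ := exists_ne_zero_mem_of_isChain hS
    obtain ⟨ξ, hξ, hξT⟩ := exists_functional_of_isChain hT hx0
    have hmono : ∀ {P : Set (Submodule k V)}, IsChain (· ≤ ·) P →
        IsChain (· ≤ ·) ((fun C => C.comap (LinearMap.ker ξ).subtype) '' P) := by
      rintro P hP _ ⟨C, hC, rfl⟩ _ ⟨C', hC', rfl⟩ -
      exact (hP.total hC hC').imp (Submodule.comap_mono ·) (Submodule.comap_mono ·)
    obtain ⟨bU, hU1, hU2⟩ := ih (finrank_ker_of_apply_eq_one hξ hn) (hmono hS) (hmono hT)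
    obtain ⟨b, -, -, hb⟩ := exists_basis_cons hξ bU
    refine ⟨b, fun C hC => hb C ?_ (hU1 _ ⟨C, hC, rfl⟩), fun C hC => hb C (hξT C hC)
      (hU2 _ ⟨C, hC, rfl⟩)⟩
    by_cases h : C = ⊥
    · exact Or.inr (h ▸ bot_le)
    · exact Or.inl (hxS C hC h)

end AdaptedBases

namespace RealInnerProduct

variable {V : Type*} [AddCommGroup V] [Module ℝ V]

/-- The restriction of an inner product to a subspace. -/
def restrict (ip : RealInnerProduct V) (U : Submodule ℝ V) : RealInnerProduct U where
  form := ip.form.compl₁₂ U.subtype U.subtype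
  symm x y := ip.symm x y
  pos x hx := ip.pos x (by simpa using hx)

theorem restrict_form (ip : RealInnerProduct V) (U : Submodule ℝ V) (x y : U) :
    (ip.restrict U).form x y = ip.form x y := rfl

/-- A chain of subspaces of a Euclidean space has an adapted orthonormal basis. -/
theorem exists_isOrthonormal_adaptedTo [FiniteDimensional ℝ V] (ip : RealInnerProduct V) {n : ℕ}
    (hn : finrank ℝ V = n) {S : Set (Submodule ℝ V)} (hS : IsChain (· ≤ ·) S) :
    ∃ b : Basis (Fin n) ℝ V, ip.IsOrthonormal b ∧ ∀ C ∈ S, BasisAdaptedTo b C := by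
  induction n generalizing V with
  | zero =>
    have : Subsingleton V := finrank_zero_iff.1 hn
    exact ⟨Basis.empty V, fun i => i.elim0, fun C _ x _ i => i.elim0⟩
  | succ n ih =>
    have : Nontrivial V := nontrivial_of_finrank_pos (R := ℝ) (by omega)
    obtain ⟨y, hy0, hyS⟩ := exists_ne_zero_mem_of_isChain hS
    have hpos := ip.pos y hy0
    have hs := Real.sqrt_pos.2 hpos
    set x : V := (Real.sqrt (ip.form y y))⁻¹ • y with hxdef
    have hx1 : ip.form x x = 1 := by
      have h2 := Real.mul_self_sqrt hpos.le
      simp only [hxdef, map_smul, LinearMap.smul_apply, smul_eq_mul]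
      field_simp
      rw [sq, h2]
    have hξ : ip.form x x = 1 := hx1
    have hmono : IsChain (· ≤ ·)
        ((fun C : Submodule ℝ V => C.comap (LinearMap.ker (ip.form x)).subtype) '' S) := by
      rintro _ ⟨C, hC, rfl⟩ _ ⟨C', hC', rfl⟩ -
      exact (hS.total hC hC').imp (Submodule.comap_mono ·) (Submodule.comap_mono ·)
    obtain ⟨bU, hU1, hU2⟩ := ih (ip.restrict (LinearMap.ker (ip.form x)))
      (finrank_ker_of_apply_eq_one hξ hn) hmono
    obtain ⟨b, hb0, hbs, hb⟩ := exists_basis_cons hξ bU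
    have hker : ∀ j, ip.form x (bU j) = 0 := fun j => LinearMap.mem_ker.1 (bU j).2
    refine ⟨b, fun i j => ?_, fun C hC => hb C ?_ (hU2 _ ⟨C, hC, rfl⟩)⟩
    · refine Fin.cases ?_ (fun i => ?_) i <;> refine Fin.cases ?_ (fun j => ?_) j
      · simp [hb0, hx1]
      · simp [hb0, hbs, hker, (Fin.succ_ne_zero j).symm]
      · rw [hb0, hbs, ip.symm, hker]
        simp [Fin.succ_ne_zero i]
      · rw [hbs, hbs]
        have := hU1 i j
        rw [restrict_form] at this
        simpa using this
    · by_cases h : C = ⊥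
      · exact Or.inr (h ▸ bot_le)
      · exact Or.inl (C.smul_mem _ (hyS C hC h))

end RealInnerProduct

/-! ### Weighted bases and their filtrations -/

section WeightFiltration

variable {k W : Type*} [Field k] [AddCommGroup W] [Module k W] {ι κ : Type*}

/-- The decreasing filtration of `W` defined by a basis `e` with real weights `lam`: the member at
level `a` is spanned by the basis vectors of weight at least `a`. -/
def weightFiltration (e : Basis ι k W) (lam : ι → ℝ) (a : ℝ) : Submodule k W where
  carrier := {x | ∀ i, e.repr x i ≠ 0 → a ≤ lam i}
  add_mem' := by
    intro x y hx hy i h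
    by_cases h1 : e.repr x i = 0
    · refine hy i fun h2 => h ?_
      simp [h1, h2]
    · exact hx i h1
  zero_mem' := by simp
  smul_mem' := by
    intro c x hx i h
    refine hx i fun h1 => h ?_
    simp [h1]

theorem mem_weightFiltration {e : Basis ι k W} {lam : ι → ℝ} {a : ℝ} {x : W} :
    x ∈ weightFiltration e lam a ↔ ∀ i, e.repr x i ≠ 0 → a ≤ lam i := Iff.rfl

theorem weightFiltration_antitone (e : Basis ι k W) (lam : ι → ℝ) :
    Antitone (weightFiltration e lam) := fun _ _ hab _ hx i hi => hab.trans (hx i hi)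

theorem isChain_range_weightFiltration (e : Basis ι k W) (lam : ι → ℝ) :
    IsChain (· ≤ ·) (Set.range (weightFiltration e lam)) :=
  (weightFiltration_antitone e lam).isChain_range

theorem basis_mem_weightFiltration {e : Basis ι k W} {lam : ι → ℝ} {a : ℝ} {i : ι} :
    e i ∈ weightFiltration e lam a ↔ a ≤ lam i := by
  classical
  constructor
  · intro h
    exact h i (by simp)
  · intro h j hj
    by_cases hij : i = j
    · exact hij ▸ h
    · simp [hij] at hj

theorem weightFiltration_eq_of_mem_iff {e : Basis ι k W} {lam : ι → ℝ} {b : Basis κ k W}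
    {lam' : κ → ℝ} (hb : ∀ a, BasisAdaptedTo b (weightFiltration e lam a))
    (h : ∀ i a, b i ∈ weightFiltration e lam a ↔ a ≤ lam' i) (a : ℝ) :
    weightFiltration b lam' a = weightFiltration e lam a := by
  ext x
  constructor
  · intro hx
    rw [← b.linearCombination_repr x, Finsupp.linearCombination_apply]
    exact Submodule.sum_mem _ fun i hi =>
      Submodule.smul_mem _ _ ((h i a).2 (hx i (Finsupp.mem_support_iff.1 hi)))
  · exact fun hx i hi => (h i a).1 (hb a x hx i hi)

/-- A basis adapted to the filtration of a weighted basis carries weights that define the same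
filtration. -/
theorem exists_weights_of_adaptedTo {e : Basis ι k W} {lam : ι → ℝ} {b : Basis κ k W}
    (hb : ∀ a, BasisAdaptedTo b (weightFiltration e lam a)) :
    ∃ lam' : κ → ℝ, ∀ a, weightFiltration b lam' a = weightFiltration e lam a := by
  have hne : ∀ i, (e.repr (b i)).support.Nonempty := by
    intro i
    rw [Finsupp.support_nonempty_iff]
    simpa using b.ne_zero i
  refine ⟨fun i => (e.repr (b i)).support.inf' (hne i) lam,
    weightFiltration_eq_of_mem_iff hb fun i a => ?_⟩
  rw [Finset.le_inf'_iff, mem_weightFiltration]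
  simp

/-- Elements all of whose components have weight above `a` lie in a member of the filtration at a
level above `a`. -/
theorem exists_lt_mem_weightFiltration {e : Basis ι k W} {lam : ι → ℝ} {a : ℝ} {x : W}
    (hx : ∀ i, e.repr x i ≠ 0 → a < lam i) : ∃ a', a < a' ∧ x ∈ weightFiltration e lam a' := by
  by_cases h : (e.repr x).support.Nonempty
  · refine ⟨(e.repr x).support.inf' h lam, ?_, fun i hi => ?_⟩
    · rw [Finset.lt_inf'_iff]
      exact fun i hi => hx i (Finsupp.mem_support_iff.1 hi)
    · exact Finset.inf'_le _ (Finsupp.mem_support_iff.2 hi)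
  · rw [Finset.not_nonempty_iff_eq_empty, Finsupp.support_eq_empty] at h
    exact ⟨a + 1, by linarith, fun i hi => by simp [h] at hi⟩

variable [Fintype ι] [Fintype κ]

theorem trace_eq_sum_repr (e : Basis ι k W) (T : W →ₗ[k] W) :
    LinearMap.trace k W T = ∑ i, e.repr (T (e i)) i := by
  classical
  rw [LinearMap.trace_eq_matrix_trace k e, Matrix.trace]
  simp [LinearMap.toMatrix_apply]

end WeightFiltration

section WeightOperator

variable {W : Type*} [AddCommGroup W] [Module ℂ W] {ι κ : Type*}

/-- The operator that is diagonal in the basis `e` with the eigenvalues `lam`. -/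
noncomputable def weightOperator (e : Basis ι ℂ W) (lam : ι → ℝ) : W →ₗ[ℂ] W :=
  e.constr ℂ fun i => (lam i : ℂ) • e i

theorem weightOperator_basis (e : Basis ι ℂ W) (lam : ι → ℝ) (i : ι) :
    weightOperator e lam (e i) = (lam i : ℂ) • e i := by
  rw [weightOperator, Basis.constr_basis]

variable [Fintype ι] [Fintype κ]

theorem repr_weightOperator (e : Basis ι ℂ W) (lam : ι → ℝ) (x : W) (i : ι) :
    e.repr (weightOperator e lam x) i = lam i * e.repr x i := by
  classical
  conv_lhs => rw [← e.sum_repr x]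
  simp only [map_sum, map_smul, weightOperator_basis, Basis.repr_self, Finsupp.coe_finsetSum,
    Finset.sum_apply, Finsupp.smul_apply, smul_eq_mul, Finsupp.single_apply, mul_ite, mul_one,
    mul_zero, Finset.sum_ite_eq', Finset.mem_univ, if_true]
  exact mul_comm _ _

theorem trace_mul_weightOperator (e : Basis ι ℂ W) (lam : ι → ℝ) (T : W →ₗ[ℂ] W) :
    LinearMap.trace ℂ W (T ∘ₗ weightOperator e lam) = ∑ i, lam i * e.repr (T (e i)) i := by
  rw [trace_eq_sum_repr e]
  simp only [LinearMap.comp_apply, weightOperator_basis, map_smul, Finsupp.smul_apply, smul_eq_mul]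

theorem weightOperator_mem {e : Basis ι ℂ W} {lam : ι → ℝ} {a : ℝ} {x : W}
    (hx : x ∈ weightFiltration e lam a) : weightOperator e lam x ∈ weightFiltration e lam a := by
  intro i hi
  rw [repr_weightOperator] at hi
  exact hx i (right_ne_zero_of_mul hi)

theorem exists_weightOperator_sub_mem {e : Basis ι ℂ W} {lam : ι → ℝ} {a : ℝ} {x : W}
    (hx : x ∈ weightFiltration e lam a) :
    ∃ a', a < a' ∧ weightOperator e lam x - (a : ℂ) • x ∈ weightFiltration e lam a' := by
  refine exists_lt_mem_weightFiltration fun i hi => ?_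
  have h1 : e.repr (weightOperator e lam x - (a : ℂ) • x) i = (lam i - a) * e.repr x i := by
    rw [map_sub, map_smul, Finsupp.sub_apply, Finsupp.smul_apply, repr_weightOperator, smul_eq_mul,
      sub_mul]
  rw [h1] at hi
  have h2 := hx i (right_ne_zero_of_mul hi)
  refine lt_of_le_of_ne h2 fun h3 => left_ne_zero_of_mul hi ?_
  simp [h3]

/-- If two weighted bases define the same filtration, then the difference of their weight operators
strictly raises the filtration, so that `Tr (T ∘ A)` is the same for both weight operators `A`
whenever `T` preserves the filtration. -/
theorem sum_weights_mul_repr_eq {e : Basis ι ℂ W} {lam : ι → ℝ} {b : Basis κ ℂ W} {lam' : κ → ℝ}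
    (h : ∀ a, weightFiltration b lam' a = weightFiltration e lam a) {T : W →ₗ[ℂ] W}
    (hT : ∀ a, ∀ x ∈ weightFiltration e lam a, T x ∈ weightFiltration e lam a) :
    ∑ i, (lam i : ℂ) * e.repr (T (e i)) i = ∑ i, (lam' i : ℂ) * b.repr (T (b i)) i := by
  rw [← trace_mul_weightOperator, ← trace_mul_weightOperator, ← sub_eq_zero, ← map_sub,
    ← LinearMap.comp_sub, trace_eq_sum_repr e]
  refine Finset.sum_eq_zero fun i _ => ?_
  have hi : e i ∈ weightFiltration e lam (lam i) := basis_mem_weightFiltration.2 le_rfl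
  obtain ⟨a₁, h₁, hx₁⟩ := exists_weightOperator_sub_mem hi
  obtain ⟨a₂, h₂, hx₂⟩ := exists_weightOperator_sub_mem ((h _).symm ▸ hi)
  rw [h] at hx₂
  have hx : weightOperator e lam (e i) - weightOperator b lam' (e i) ∈
      weightFiltration e lam (min a₁ a₂) := by
    have := Submodule.sub_mem _ (weightFiltration_antitone e lam (min_le_left a₁ a₂) hx₁)
      (weightFiltration_antitone e lam (min_le_right a₁ a₂) hx₂)
    simpa using this
  by_contra hne
  have := hT _ _ hx i hne
  exact absurd this (not_le.2 (lt_min h₁ h₂))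

/-- The distance of the weights to the constant weight `1`; optimal weights minimize it. -/
def weightEnergy (lam : ι → ℝ) : ℝ := ∑ i, (lam i - 1) ^ 2

theorem weightEnergy_eq {e : Basis ι ℂ W} {lam : ι → ℝ} {b : Basis κ ℂ W} {lam' : κ → ℝ}
    (h : ∀ a, weightFiltration b lam' a = weightFiltration e lam a) :
    weightEnergy lam' = weightEnergy lam := by
  have h1 : ∑ i, lam i = ∑ i, lam' i := by
    have := sum_weights_mul_repr_eq h (T := LinearMap.id) (fun a x hx => hx)
    simp only [LinearMap.id_apply, Basis.repr_self, Finsupp.single_eq_same, mul_one] at this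
    exact_mod_cast this
  have hc : Fintype.card κ = Fintype.card ι := by
    rw [← Module.finrank_eq_card_basis b, Module.finrank_eq_card_basis e]
  have h2 := sum_weights_mul_repr_eq h (T := weightOperator e lam) (fun a x hx => weightOperator_mem hx)
  have h3 := sum_weights_mul_repr_eq h (T := weightOperator b lam')
    (fun a x hx => by rw [← h] at hx ⊢; exact weightOperator_mem hx)
  rw [← trace_mul_weightOperator, ← trace_mul_weightOperator] at h2 h3
  have h4 : ∑ i, lam i * lam i = ∑ i, lam' i * lam' i := by
    have : LinearMap.trace ℂ W (weightOperator e lam ∘ₗ weightOperator e lam) =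
        LinearMap.trace ℂ W (weightOperator b lam' ∘ₗ weightOperator b lam') := by
      rw [h2, ← h3]
      exact LinearMap.trace_mul_comm ℂ (weightOperator e lam) (weightOperator b lam')
    rw [trace_mul_weightOperator, trace_mul_weightOperator] at this
    simp only [weightOperator_basis, map_smul, Basis.repr_self, Finsupp.smul_apply,
      Finsupp.single_eq_same, smul_eq_mul, mul_one] at this
    exact_mod_cast this
  have h5 : ∀ x : ℝ, (x - 1) ^ 2 = x * x - 2 * x + 1 := fun x => by ring
  simp only [weightEnergy, h5, Finset.sum_add_distrib, Finset.sum_sub_distrib, ← Finset.mul_sum,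
    h1, h4]
  simp [hc]

end WeightOperator

/-! ### Optimal weights of an algebra -/

section Optimal

variable {W : Type*} [AddCommGroup W] [Module ℂ W] {ι κ : Type*} [Fintype ι] [Fintype κ]

/-- The weights `lam` of the basis `e` are compatible with the product `μ`: a product of basis
vectors has only components whose weight is at least the sum of the weights of the factors. -/
def WeightAdmissible (μ : W →ₗ[ℂ] W →ₗ[ℂ] W) (e : Basis ι ℂ W) (lam : ι → ℝ) : Prop :=
  ∀ i j l, e.repr (μ (e i) (e j)) l ≠ 0 → lam i + lam j ≤ lam l

theorem weightAdmissible_iff {μ : W →ₗ[ℂ] W →ₗ[ℂ] W} {e : Basis ι ℂ W} {lam : ι → ℝ} :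
    WeightAdmissible μ e lam ↔ ∀ a b, ∀ x ∈ weightFiltration e lam a,
      ∀ y ∈ weightFiltration e lam b, μ x y ∈ weightFiltration e lam (a + b) := by
  constructor
  · intro h a b x hx y hy
    rw [← e.sum_repr x, ← e.sum_repr y]
    simp only [map_sum, map_smul, LinearMap.sum_apply, LinearMap.smul_apply]
    refine Submodule.sum_mem _ fun j _ => ?_
    by_cases hj : e.repr y j = 0
    · simp [hj]
    refine Submodule.smul_mem _ _ (Submodule.sum_mem _ fun i _ => ?_)
    by_cases hi : e.repr x i = 0
    · simp [hi]
    exact Submodule.smul_mem _ _ fun l hl => (add_le_add (hx i hi) (hy j hj)).trans (h i j l hl)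
  · intro h i j l hl
    exact h _ _ _ (basis_mem_weightFiltration.2 le_rfl) _ (basis_mem_weightFiltration.2 le_rfl) l hl

theorem WeightAdmissible.of_weightFiltration_eq {μ : W →ₗ[ℂ] W →ₗ[ℂ] W} {e : Basis ι ℂ W}
    {lam : ι → ℝ} {b : Basis κ ℂ W} {lam' : κ → ℝ} (hA : WeightAdmissible μ e lam)
    (h : ∀ a, weightFiltration b lam' a = weightFiltration e lam a) :
    WeightAdmissible μ b lam' := by
  rw [weightAdmissible_iff] at hA ⊢
  simpa only [h] using hA

/-- The weighted basis `(e, lam)` minimizes the energy among all weighted bases that are compatible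
with the product. -/
structure IsOptimal {n : ℕ} (μ : W →ₗ[ℂ] W →ₗ[ℂ] W) (e : Basis (Fin n) ℂ W) (lam : Fin n → ℝ) :
    Prop where
  admissible : WeightAdmissible μ e lam
  le : ∀ (e' : Basis (Fin n) ℂ W) (lam' : Fin n → ℝ), WeightAdmissible μ e' lam' →
    weightEnergy lam ≤ weightEnergy lam'

/-- The energy attains its minimum on each cone given by the conditions `lam i + lam j ≤ lam l`. -/
theorem exists_min_weightEnergy (P : Set (ι × ι × ι)) :
    ∃ lam : ι → ℝ, (∀ p ∈ P, lam p.1 + lam p.2.1 ≤ lam p.2.2) ∧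
      ∀ lam' : ι → ℝ, (∀ p ∈ P, lam' p.1 + lam' p.2.1 ≤ lam' p.2.2) →
        weightEnergy lam ≤ weightEnergy lam' := by
  set d : ℝ := (Fintype.card ι : ℝ)
  have hd : 0 ≤ d := Nat.cast_nonneg _
  let K : Set (ι → ℝ) := {lam | ∀ p ∈ P, lam p.1 + lam p.2.1 ≤ lam p.2.2} ∩
    Set.pi Set.univ fun _ => Set.Icc (-d) (d + 2)
  have hclosed : IsClosed {lam : ι → ℝ | ∀ p ∈ P, lam p.1 + lam p.2.1 ≤ lam p.2.2} := by
    simp only [Set.ofPred_forall]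
    exact isClosed_biInter fun p _ => isClosed_le (by fun_prop) (by fun_prop)
  have hK : IsCompact K := (isCompact_univ_pi fun _ => isCompact_Icc).inter_left hclosed
  have h0 : (0 : ι → ℝ) ∈ K := by
    refine ⟨fun p _ => by simp, fun i _ => ⟨?_, ?_⟩⟩ <;> simp <;> linarith
  have hcont : Continuous (weightEnergy : (ι → ℝ) → ℝ) := by
    unfold weightEnergy
    fun_prop
  obtain ⟨lam, hlam, hmin⟩ := hK.exists_isMinOn ⟨0, h0⟩ hcont.continuousOn
  refine ⟨lam, hlam.1, fun lam' h' => ?_⟩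
  by_cases hb : lam' ∈ K
  · exact hmin hb
  · -- outside the box the energy exceeds the energy `card ι` of the zero weights
    refine (hmin h0).trans ?_
    have h1 : ∃ i, ¬ (lam' i ∈ Set.Icc (-d) (d + 2)) := by
      by_contra hcon
      push Not at hcon
      exact hb ⟨h', fun i _ => hcon i⟩
    obtain ⟨i, hi⟩ := h1
    have h2 : (lam' i - 1) ^ 2 ≤ weightEnergy lam' :=
      Finset.single_le_sum (f := fun i => (lam' i - 1) ^ 2) (fun _ _ => sq_nonneg _)
        (Finset.mem_univ i)
    have h3 : weightEnergy (0 : ι → ℝ) = d := by simp [weightEnergy, d]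
    refine h3.le.trans (le_trans ?_ h2)
    rw [Set.mem_Icc, not_and_or, not_le, not_le] at hi
    rcases hi with hi | hi <;> nlinarith

theorem exists_isOptimal [FiniteDimensional ℂ W] {n : ℕ} (hn : finrank ℂ W = n)
    (μ : W →ₗ[ℂ] W →ₗ[ℂ] W) :
    ∃ (e : Basis (Fin n) ℂ W) (lam : Fin n → ℝ), IsOptimal μ e lam := by
  -- only finitely many sets of nonvanishing structure constants occur
  let pat : Basis (Fin n) ℂ W → Set (Fin n × Fin n × Fin n) := fun e =>
    {p | e.repr (μ (e p.1) (e p.2.1)) p.2.2 ≠ 0}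
  choose m hm hmin using exists_min_weightEnergy (ι := Fin n)
  obtain ⟨_, ⟨e, rfl⟩, he⟩ := Set.exists_min_image (Set.range pat) (fun P => weightEnergy (m P))
    (Set.toFinite _) ⟨_, finBasisOfFinrankEq ℂ W hn, rfl⟩
  refine ⟨e, m (pat e), fun i j l h => hm (pat e) (i, j, l) h, fun e' lam' h' => ?_⟩
  exact (he _ ⟨e', rfl⟩).trans (hmin _ lam' fun p hp => h' _ _ _ hp)

/-- All optimal weighted bases define the same filtration: they have a common adapted basis, and on
the weights of one basis the energy is strictly convex. -/
theorem IsOptimal.weightFiltration_eq [FiniteDimensional ℂ W] {n : ℕ} {μ : W →ₗ[ℂ] W →ₗ[ℂ] W}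
    {e e' : Basis (Fin n) ℂ W} {lam lam' : Fin n → ℝ} (h : IsOptimal μ e lam)
    (h' : IsOptimal μ e' lam') (a : ℝ) :
    weightFiltration e lam a = weightFiltration e' lam' a := by
  obtain ⟨b, hb, hb'⟩ := exists_basis_adaptedTo_of_isChain (k := ℂ) (V := W) (n := n)
    (by simp [Module.finrank_eq_card_basis e])
    (isChain_range_weightFiltration e lam) (isChain_range_weightFiltration e' lam')
  obtain ⟨α, hα⟩ := exists_weights_of_adaptedTo fun a => hb _ ⟨a, rfl⟩
  obtain ⟨α', hα'⟩ := exists_weights_of_adaptedTo fun a => hb' _ ⟨a, rfl⟩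
  have hA := h.admissible.of_weightFiltration_eq hα
  have hA' := h'.admissible.of_weightFiltration_eq hα'
  have hE := weightEnergy_eq hα
  have hE' := weightEnergy_eq hα'
  have hmid := h.le b (fun i => (α i + α' i) / 2) fun i j l hl => by
    have h1 := hA i j l hl
    have h2 := hA' i j l hl
    linarith
  have hEE := le_antisymm (h.le _ _ h'.admissible) (h'.le _ _ h.admissible)
  have hpar : weightEnergy (fun i => (α i + α' i) / 2) =
      (weightEnergy α + weightEnergy α') / 2 - (∑ i, (α i - α' i) ^ 2) / 4 := by
    simp only [weightEnergy, ← Finset.sum_add_distrib, Finset.sum_div, ← Finset.sum_sub_distrib]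
    exact Finset.sum_congr rfl fun i _ => by ring
  have hsum : ∑ i, (α i - α' i) ^ 2 = 0 := by
    refine le_antisymm ?_ (Finset.sum_nonneg fun _ _ => sq_nonneg _)
    linarith
  have hαα : α = α' := by
    funext i
    have := (Finset.sum_eq_zero_iff_of_nonneg fun _ _ => sq_nonneg _).1 hsum i (Finset.mem_univ i)
    have := pow_eq_zero_iff (two_ne_zero) |>.1 this
    linarith
  rw [← hα, ← hα', hαα]

end Optimal

/-! ### Invariance of the optimal filtration -/

section Invariance

variable {W : Type*} {n : ℕ}

section Algebraic

variable [AddCommGroup W] [Module ℂ W] {μ : W →ₗ[ℂ] W →ₗ[ℂ] W} {e : Basis (Fin n) ℂ W}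
  {lam : Fin n → ℝ}

theorem IsOptimal.map (h : IsOptimal μ e lam) (φ : W ≃ₗ[ℂ] W)
    (hφ : ∀ x y, φ (μ x y) = μ (φ x) (φ y)) : IsOptimal μ (e.map φ) lam := by
  refine ⟨fun i j l hl => h.admissible i j l ?_, h.le⟩
  have h1 : φ.symm (μ (φ (e i)) (φ (e j))) = μ (e i) (e j) := by
    rw [← hφ, LinearEquiv.symm_apply_apply]
  simpa [h1] using hl

theorem IsOptimal.automorphism_mem [FiniteDimensional ℂ W] (h : IsOptimal μ e lam) (φ : W ≃ₗ[ℂ] W)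
    (hφ : ∀ x y, φ (μ x y) = μ (φ x) (φ y)) {a : ℝ} {x : W} (hx : x ∈ weightFiltration e lam a) :
    φ x ∈ weightFiltration e lam a := by
  rw [h.weightFiltration_eq (h.map φ hφ) a]
  intro i hi
  exact hx i (by simpa using hi)

/-- The optimal filtration is invariant under antilinear involutive automorphisms. -/
theorem IsOptimal.antilinear_mem [FiniteDimensional ℂ W] (h : IsOptimal μ e lam) (σ : W → W)
    (hadd : ∀ x y, σ (x + y) = σ x + σ y) (hsmul : ∀ (c : ℂ) x, σ (c • x) = star c • σ x)
    (hinv : ∀ x, σ (σ x) = x) (hσ : ∀ x y, σ (μ x y) = μ (σ x) (σ y)) {a : ℝ} {x : W}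
    (hx : x ∈ weightFiltration e lam a) : σ x ∈ weightFiltration e lam a := by
  let r : W ≃ₗ[ℂ] (Fin n → ℂ) :=
    { toFun := fun x i => star (e.repr (σ x) i)
      map_add' := fun x y => by
        funext i
        simp [hadd]
      map_smul' := fun c x => by
        funext i
        simp [hsmul]
      invFun := fun f => σ (∑ i, star (f i) • e i)
      left_inv := fun x => by
        simp only [star_star]
        rw [e.sum_repr, hinv]
      right_inv := fun f => by
        funext i
        simp only [hinv]
        rw [Basis.repr_sum_self, star_star] }
  let e' : Basis (Fin n) ℂ W := Basis.ofEquivFun r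
  have hrepr : ∀ x i, e'.repr x i = star (e.repr (σ x) i) := by
    intro x i
    simp [e', r]
  have hbasis : ∀ i, σ (e' i) = e i := by
    intro i
    apply e.repr.injective
    ext j
    have h1 := hrepr (e' i) j
    have h2 := congrArg star h1
    rw [star_star] at h2
    rw [← h2]
    simp only [Basis.repr_self, Finsupp.single_apply]
    split_ifs <;> simp
  have h' : IsOptimal μ e' lam := by
    refine ⟨fun i j l hl => h.admissible i j l ?_, h.le⟩
    rw [hrepr, hσ, hbasis, hbasis] at hl
    exact fun h0 => hl (by rw [h0, star_zero])
  rw [h'.weightFiltration_eq h a |>.symm] at hx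
  intro i hi
  refine hx i ?_
  rw [hrepr]
  exact fun h0 => hi (star_eq_zero.1 h0)

end Algebraic

variable [NormedAddCommGroup W] [NormedSpace ℂ W] [FiniteDimensional ℂ W]
  {μ : W →ₗ[ℂ] W →ₗ[ℂ] W} {e : Basis (Fin n) ℂ W} {lam : Fin n → ℝ}

theorem exp_smul_mul_exp_neg_smul (D : W →L[ℂ] W) (t : ℂ) :
    NormedSpace.exp (t • D) * NormedSpace.exp ((-t) • D) = 1 := by
  have : CompleteSpace W := FiniteDimensional.complete ℂ W
  let : NormedAlgebra ℚ (W →L[ℂ] W) := NormedAlgebra.restrictScalars ℚ ℂ _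
  have hc : Commute (t • D) ((-t) • D) := ((Commute.refl D).smul_left t).smul_right (-t)
  rw [← NormedSpace.exp_add_of_commute hc]
  simp

/-- The exponentials of a derivation are automorphisms. -/
theorem exp_smul_derivation {D : W →L[ℂ] W} (hD : ∀ x y, D (μ x y) = μ (D x) y + μ x (D y)) (t : ℂ)
    (x y : W) : NormedSpace.exp (t • D) (μ x y) =
      μ (NormedSpace.exp (t • D) x) (NormedSpace.exp (t • D) y) := by
  have : CompleteSpace W := FiniteDimensional.complete ℂ W
  let μc : W →L[ℂ] W →L[ℂ] W :=
    LinearMap.toContinuousLinearMap (LinearMap.toContinuousLinearMap.toLinearMap ∘ₗ μ)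
  have hμc : ∀ x y, μc x y = μ x y := fun x y => rfl
  set E : ℂ → (W →L[ℂ] W) := fun t => NormedSpace.exp (t • D) with hE
  have hder : ∀ t, HasDerivAt E (D * E t) t := fun t => hasDerivAt_exp_smul_const' D t
  have hder' : ∀ t, HasDerivAt (fun s => E (-s)) (-(E (-t) * D)) t := by
    intro t
    have h1 : HasDerivAt E (E (-t) * D) (-t) := hasDerivAt_exp_smul_const D (-t)
    have h2 := h1.scomp t (hasDerivAt_neg t)
    rw [neg_one_smul] at h2
    exact h2
  have happ : ∀ (z : W) t, HasDerivAt (fun s => E s z) (D (E t z)) t := by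
    intro z t
    have := (hder t).clm_apply (hasDerivAt_const t z)
    simpa using this
  have hinv : ∀ t, E t * E (-t) = 1 := exp_smul_mul_exp_neg_smul D
  have hE0 : E 0 = 1 := by simp [hE]
  have hconst : ∀ s, HasDerivAt (fun s => E (-s) (μc (E s x) (E s y))) 0 s := by
    intro s
    have h1 := ((μc.hasFDerivAt.comp_hasDerivAt s (happ x s)).clm_apply (happ y s))
    have h2 := (hder' s).clm_apply h1
    refine h2.congr_deriv ?_
    change -(E (-s) (D (μ (E s x) (E s y)))) +
      E (-s) (μ (D (E s x)) (E s y) + μ (E s x) (D (E s y))) = 0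
    rw [hD, neg_add_cancel]
  have heq := is_const_of_deriv_eq_zero (fun s => (hconst s).differentiableAt)
    (fun s => (hconst s).deriv) t 0
  simp only [neg_zero, hE0, hμc, one_apply_eq_self] at heq
  have h3 := congrArg (E t) heq
  rw [← mul_apply_eq_comp, hinv, one_apply_eq_self] at h3
  exact h3.symm

/-- The optimal filtration is invariant under derivations, because it is invariant under their
exponentials. -/
theorem IsOptimal.derivation_mem (h : IsOptimal μ e lam) {D : W →ₗ[ℂ] W}
    (hD : ∀ x y, D (μ x y) = μ (D x) y + μ x (D y)) {a : ℝ} {x : W}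
    (hx : x ∈ weightFiltration e lam a) : D x ∈ weightFiltration e lam a := by
  have : CompleteSpace W := FiniteDimensional.complete ℂ W
  set Dc : W →L[ℂ] W := LinearMap.toContinuousLinearMap D with hDc
  have hDc' : ∀ x, Dc x = D x := fun x => rfl
  have hexp := exp_smul_derivation (D := Dc) (μ := μ) hD
  have hinv := exp_smul_mul_exp_neg_smul Dc
  have hmem : ∀ t : ℂ, NormedSpace.exp (t • Dc) x ∈ weightFiltration e lam a := by
    intro t
    let φ : W ≃ₗ[ℂ] W := LinearEquiv.ofLinearMap
      (NormedSpace.exp (t • Dc) : W →L[ℂ] W).toLinearMap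
      (NormedSpace.exp ((-t) • Dc) : W →L[ℂ] W).toLinearMap
      (by
        ext z
        exact congrArg (fun f : W →L[ℂ] W => f z) (hinv t))
      (by
        ext z
        have := hinv (-t)
        rw [neg_neg] at this
        exact congrArg (fun f : W →L[ℂ] W => f z) this)
    exact h.automorphism_mem φ (fun y z => hexp t y z) hx
  intro i hi
  by_contra hai
  -- the `i`-th coordinate vanishes along the orbit, hence so does its derivative at `0`
  let c : W →L[ℂ] ℂ := LinearMap.toContinuousLinearMap (e.coord i)
  have h1 : HasDerivAt (fun t : ℂ => c ((NormedSpace.exp (t • Dc) : W →L[ℂ] W) x)) (c (D x)) 0 := by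
    have h2 := (hasDerivAt_exp_smul_const Dc (0 : ℂ)).clm_apply (hasDerivAt_const (0 : ℂ) x)
    have h3 := c.hasFDerivAt.comp_hasDerivAt (0 : ℂ) h2
    simpa [hDc', Function.comp_def] using h3
  have h4 : (fun t : ℂ => c ((NormedSpace.exp (t • Dc) : W →L[ℂ] W) x)) = fun _ => 0 := by
    funext t
    by_contra hne
    exact hai (hmem t i hne)
  rw [h4] at h1
  exact hi (h1.unique (hasDerivAt_const _ _))

end Invariance

/-! ### Properties of the optimal weights -/

section OptimalWeights

variable {W : Type*} {n : ℕ}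

/-- The optimal weights satisfy `∑ lam² = ∑ lam`, since their multiples are compatible with the
product, too. -/
theorem IsOptimal.sum_sq [AddCommGroup W] [Module ℂ W] {μ : W →ₗ[ℂ] W →ₗ[ℂ] W}
    {e : Basis (Fin n) ℂ W} {lam : Fin n → ℝ} (h : IsOptimal μ e lam) :
    ∑ i, lam i ^ 2 = ∑ i, lam i := by
  have key : ∀ s : ℝ, 0 ≤ s → (∑ i, lam i ^ 2) - 2 * ∑ i, lam i ≤
      s ^ 2 * (∑ i, lam i ^ 2) - 2 * s * ∑ i, lam i := by
    intro s hs
    have h1 := h.le e (fun i => s * lam i) fun i j l hl => by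
      have := h.admissible i j l hl
      nlinarith
    have h2 : ∀ x : ℝ, (x - 1) ^ 2 = x ^ 2 - 2 * x + 1 := fun x => by ring
    simp only [weightEnergy, h2, Finset.sum_add_distrib, Finset.sum_sub_distrib, mul_pow,
      ← Finset.mul_sum] at h1
    linarith
  set P := ∑ i, lam i ^ 2
  set Q := ∑ i, lam i
  have hP : 0 ≤ P := Finset.sum_nonneg fun _ _ => sq_nonneg _
  have h0 := key 0 le_rfl
  rcases hP.eq_or_lt with hP0 | hP0
  · have h2 := key 2 (by norm_num)
    nlinarith
  · have h3 := key (Q / P) (div_nonneg (by linarith) hP)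
    have h4 : (Q / P) ^ 2 * P - 2 * (Q / P) * Q = - (Q ^ 2 / P) := by
      field_simp
      ring
    rw [h4] at h3
    have h5 : (P - Q) ^ 2 ≤ 0 := by
      have h6 : (P - 2 * Q) * P ≤ -(Q ^ 2 / P) * P := mul_le_mul_of_nonneg_right h3 hP
      have h7 : -(Q ^ 2 / P) * P = -Q ^ 2 := by field_simp
      nlinarith
    nlinarith [sq_nonneg (P - Q)]

/-- The optimal weights of a Lie algebra are nonnegative: the filtration consists of ideals, so that
replacing the negative weights by zero is compatible with the bracket and lowers the energy. -/
theorem IsOptimal.weights_nonneg [NormedAddCommGroup W] [NormedSpace ℂ W] [FiniteDimensional ℂ W]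
    {μ : W →ₗ[ℂ] W →ₗ[ℂ] W} {e : Basis (Fin n) ℂ W} {lam : Fin n → ℝ} (h : IsOptimal μ e lam)
    (hskew : ∀ x y, μ x y = -μ y x) (hjac : ∀ x y z, μ x (μ y z) = μ (μ x y) z + μ y (μ x z))
    (i : Fin n) : 0 ≤ lam i := by
  have hright : ∀ i j l, e.repr (μ (e i) (e j)) l ≠ 0 → lam j ≤ lam l := fun i j l hl =>
    h.derivation_mem (D := μ (e i)) (hjac (e i)) (basis_mem_weightFiltration.2 le_rfl) l hl
  have hleft : ∀ i j l, e.repr (μ (e i) (e j)) l ≠ 0 → lam i ≤ lam l := fun i j l hl => by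
    refine hright j i l fun h0 => hl ?_
    rw [hskew]
    simp [h0]
  have hmax := h.le e (fun i => max (lam i) 0) fun i j l hl => by
    have h1 := h.admissible i j l hl
    have h2 := hright i j l hl
    have h3 := hleft i j l hl
    change max (lam i) 0 + max (lam j) 0 ≤ max (lam l) 0
    rcases max_cases (lam i) 0 with ⟨h4, h5⟩ | ⟨h4, h5⟩ <;>
      rcases max_cases (lam j) 0 with ⟨h6, h7⟩ | ⟨h6, h7⟩ <;>
      rcases max_cases (lam l) 0 with ⟨h8, h9⟩ | ⟨h8, h9⟩ <;> rw [h4, h6, h8] <;> linarith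
  by_contra hi
  push Not at hi
  refine absurd hmax (not_le.2 (Finset.sum_lt_sum (fun j _ => ?_) ⟨i, Finset.mem_univ i, ?_⟩))
  · change (max (lam j) 0 - 1) ^ 2 ≤ _
    rcases max_cases (lam j) 0 with ⟨h4, h5⟩ | ⟨h4, h5⟩ <;> rw [h4]
    nlinarith
  · change (max (lam i) 0 - 1) ^ 2 < _
    rw [max_eq_right hi.le]
    nlinarith

end OptimalWeights

/-! ### The optimality inequality for derivations -/

section Spectral

variable {W : Type*} [AddCommGroup W] [Module ℂ W]

/-- The sum of the generalized eigenspaces of `D` for the eigenvalues in `S`. -/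
def spectralSubspace (D : End ℂ W) (S : Set ℂ) : Submodule ℂ W :=
  ⨆ ν ∈ S, D.maxGenEigenspace ν

theorem spectralSubspace_mono (D : End ℂ W) {S T : Set ℂ} (h : S ⊆ T) :
    spectralSubspace D S ≤ spectralSubspace D T := biSup_mono h

theorem maxGenEigenspace_le_spectralSubspace (D : End ℂ W) {S : Set ℂ} {ν : ℂ} (h : ν ∈ S) :
    D.maxGenEigenspace ν ≤ spectralSubspace D S := le_biSup (fun ν => D.maxGenEigenspace ν) h

theorem apply_sub_smul_mem_maxGenEigenspace {D : End ℂ W} {ν : ℂ} (c : ℂ) {x : W}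
    (hx : x ∈ D.maxGenEigenspace ν) : D x - c • x ∈ D.maxGenEigenspace ν :=
  Submodule.sub_mem _ (Module.End.mapsTo_maxGenEigenspace_of_comm (Commute.refl D) ν hx)
    (Submodule.smul_mem _ _ hx)

theorem apply_sub_smul_mem_spectralSubspace {D : End ℂ W} {S : Set ℂ} (c : ℂ) {x : W}
    (hx : x ∈ spectralSubspace D S) : D x - c • x ∈ spectralSubspace D S := by
  suffices h : spectralSubspace D S ≤ (spectralSubspace D S).comap (D - c • 1) from h hx
  refine iSup₂_le fun ν hν y hy => ?_
  exact maxGenEigenspace_le_spectralSubspace D hν (apply_sub_smul_mem_maxGenEigenspace c hy)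

/-- For a derivation, the product of generalized eigenvectors is a generalized eigenvector for the
sum of the eigenvalues. -/
theorem mul_mem_maxGenEigenspace {μ : W →ₗ[ℂ] W →ₗ[ℂ] W} {D : End ℂ W}
    (hD : ∀ x y, D (μ x y) = μ (D x) y + μ x (D y)) {α β : ℂ} {x y : W}
    (hx : x ∈ D.maxGenEigenspace α) (hy : y ∈ D.maxGenEigenspace β) :
    μ x y ∈ D.maxGenEigenspace (α + β) := by
  rw [Module.End.mem_maxGenEigenspace] at hx hy
  obtain ⟨p, hp⟩ := hx
  obtain ⟨q, hq⟩ := hy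
  have hstep : ∀ z : W, (D - (α + β) • 1) z ∈ D.maxGenEigenspace (α + β) →
      z ∈ D.maxGenEigenspace (α + β) := by
    intro z hz
    rw [Module.End.mem_maxGenEigenspace] at hz ⊢
    obtain ⟨k, hk⟩ := hz
    exact ⟨k + 1, by rw [pow_succ, Module.End.mul_apply, hk]⟩
  have hleib : ∀ x y : W, (D - (α + β) • 1) (μ x y) =
      μ ((D - α • 1) x) y + μ x ((D - β • 1) y) := by
    intro x y
    simp only [LinearMap.sub_apply, LinearMap.smul_apply, Module.End.one_apply, hD, map_sub,
      map_smul, add_smul, LinearMap.add_apply]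
    abel
  have main : ∀ m p q : ℕ, p + q = m → ∀ x y : W, ((D - α • 1) ^ p) x = 0 → ((D - β • 1) ^ q) y = 0 →
      μ x y ∈ D.maxGenEigenspace (α + β) := by
    intro m
    induction m with
    | zero =>
      intro p q hpq x y hx _
      obtain rfl : p = 0 := by omega
      have hx0 : x = 0 := by simpa using hx
      simp [hx0]
    | succ m ih =>
      intro p q hpq x y hx hy
      rcases p with _ | p
      · have hx0 : x = 0 := by simpa using hx
        simp [hx0]
      rcases q with _ | q
      · have hy0 : y = 0 := by simpa using hy
        simp [hy0]
      apply hstep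
      rw [hleib]
      rw [pow_succ, Module.End.mul_apply] at hx hy
      refine Submodule.add_mem _ (ih p (q + 1) (by omega) _ _ hx ?_)
        (ih (p + 1) q (by omega) _ _ ?_ hy)
      · rw [pow_succ, Module.End.mul_apply, hy]
      · rw [pow_succ, Module.End.mul_apply, hx]
  exact main _ p q rfl x y hp hq

theorem mul_mem_spectralSubspace {μ : W →ₗ[ℂ] W →ₗ[ℂ] W} {D : End ℂ W}
    (hD : ∀ x y, D (μ x y) = μ (D x) y + μ x (D y)) {S T U : Set ℂ}
    (hU : ∀ α ∈ S, ∀ β ∈ T, α + β ∈ U) {x y : W} (hx : x ∈ spectralSubspace D S)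
    (hy : y ∈ spectralSubspace D T) : μ x y ∈ spectralSubspace D U := by
  have h1 : ∀ α ∈ S, ∀ x ∈ D.maxGenEigenspace α, ∀ y ∈ spectralSubspace D T,
      μ x y ∈ spectralSubspace D U := by
    intro α hα x hx y hy
    suffices h : spectralSubspace D T ≤ (spectralSubspace D U).comap (μ x) from h hy
    exact iSup₂_le fun β hβ z hz =>
      maxGenEigenspace_le_spectralSubspace D (hU α hα β hβ) (mul_mem_maxGenEigenspace hD hx hz)
  suffices h : spectralSubspace D S ≤ (spectralSubspace D U).comap (μ.flip y) from h hx
  exact iSup₂_le fun α hα z hz => h1 α hα z hz y hy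

/-- The lexicographic order key of a complex number: first the real, then the imaginary part. -/
def lexKey (z : ℂ) : ℝ ×ₗ ℝ := toLex (z.re, z.im)

theorem lexKey_injective : Function.Injective lexKey := by
  intro z w h
  have h1 := toLex.injective h
  rw [Prod.mk.injEq] at h1
  exact Complex.ext h1.1 h1.2

theorem re_le_of_lexKey_le {z w : ℂ} (h : lexKey z ≤ lexKey w) : z.re ≤ w.re := by
  rw [lexKey, lexKey, Prod.Lex.toLex_le_toLex] at h
  rcases h with h | h
  · exact h.le
  · exact h.1.le

theorem lexKey_lt_of_re_lt {z w : ℂ} (h : z.re < w.re) : lexKey z < lexKey w := by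
  rw [lexKey, lexKey, Prod.Lex.toLex_lt_toLex]
  exact Or.inl h

/-- The members of a flag in which `D` is triangular: the generalized eigenspaces for the
eigenvalues above `ν` in the lexicographic order, and the kernel of `(D - ν) ^ m`. -/
def triangularFlag (D : End ℂ W) (ν : ℂ) (m : ℕ) : Submodule ℂ W :=
  spectralSubspace D {ν' | lexKey ν < lexKey ν'} ⊔ LinearMap.ker ((D - ν • 1) ^ m)

theorem ker_pow_le_maxGenEigenspace (D : End ℂ W) (ν : ℂ) (m : ℕ) :
    LinearMap.ker ((D - ν • 1) ^ m) ≤ D.maxGenEigenspace ν := by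
  intro x hx
  rw [Module.End.mem_maxGenEigenspace]
  exact ⟨m, hx⟩

theorem triangularFlag_le (D : End ℂ W) {ν : ℂ} {m : ℕ} {S : Set ℂ}
    (h : ∀ ν', lexKey ν ≤ lexKey ν' → ν' ∈ S) : triangularFlag D ν m ≤ spectralSubspace D S :=
  sup_le (spectralSubspace_mono D fun ν' hν' => h ν' (le_of_lt hν'))
    ((ker_pow_le_maxGenEigenspace D ν m).trans (maxGenEigenspace_le_spectralSubspace D (h ν le_rfl)))

theorem isChain_triangularFlag (D : End ℂ W) : IsChain (· ≤ ·)
    ({C | ∃ ν m, C = triangularFlag D ν m} ∪ {C | ∃ r : ℝ, C = spectralSubspace D {ν | r ≤ ν.re}}) := by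
  have h1 : ∀ {ν ν' : ℂ} {m m' : ℕ}, lexKey ν < lexKey ν' →
      triangularFlag D ν' m' ≤ triangularFlag D ν m := fun h =>
    (triangularFlag_le D fun _ h' => h.trans_le h').trans le_sup_left
  have h2 : ∀ {ν : ℂ} {m : ℕ} {r : ℝ}, triangularFlag D ν m ≤ spectralSubspace D {ν | r ≤ ν.re} ∨
      spectralSubspace D {ν | r ≤ ν.re} ≤ triangularFlag D ν m := by
    intro ν m r
    by_cases hr : r ≤ ν.re
    · exact Or.inl (triangularFlag_le D fun ν' h' => hr.trans (re_le_of_lexKey_le h'))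
    · refine Or.inr (le_trans (spectralSubspace_mono D fun ν' hν' => ?_) le_sup_left)
      exact lexKey_lt_of_re_lt ((not_le.1 hr).trans_le hν')
  rintro C (⟨ν, m, rfl⟩ | ⟨r, rfl⟩) C' (⟨ν', m', rfl⟩ | ⟨r', rfl⟩) -
  · rcases lt_trichotomy (lexKey ν) (lexKey ν') with h | h | h
    · exact Or.inr (h1 h)
    · obtain rfl := lexKey_injective h
      have h3 : ∀ {p q : ℕ}, p ≤ q → triangularFlag D ν p ≤ triangularFlag D ν q := by
        intro p q hpq
        refine sup_le_sup le_rfl fun x hx => ?_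
        obtain ⟨d, rfl⟩ := Nat.exists_eq_add_of_le' hpq
        rw [LinearMap.mem_ker] at hx ⊢
        rw [pow_add, Module.End.mul_apply, hx, map_zero]
      rcases le_total m m' with hm | hm
      · exact Or.inl (h3 hm)
      · exact Or.inr (h3 hm)
    · exact Or.inl (h1 h)
  · exact h2
  · exact h2.symm
  · rcases le_total r r' with h | h
    · exact Or.inr (spectralSubspace_mono D fun ν hν => h.trans hν)
    · exact Or.inl (spectralSubspace_mono D fun ν hν => h.trans hν)

theorem apply_sub_smul_mem_triangularFlag {D : End ℂ W} {ν : ℂ} {m : ℕ} {x : W}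
    (hx : x ∈ triangularFlag D ν (m + 1)) : D x - ν • x ∈ triangularFlag D ν m := by
  obtain ⟨y, hy, z, hz, rfl⟩ := Submodule.mem_sup.1 hx
  have h1 := apply_sub_smul_mem_spectralSubspace ν hy
  have h2 : D z - ν • z ∈ LinearMap.ker ((D - ν • 1) ^ m) := by
    rw [LinearMap.mem_ker, pow_succ, Module.End.mul_apply] at hz
    exact hz
  have h3 : D (y + z) - ν • (y + z) = (D y - ν • y) + (D z - ν • z) := by
    rw [map_add, smul_add]
    abel
  rw [h3]
  exact Submodule.add_mem_sup h1 h2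

variable [FiniteDimensional ℂ W]

/-- Each nonzero vector enters the flag at a definite level `(ν, m + 1)`. -/
theorem exists_triangularFlag_level (D : End ℂ W) {v : W} (hv : v ≠ 0) :
    ∃ ν m, v ∈ triangularFlag D ν (m + 1) ∧ v ∉ triangularFlag D ν m ∧
      v ∉ spectralSubspace D {ν' | lexKey ν < lexKey ν'} := by
  classical
  have htop : v ∈ ⨆ ν, D.maxGenEigenspace ν := by
    rw [Module.End.iSup_maxGenEigenspace_eq_top]
    trivial
  obtain ⟨f, hf, hfv⟩ := (Submodule.mem_iSup_iff_exists_finsupp _ _).1 htop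
  have hne : f.support.Nonempty := by
    rw [Finsupp.support_nonempty_iff]
    rintro rfl
    exact hv (by simpa using hfv.symm)
  obtain ⟨ν, hν, hmin⟩ := Finset.exists_min_image f.support lexKey hne
  have hrest : v - f ν ∈ spectralSubspace D {ν' | lexKey ν < lexKey ν'} := by
    rw [← hfv, Finsupp.sum, ← Finset.add_sum_erase _ _ hν, add_sub_cancel_left]
    refine Submodule.sum_mem _ fun ν' hν' => ?_
    rw [Finset.mem_erase] at hν'
    refine maxGenEigenspace_le_spectralSubspace D ?_ (hf ν')
    exact lt_of_le_of_ne (hmin ν' hν'.2) fun h => hν'.1 (lexKey_injective h).symm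
  have hnot : v ∉ spectralSubspace D {ν' | lexKey ν < lexKey ν'} := by
    intro h
    have h1 : f ν ∈ spectralSubspace D {ν' | lexKey ν < lexKey ν'} := by
      have := Submodule.sub_mem _ h hrest
      simpa using this
    have h2 := (Module.End.independent_maxGenEigenspace D).disjoint_biSup (x := ν)
      (y := {ν' | lexKey ν < lexKey ν'}) (by simp)
    exact Finsupp.mem_support_iff.1 hν (Submodule.disjoint_def.1 h2 _ (hf ν) h1)
  have hex : ∃ m, v ∈ triangularFlag D ν m := by
    obtain ⟨m, hm⟩ := (Module.End.mem_maxGenEigenspace D ν (f ν)).1 (hf ν)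
    refine ⟨m, ?_⟩
    rw [← sub_add_cancel v (f ν)]
    exact Submodule.add_mem _ (Submodule.mem_sup_left hrest) (Submodule.mem_sup_right hm)
  have h0 : Nat.find hex ≠ 0 := by
    intro h
    have := Nat.find_spec hex
    rw [h, triangularFlag, pow_zero] at this
    refine hnot ?_
    have hker : LinearMap.ker (1 : End ℂ W) = ⊥ := LinearMap.ker_id
    rwa [hker, sup_bot_eq] at this
  obtain ⟨m, hm⟩ := Nat.exists_eq_succ_of_ne_zero h0
  refine ⟨ν, m, ?_, Nat.find_min hex (by omega), hnot⟩
  have := Nat.find_spec hex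
  rwa [hm] at this

end Spectral

/-- For a derivation `D`, moving the optimal weights in the direction of the real parts of the
eigenvalues of `D` cannot decrease the energy. The derivative of the energy in this direction is
`2 Re Tr ((A - 1) ∘ D)`, where `A` is the weight operator. -/
theorem IsOptimal.sum_weights_sub_one_mul_nonneg {W : Type*} {n : ℕ} [NormedAddCommGroup W]
    [NormedSpace ℂ W] [FiniteDimensional ℂ W] {μ : W →ₗ[ℂ] W →ₗ[ℂ] W} {e : Basis (Fin n) ℂ W}
    {lam : Fin n → ℝ} (h : IsOptimal μ e lam) {D : End ℂ W}
    (hD : ∀ x y, D (μ x y) = μ (D x) y + μ x (D y)) :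
    0 ≤ ∑ i, (lam i - 1) * (e.repr (D (e i)) i).re := by
  obtain ⟨b, hb, hb'⟩ := exists_basis_adaptedTo_of_isChain (k := ℂ) (V := W) (n := n)
    (by simp [Module.finrank_eq_card_basis e])
    (isChain_range_weightFiltration e lam) (isChain_triangularFlag D)
  obtain ⟨α, hα⟩ := exists_weights_of_adaptedTo fun a => hb _ ⟨a, rfl⟩
  have hA := h.admissible.of_weightFiltration_eq hα
  choose ν m hν1 hν2 hν3 using fun i => exists_triangularFlag_level D (b.ne_zero i)
  have hdiag : ∀ i, b.repr (D (b i)) i = ν i := by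
    intro i
    have h1 := apply_sub_smul_mem_triangularFlag (hν1 i)
    have h2 : b.repr (D (b i) - ν i • b i) i = 0 := by
      by_contra hne
      exact hν2 i (hb' _ (Or.inl ⟨_, _, rfl⟩) _ h1 i hne)
    have h3 : b.repr (D (b i)) i - ν i = 0 := by simpa using h2
    exact sub_eq_zero.1 h3
  have hψ : ∀ i j l, b.repr (μ (b i) (b j)) l ≠ 0 → (ν i).re + (ν j).re ≤ (ν l).re := by
    intro i j l hl
    have hmem : ∀ i, b i ∈ spectralSubspace D {z | (ν i).re ≤ z.re} := fun i =>
      triangularFlag_le D (fun _ h' => re_le_of_lexKey_le h') (hν1 i)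
    have h1 := mul_mem_spectralSubspace hD (U := {z | (ν i).re + (ν j).re ≤ z.re})
      (fun a ha b hb => by
        rw [Set.mem_ofPred_eq, Complex.add_re]
        exact add_le_add ha hb) (hmem i) (hmem j)
    have h2 := hb' _ (Or.inr ⟨_, rfl⟩) _ h1 l hl
    by_contra hlt
    refine hν3 l (spectralSubspace_mono D (fun z hz => ?_) h2)
    exact lexKey_lt_of_re_lt ((not_le.1 hlt).trans_le hz)
  have hpert : ∀ t : ℝ, 0 ≤ t → 0 ≤ 2 * t * (∑ i, (α i - 1) * (ν i).re) +
      t ^ 2 * ∑ i, (ν i).re ^ 2 := by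
    intro t ht
    have h1 := h.le b (fun i => α i + t * (ν i).re) fun i j l hl => by
      have h2 := hA i j l hl
      have h3 := mul_le_mul_of_nonneg_left (hψ i j l hl) ht
      linarith
    rw [← weightEnergy_eq hα, ← sub_nonneg, weightEnergy, weightEnergy,
      ← Finset.sum_sub_distrib] at h1
    rw [Finset.mul_sum, Finset.mul_sum, ← Finset.sum_add_distrib]
    refine h1.trans_eq (Finset.sum_congr rfl fun i _ => by ring)
  have hlim : 0 ≤ ∑ i, (α i - 1) * (ν i).re := by
    by_contra hneg
    push Not at hneg
    set P := ∑ i, (α i - 1) * (ν i).re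
    set Q := ∑ i, (ν i).re ^ 2
    have hQ : 0 ≤ Q := Finset.sum_nonneg fun _ _ => sq_nonneg _
    have h1 := hpert (-P / (Q + 1)) (div_nonneg (by linarith) (by linarith))
    have h2 : 2 * (-P / (Q + 1)) * P + (-P / (Q + 1)) ^ 2 * Q =
        -(P ^ 2 * (Q + 2)) / (Q + 1) ^ 2 := by
      field_simp
      ring
    rw [h2] at h1
    have h3 : -(P ^ 2 * (Q + 2)) / (Q + 1) ^ 2 < 0 := by
      apply div_neg_of_neg_of_pos
      · have : 0 < P ^ 2 := sq_pos_of_neg hneg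
        nlinarith
      · positivity
    linarith
  have h1 := sum_weights_mul_repr_eq hα (T := D) fun a x hx => h.derivation_mem hD hx
  have h2 : ∑ i, e.repr (D (e i)) i = ∑ i, b.repr (D (b i)) i := by
    rw [← trace_eq_sum_repr, ← trace_eq_sum_repr]
  have h3 : ∑ i, ((lam i : ℂ) - 1) * e.repr (D (e i)) i = ∑ i, ((α i : ℂ) - 1) * ν i := by
    simp only [sub_mul, one_mul, Finset.sum_sub_distrib, h1, h2, hdiag]
  have h4 := congrArg Complex.re h3
  simp only [Complex.re_sum] at h4
  have h5 : ∀ (r : ℝ) (z : ℂ), (((r : ℂ) - 1) * z).re = (r - 1) * z.re := by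
    intro r z
    simp [Complex.mul_re]
  simp only [h5] at h4
  rw [h4]
  exact hlim

/-! ### Complexification in coordinates -/

section Complexification

theorem half_smul_add_conj {M : Type*} [AddCommGroup M] [Module ℂ M] (x y : M) :
    (1 / 2 : ℂ) • ((x + Complex.I • y) + (x + -Complex.I • y)) = x := by
  module

theorem half_smul_sub_conj {M : Type*} [AddCommGroup M] [Module ℂ M] (x y : M) :
    (-Complex.I / 2 : ℂ) • ((x + Complex.I • y) - (x + -Complex.I • y)) = y := by
  have h2 : (-Complex.I / 2 * (2 * Complex.I) : ℂ) = 1 := by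
    linear_combination (-1 : ℂ) * Complex.I_mul_I
  have h3 : x + Complex.I • y - (x + -Complex.I • y) = (2 * Complex.I) • y := by
    module
  rw [h3, smul_smul, h2, one_smul]

variable {V : Type*} [AddCommGroup V] [Module ℝ V] {d : ℕ} (E : Basis (Fin d) ℝ V)

/-- The embedding of a real vector space with the basis `E` into its complexification
`Fin d → ℂ`. -/
noncomputable def toComplex : V →ₗ[ℝ] (Fin d → ℂ) where
  toFun x := fun k => (E.repr x k : ℂ)
  map_add' x y := by
    funext k
    simp
  map_smul' c x := by
    funext k
    simp

theorem toComplex_apply (x : V) (k : Fin d) : toComplex E x k = (E.repr x k : ℂ) := rfl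

theorem star_toComplex (x : V) : star (toComplex E x) = toComplex E x := by
  funext k
  simp [toComplex_apply]

theorem exists_eq_toComplex_add (z : Fin d → ℂ) :
    ∃ x y : V, z = toComplex E x + Complex.I • toComplex E y := by
  refine ⟨∑ k, (z k).re • E k, ∑ k, (z k).im • E k, ?_⟩
  funext k
  simp only [Pi.add_apply, Pi.smul_apply, toComplex_apply, Basis.repr_sum_self, smul_eq_mul]
  rw [mul_comm, Complex.re_add_im]

variable {E} in
@[elab_as_elim]
theorem toComplex_induction {p : (Fin d → ℂ) → Prop} (hp : ∀ x, p (toComplex E x))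
    (hadd : ∀ z w, p z → p w → p (z + w)) (hsmul : ∀ (c : ℂ) z, p z → p (c • z)) (z : Fin d → ℂ) :
    p z := by
  obtain ⟨x, y, rfl⟩ := exists_eq_toComplex_add E z
  exact hadd _ _ (hp x) (hsmul _ _ (hp y))

variable {E} in
theorem toComplex_ext {M : Type*} [AddCommGroup M] [Module ℂ M] {f g : (Fin d → ℂ) →ₗ[ℂ] M}
    (h : ∀ x, f (toComplex E x) = g (toComplex E x)) : f = g := by
  refine LinearMap.ext fun z => ?_
  obtain ⟨x, y, rfl⟩ := exists_eq_toComplex_add E z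
  rw [map_add, map_smul, h, h, map_add, map_smul]

/-- The complex linear extension of a real linear map to the complexification. -/
noncomputable def complexLift {M : Type*} [AddCommGroup M] [Module ℂ M] (f : V → M) :
    (Fin d → ℂ) →ₗ[ℂ] M := (Pi.basisFun ℂ (Fin d)).constr ℂ fun i => f (E i)

theorem complexLift_toComplex {M : Type*} [AddCommGroup M] [Module ℂ M] {f : V → M}
    (hadd : ∀ x y, f (x + y) = f x + f y) (hsmul : ∀ (c : ℝ) x, f (c • x) = (c : ℂ) • f x) (x : V) :
    complexLift E f (toComplex E x) = f x := by
  let g : V →+ M := AddMonoidHom.mk' f hadd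
  have hg : ∀ x, f x = g x := fun x => rfl
  rw [complexLift, Basis.constr_apply_fintype]
  simp only [Pi.basisFun_equivFun, LinearEquiv.refl_apply, toComplex_apply, ← hsmul]
  conv_rhs => rw [← E.sum_repr x]
  simp only [hg, map_sum]

theorem complexLift_toComplex_toComplex (b : Basis (Fin d) ℝ V) (x : V) :
    complexLift E (toComplex b) (toComplex E x) = toComplex b x :=
  complexLift_toComplex E (map_add _) (fun c x => by
    rw [map_smul]
    funext k
    simp) x

/-- A basis of `V` gives a basis of the complexification. -/
theorem exists_basis_toComplex (b : Basis (Fin d) ℝ V) :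
    ∃ c : Basis (Fin d) ℂ (Fin d → ℂ), (∀ i, c i = toComplex E (b i)) ∧
      ∀ x i, c.repr (toComplex E x) i = (b.repr x i : ℂ) := by
  let r : (Fin d → ℂ) ≃ₗ[ℂ] (Fin d → ℂ) := LinearEquiv.ofLinearMap
    (complexLift E (toComplex b)) (complexLift b (toComplex E))
    (toComplex_ext (E := b) fun x => by
      simp only [LinearMap.comp_apply, complexLift_toComplex_toComplex, LinearMap.id_apply])
    (toComplex_ext (E := E) fun x => by
      simp only [LinearMap.comp_apply, complexLift_toComplex_toComplex, LinearMap.id_apply])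
  have hrepr : ∀ x i, (Basis.ofEquivFun r).repr (toComplex E x) i = (b.repr x i : ℂ) := by
    intro x i
    rw [Basis.ofEquivFun_repr_apply]
    exact congrFun (complexLift_toComplex_toComplex E b x) i
  refine ⟨Basis.ofEquivFun r, fun i => ?_, hrepr⟩
  apply (Basis.ofEquivFun r).repr.injective
  ext j
  rw [hrepr, Basis.repr_self, Basis.repr_self]
  simp only [Finsupp.single_apply]
  split_ifs <;> simp

/-- The complexification of an endomorphism. -/
noncomputable def complexEnd (T : End ℝ V) : End ℂ (Fin d → ℂ) :=
  complexLift E fun x => toComplex E (T x)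

theorem complexEnd_toComplex (T : End ℝ V) (x : V) :
    complexEnd E T (toComplex E x) = toComplex E (T x) :=
  complexLift_toComplex E (f := fun x => toComplex E (T x)) (by simp) (fun c x => by
    rw [map_smul, map_smul]
    funext k
    simp) x

/-- The complexification of a bilinear product. -/
noncomputable def complexMul (β : V →ₗ[ℝ] V →ₗ[ℝ] V) :
    (Fin d → ℂ) →ₗ[ℂ] (Fin d → ℂ) →ₗ[ℂ] (Fin d → ℂ) :=
  complexLift E fun x => complexEnd E (β x)

theorem complexMul_toComplex (β : V →ₗ[ℝ] V →ₗ[ℝ] V) (x y : V) :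
    complexMul E β (toComplex E x) (toComplex E y) = toComplex E (β x y) := by
  rw [complexMul, complexLift_toComplex E (f := fun x => complexEnd E (β x)), complexEnd_toComplex]
  · intro x x'
    refine toComplex_ext (E := E) fun y => ?_
    simp [complexEnd_toComplex]
  · intro a x
    refine toComplex_ext (E := E) fun y => ?_
    rw [LinearMap.smul_apply, complexEnd_toComplex, complexEnd_toComplex, map_smul,
      LinearMap.smul_apply, map_smul]
    funext k
    simp

theorem star_complexMul (β : V →ₗ[ℝ] V →ₗ[ℝ] V) (z w : Fin d → ℂ) :
    star (complexMul E β z w) = complexMul E β (star z) (star w) := by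
  refine toComplex_induction (E := E) ?_ ?_ ?_ z
  · intro x
    refine toComplex_induction (E := E) ?_ ?_ ?_ w
    · intro y
      simp only [complexMul_toComplex, star_toComplex]
    · intro w w' hw hw'
      rw [map_add, star_add, hw, hw', star_add, map_add]
    · intro c w hw
      rw [map_smul, star_smul, hw, star_smul, map_smul]
  · intro z z' hz hz'
    rw [map_add, LinearMap.add_apply, star_add, hz, hz', star_add, map_add, LinearMap.add_apply]
  · intro c z hz
    rw [map_smul, LinearMap.smul_apply, star_smul, hz, star_smul, map_smul, LinearMap.smul_apply]

theorem complexMul_skew {β : V →ₗ[ℝ] V →ₗ[ℝ] V} (hβ : ∀ x y, β x y = -β y x) (z w : Fin d → ℂ) :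
    complexMul E β z w = -complexMul E β w z := by
  refine toComplex_induction (E := E) ?_ ?_ ?_ z
  · intro x
    refine toComplex_induction (E := E) ?_ ?_ ?_ w
    · intro y
      rw [complexMul_toComplex, complexMul_toComplex, hβ, map_neg]
    · intro w w' hw hw'
      rw [map_add, hw, hw', map_add, LinearMap.add_apply, neg_add]
    · intro c w hw
      rw [map_smul, hw, map_smul, LinearMap.smul_apply, smul_neg]
  · intro z z' hz hz'
    rw [map_add, LinearMap.add_apply, hz, hz', map_add, neg_add]
  · intro c z hz
    rw [map_smul, LinearMap.smul_apply, hz, map_smul, smul_neg]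

theorem complexEnd_derivation {β : V →ₗ[ℝ] V →ₗ[ℝ] V} {D : End ℝ V}
    (hD : ∀ x y, D (β x y) = β (D x) y + β x (D y)) (z w : Fin d → ℂ) :
    complexEnd E D (complexMul E β z w) =
      complexMul E β (complexEnd E D z) w + complexMul E β z (complexEnd E D w) := by
  refine toComplex_induction (E := E) ?_ ?_ ?_ z
  · intro x
    refine toComplex_induction (E := E) ?_ ?_ ?_ w
    · intro y
      simp only [complexMul_toComplex, complexEnd_toComplex, hD, map_add]
    · intro w w' hw hw'
      simp only [map_add, hw, hw']
      abel
    · intro c w hw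
      simp only [map_smul, hw, smul_add]
  · intro z z' hz hz'
    simp only [map_add, LinearMap.add_apply, hz, hz']
    abel
  · intro c z hz
    simp only [map_smul, LinearMap.smul_apply, hz, smul_add]

theorem complexMul_jacobi {β : V →ₗ[ℝ] V →ₗ[ℝ] V}
    (hβ : ∀ x y z, β x (β y z) = β (β x y) z + β y (β x z)) (v z w : Fin d → ℂ) :
    complexMul E β v (complexMul E β z w) =
      complexMul E β (complexMul E β v z) w + complexMul E β z (complexMul E β v w) := by
  have hend : ∀ x, complexMul E β (toComplex E x) = complexEnd E (β x) := by
    intro x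
    refine toComplex_ext (E := E) fun y => ?_
    rw [complexMul_toComplex, complexEnd_toComplex]
  refine toComplex_induction (E := E) ?_ ?_ ?_ v
  · intro x
    rw [hend]
    exact complexEnd_derivation E (hβ x) z w
  · intro v v' hv hv'
    simp only [map_add, LinearMap.add_apply, hv, hv']
    abel
  · intro c v hv
    simp only [map_smul, LinearMap.smul_apply, hv, smul_add]

end Complexification

/-! ### Optimal orthonormal bases of a Euclidean Lie algebra -/

theorem IsOptimal.of_weightFiltration_eq {W : Type*} [AddCommGroup W] [Module ℂ W] {n : ℕ}
    {μ : W →ₗ[ℂ] W →ₗ[ℂ] W} {e b : Basis (Fin n) ℂ W} {lam lam' : Fin n → ℝ}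
    (h : IsOptimal μ e lam) (hb : ∀ a, weightFiltration b lam' a = weightFiltration e lam a) :
    IsOptimal μ b lam' :=
  ⟨h.admissible.of_weightFiltration_eq hb, fun e' α hα => (weightEnergy_eq hb).trans_le (h.le e' α hα)⟩

/-- The orthonormal basis `u` with the weights `lam` spans the canonical optimal filtration of the
Lie algebra `𝔫`. The operator `A` with `A (u i) = lam i • u i` replaces a derivation: it is compatible
with the bracket up to a definite sign, and so is its commutator with each derivation. -/
structure IsOptimalBasis {𝔫 : Type*} [LieRing 𝔫] [LieAlgebra ℝ 𝔫] {d : ℕ}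
    (u : Basis (Fin d) ℝ 𝔫) (lam : Fin d → ℝ) : Prop where
  nonneg : ∀ i, 0 ≤ lam i
  sum_sq : ∑ i, lam i ^ 2 = ∑ i, lam i
  bracket : ∀ i j l, u.repr ⁅u i, u j⁆ l ≠ 0 → lam i + lam j ≤ lam l
  derivation : ∀ D : End ℝ 𝔫, (∀ x y, D ⁅x, y⁆ = ⁅D x, y⁆ + ⁅x, D y⁆) →
    ∀ i j, u.repr (D (u j)) i ≠ 0 → lam j ≤ lam i
  trace_le : ∀ D : End ℝ 𝔫, (∀ x y, D ⁅x, y⁆ = ⁅D x, y⁆ + ⁅x, D y⁆) →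
    0 ≤ ∑ i, (lam i - 1) * u.repr (D (u i)) i

theorem exists_isOptimalBasis {𝔫 : Type*} [LieRing 𝔫] [LieAlgebra ℝ 𝔫] [FiniteDimensional ℝ 𝔫]
    (ip : RealInnerProduct 𝔫) :
    ∃ (u : Basis (Fin (finrank ℝ 𝔫)) ℝ 𝔫) (lam : Fin (finrank ℝ 𝔫) → ℝ),
      ip.IsOrthonormal u ∧ IsOptimalBasis u lam := by
  set E := finBasis ℝ 𝔫
  let β : 𝔫 →ₗ[ℝ] 𝔫 →ₗ[ℝ] 𝔫 := (LieAlgebra.ad ℝ 𝔫 : 𝔫 →ₗ[ℝ] End ℝ 𝔫)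
  have hβ : ∀ x y, β x y = ⁅x, y⁆ := fun x y => rfl
  have hskew : ∀ x y, β x y = -β y x := fun x y => by rw [hβ, hβ, lie_skew]
  have hjac : ∀ x y z, β x (β y z) = β (β x y) z + β y (β x z) := fun x y z => by
    exact leibniz_lie x y z
  set μ := complexMul E β
  obtain ⟨e, lam₀, h₀⟩ := exists_isOptimal (W := Fin (finrank ℝ 𝔫) → ℂ) (n := finrank ℝ 𝔫)
    (Module.finrank_fin_fun ℂ) μ
  -- the real points of the optimal filtration
  let F : ℝ → Submodule ℝ 𝔫 := fun a =>
    ((weightFiltration e lam₀ a).restrictScalars ℝ).comap (toComplex E)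
  have hF : ∀ a x, x ∈ F a ↔ toComplex E x ∈ weightFiltration e lam₀ a := fun a x => Iff.rfl
  have hchain : IsChain (· ≤ ·) (Set.range F) := by
    have : Antitone F := fun a b hab x hx => weightFiltration_antitone e lam₀ hab hx
    exact this.isChain_range
  obtain ⟨u, hu, huF⟩ := ip.exists_isOrthonormal_adaptedTo rfl hchain
  obtain ⟨c, hc, hcrepr⟩ := exists_basis_toComplex E u
  have hadapt : ∀ a, BasisAdaptedTo c (weightFiltration e lam₀ a) := by
    intro a z hz i hi
    have hstar : star z ∈ weightFiltration e lam₀ a :=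
      h₀.antilinear_mem star star_add star_smul star_star (star_complexMul E β) hz
    obtain ⟨x, y, rfl⟩ := exists_eq_toComplex_add E z
    rw [star_add, star_smul, star_toComplex, star_toComplex] at hstar
    have hI : star Complex.I = -Complex.I := Complex.conj_I
    rw [hI] at hstar
    have hx : x ∈ F a := by
      have h1 := Submodule.smul_mem _ (1 / 2 : ℂ) (Submodule.add_mem _ hz hstar)
      rw [hF]
      convert h1 using 1
      exact (half_smul_add_conj _ _).symm
    have hy : y ∈ F a := by
      have h1 := Submodule.smul_mem _ (-Complex.I / 2 : ℂ) (Submodule.sub_mem _ hz hstar)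
      rw [hF]
      convert h1 using 1
      exact (half_smul_sub_conj _ _).symm
    rw [map_add, map_smul, Finsupp.add_apply, Finsupp.smul_apply, hcrepr, hcrepr] at hi
    rw [hc, ← hF]
    by_cases hxi : u.repr x i = 0
    · refine huF _ ⟨a, rfl⟩ y hy i fun hyi => hi ?_
      simp [hxi, hyi]
    · exact huF _ ⟨a, rfl⟩ x hx i hxi
  obtain ⟨lam, hlam⟩ := exists_weights_of_adaptedTo hadapt
  have h := h₀.of_weightFiltration_eq hlam
  have hder : ∀ D : End ℝ 𝔫, (∀ x y, D ⁅x, y⁆ = ⁅D x, y⁆ + ⁅x, D y⁆) → ∀ z w,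
      complexEnd E D (μ z w) = μ (complexEnd E D z) w + μ z (complexEnd E D w) :=
    fun D hD => complexEnd_derivation E hD
  have hDrepr : ∀ (D : End ℝ 𝔫) i j, c.repr (complexEnd E D (c j)) i = (u.repr (D (u j)) i : ℂ) := by
    intro D i j
    rw [hc, complexEnd_toComplex, hcrepr]
  refine ⟨u, lam, hu, ⟨?_, h.sum_sq, fun i j l hl => h.admissible i j l ?_, fun D hD i j hij => ?_,
    fun D hD => ?_⟩⟩
  · exact h.weights_nonneg (complexMul_skew E hskew) (complexMul_jacobi E hjac)
  · rw [hc, hc, complexMul_toComplex, hcrepr, hβ]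
    exact_mod_cast hl
  · refine h.derivation_mem (hder D hD) (basis_mem_weightFiltration.2 le_rfl) i ?_
    rw [hDrepr]
    exact_mod_cast hij
  · have := h.sum_weights_sub_one_mul_nonneg (hder D hD)
    simpa only [hDrepr, Complex.ofReal_re] using this

/-! ### The nilradical of a solvable Lie algebra -/

section Nilradical

theorem lie_mem_derivedSeries_one {R L : Type*} [CommRing R] [LieRing L] [LieAlgebra R L] (x y : L) :
    ⁅x, y⁆ ∈ LieAlgebra.derivedSeries R L 1 := by
  rw [LieAlgebra.derivedSeries_def, LieAlgebra.derivedSeriesOfIdeal_succ,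
    LieAlgebra.derivedSeriesOfIdeal_zero]
  exact LieSubmodule.lie_mem_lie (LieSubmodule.mem_top x) (LieSubmodule.mem_top y)

theorem derivedSeries_one_le {R L : Type*} [CommRing R] [LieRing L] [LieAlgebra R L]
    {P : Submodule R L} (hP : ∀ x y : L, ⁅x, y⁆ ∈ P) :
    (LieAlgebra.derivedSeries R L 1).toSubmodule ≤ P := by
  rw [LieAlgebra.derivedSeries_def, LieAlgebra.derivedSeriesOfIdeal_succ,
    LieAlgebra.derivedSeriesOfIdeal_zero, LieSubmodule.lieIdeal_oper_eq_linear_span',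
    Submodule.span_le]
  rintro _ ⟨x, -, y, -, rfl⟩
  exact hP x y

/-- By Lie's theorem, the derived algebra of a complex solvable Lie algebra acts by nilpotent
operators on each finite-dimensional module. -/
theorem isNilpotent_toEnd_of_mem_derivedSeries {L : Type*} [LieRing L] [LieAlgebra ℂ L]
    [LieAlgebra.IsSolvable L] {M : Type*} [AddCommGroup M] [Module ℂ M] [LieRingModule L M]
    [LieModule ℂ L M] [FiniteDimensional ℂ M] {x : L} (hx : x ∈ LieAlgebra.derivedSeries ℂ L 1) :
    IsNilpotent (LieModule.toEnd ℂ L M x) := by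
  induction hn : finrank ℂ M using Nat.strong_induction_on generalizing M with
  | _ n ih =>
  rcases subsingleton_or_nontrivial M with hM | hM
  · exact ⟨1, LinearMap.ext fun m => Subsingleton.elim _ _⟩
  obtain ⟨χ, hχ⟩ := LieModule.exists_nontrivial_weightSpace_of_isSolvable ℂ L M
  obtain ⟨⟨v, hv⟩, hv0⟩ := exists_ne (0 : LieModule.weightSpace M χ)
  rw [LieModule.mem_weightSpace] at hv
  have hv0' : v ≠ 0 := fun h => hv0 (Subtype.ext h)
  let K : LieSubmodule ℂ L M :=
    { toSubmodule := Submodule.span ℂ {v}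
      lie_mem := by
        intro y m hm
        obtain ⟨c, rfl⟩ := Submodule.mem_span_singleton.1 hm
        rw [lie_smul, hv y]
        exact Submodule.smul_mem _ _ (Submodule.smul_mem _ _ (Submodule.mem_span_singleton_self v)) }
  have hxv : ⁅x, v⁆ = 0 := by
    have h1 : (LieAlgebra.derivedSeries ℂ L 1).toSubmodule ≤
        LinearMap.ker ((LieModule.toEnd ℂ L M : L →ₗ[ℂ] End ℂ M).flip v) := by
      refine derivedSeries_one_le fun a b => ?_
      rw [LinearMap.mem_ker]
      change ⁅⁅a, b⁆, v⁆ = 0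
      rw [lie_lie, hv a, hv b, lie_smul, lie_smul, hv a, hv b, smul_smul, smul_smul, mul_comm,
        sub_self]
    exact h1 hx
  have hlt : finrank ℂ (M ⧸ K) < n := by
    have h1 := Submodule.finrank_quotient_add_finrank K.toSubmodule
    have h2 : finrank ℂ K.toSubmodule = 1 := finrank_span_singleton hv0'
    have h3 : finrank ℂ (M ⧸ K) = finrank ℂ (M ⧸ K.toSubmodule) := rfl
    omega
  obtain ⟨k, hk⟩ := ih _ hlt (M := M ⧸ K) rfl
  have hpow : ∀ (j : ℕ) (m : M), LieSubmodule.Quotient.mk' K ((LieModule.toEnd ℂ L M x ^ j) m) =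
      (LieModule.toEnd ℂ L (M ⧸ K) x ^ j) (LieSubmodule.Quotient.mk' K m) := by
    intro j
    induction j with
    | zero => intro m; rfl
    | succ j ihj =>
      intro m
      rw [pow_succ', pow_succ', Module.End.mul_apply, Module.End.mul_apply, ← ihj]
      rfl
  refine ⟨k + 1, LinearMap.ext fun m => ?_⟩
  have h1 : (LieModule.toEnd ℂ L M x ^ k) m ∈ K := by
    have h2 := hpow k m
    rw [hk, LinearMap.zero_apply] at h2
    exact (LieSubmodule.Quotient.mk_eq_zero' (N := K)).1 h2
  obtain ⟨c, hc⟩ := Submodule.mem_span_singleton.1 h1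
  rw [pow_succ', Module.End.mul_apply, ← hc, map_smul, LieModule.toEnd_apply_apply, hxv, smul_zero,
    LinearMap.zero_apply]

variable {𝔤 : Type*} [LieRing 𝔤] [LieAlgebra ℝ 𝔤] [FiniteDimensional ℝ 𝔤]

open TensorProduct in
theorem isNilpotent_ad_of_mem_derivedSeries [LieAlgebra.IsSolvable 𝔤] {x : 𝔤}
    (hx : x ∈ LieAlgebra.derivedSeries ℝ 𝔤 1) : IsNilpotent (LieAlgebra.ad ℝ 𝔤 x) := by
  have hx' : (1 : ℂ) ⊗ₜ[ℝ] x ∈ LieAlgebra.derivedSeries ℂ (ℂ ⊗[ℝ] 𝔤) 1 := by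
    rw [LieAlgebra.derivedSeries_baseChange]
    exact Submodule.tmul_mem_baseChange_of_mem 1 hx
  have h := isNilpotent_toEnd_of_mem_derivedSeries (M := ℂ ⊗[ℝ] 𝔤) hx'
  rw [LieModule.toEnd_baseChange] at h
  have hinj : Function.Injective (End.baseChangeHom ℝ ℂ 𝔤) :=
    LinearMap.baseChangeHom_injective ℝ 𝔤 ℂ
  rw [← IsNilpotent.map_iff hinj]
  exact h

theorem IsNilradical.derivedSeries_le [LieAlgebra.IsSolvable 𝔤] {N : LieIdeal ℝ 𝔤}
    (hN : IsNilradical N) : LieAlgebra.derivedSeries ℝ 𝔤 1 ≤ N := by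
  refine hN.2 ?_
  change LieRing.IsNilpotent (LieAlgebra.derivedSeries ℝ 𝔤 1)
  rw [LieAlgebra.isNilpotent_iff_forall (R := ℝ)]
  rintro ⟨x, hx⟩
  obtain ⟨k, hk⟩ := isNilpotent_ad_of_mem_derivedSeries hx
  have hpow : ∀ (j : ℕ) (y : LieAlgebra.derivedSeries ℝ 𝔤 1),
      (((LieAlgebra.ad ℝ (LieAlgebra.derivedSeries ℝ 𝔤 1) ⟨x, hx⟩ ^ j) y :
        LieAlgebra.derivedSeries ℝ 𝔤 1) : 𝔤) = (LieAlgebra.ad ℝ 𝔤 x ^ j) (y : 𝔤) := by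
    intro j
    induction j with
    | zero => intro y; rfl
    | succ j ih =>
      intro y
      rw [pow_succ', pow_succ', Module.End.mul_apply, Module.End.mul_apply, ← ih]
      rfl
  refine ⟨k, LinearMap.ext fun y => Subtype.ext ?_⟩
  rw [hpow, hk]
  rfl

theorem IsNilradical.lie_mem [LieAlgebra.IsSolvable 𝔤] {N : LieIdeal ℝ 𝔤} (hN : IsNilradical N)
    (x y : 𝔤) : ⁅x, y⁆ ∈ N := hN.derivedSeries_le (lie_mem_derivedSeries_one x y)

/-- An element of a nilpotent ideal acts nilpotently on the whole Lie algebra. -/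
theorem isNilpotent_ad_of_mem_ideal {𝔤 : Type*} [LieRing 𝔤] [LieAlgebra ℝ 𝔤]
    {N : LieIdeal ℝ 𝔤} [LieRing.IsNilpotent N] {x : 𝔤} (hx : x ∈ N) :
    IsNilpotent (LieAlgebra.ad ℝ 𝔤 x) := by
  obtain ⟨k, hk⟩ := LieModule.isNilpotent_toEnd_of_isNilpotent ℝ N N ⟨x, hx⟩
  have hpow : ∀ (j : ℕ) (y : N), (((LieModule.toEnd ℝ N N ⟨x, hx⟩ ^ j) y : N) : 𝔤) =
      (LieAlgebra.ad ℝ 𝔤 x ^ j) (y : 𝔤) := by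
    intro j
    induction j with
    | zero => intro y; rfl
    | succ j ih =>
      intro y
      rw [pow_succ', pow_succ', Module.End.mul_apply, Module.End.mul_apply, ← ih]
      rfl
  refine ⟨k + 1, LinearMap.ext fun y => ?_⟩
  have h1 : ⁅x, y⁆ ∈ N := lie_mem_left ℝ 𝔤 N x y hx
  have h2 := hpow k ⟨_, h1⟩
  rw [hk] at h2
  rw [pow_succ, Module.End.mul_apply, LieAlgebra.ad_apply]
  exact h2.symm

/-- The Killing form vanishes on nilpotent ideals. -/
theorem killingForm_eq_zero_of_mem_ideal {N : LieIdeal ℝ 𝔤} [LieRing.IsNilpotent N] {x : 𝔤}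
    (hx : x ∈ N) (y : 𝔤) : killingForm ℝ 𝔤 x y = 0 := by
  have hnil : LieModule.IsNilpotent N 𝔤 := by
    rw [LieModule.isNilpotent_iff_forall (R := ℝ)]
    rintro ⟨z, hz⟩
    exact isNilpotent_ad_of_mem_ideal hz
  obtain ⟨k, hk⟩ := (LieModule.isNilpotent_iff ℝ N 𝔤).1 hnil
  rw [killingForm_apply_apply]
  have hmem : ∀ (j : ℕ) (z : 𝔤), (((LieAlgebra.ad ℝ 𝔤 x ∘ₗ LieAlgebra.ad ℝ 𝔤 y) ^ j) z) ∈
      N.lcs 𝔤 j := by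
    intro j
    induction j with
    | zero => intro z; simp
    | succ j ih =>
      intro z
      rw [pow_succ', Module.End.mul_apply, LieIdeal.lcs_succ]
      exact LieSubmodule.lie_mem_lie hx ((N.lcs 𝔤 j).lie_mem (ih z))
  refine (LinearMap.isNilpotent_trace_of_isNilpotent ⟨k, LinearMap.ext fun z => ?_⟩).eq_zero
  have h1 := hmem k z
  have h2 : (N.lcs 𝔤 k).toSubmodule = (LieModule.lowerCentralSeries ℝ N 𝔤 k).toSubmodule :=
    LieIdeal.coe_lcs_eq ..
  rw [hk] at h2
  rw [← LieSubmodule.mem_toSubmodule, h2] at h1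
  exact h1

end Nilradical

/-! ### Orthonormal bases -/

namespace RealInnerProduct

section Orthonormal

variable {V : Type*} [AddCommGroup V] [Module ℝ V] (ip : RealInnerProduct V) {ι κ : Type*}
  [DecidableEq ι] [DecidableEq κ]

theorem self_nonneg (x : V) : 0 ≤ ip.form x x := by
  by_cases h : x = 0
  · simp [h]
  · exact (ip.pos x h).le

theorem eq_zero_of_self_eq_zero {x : V} (h : ip.form x x = 0) : x = 0 := by
  by_contra hne
  exact (ip.pos x hne).ne' h

theorem form_adjoint [FiniteDimensional ℝ V] (A : End ℝ V) (x y : V) :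
    ip.form (ip.adjoint A x) y = ip.form x (A y) :=
  ip.form.isAdjointPairLeftAdjointOfNondegenerate ip.nondegenerate A x y

theorem form_operatorOf [FiniteDimensional ℝ V] (β : LinearMap.BilinForm ℝ V) (x y : V) :
    ip.form (ip.operatorOf β x) y = β x y :=
  LinearMap.BilinForm.symmCompOfNondegenerate_left_apply β ip.nondegenerate y x

variable {ip}

theorem IsOrthonormal.repr_eq {b : Basis ι ℝ V} (hb : ip.IsOrthonormal b) (x : V) (i : ι) :
    b.repr x i = ip.form x (b i) := by
  conv_rhs => rw [← b.linearCombination_repr x, Finsupp.linearCombination_apply, Finsupp.sum]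
  simp only [map_sum, map_smul, LinearMap.sum_apply, LinearMap.smul_apply, smul_eq_mul]
  have ho : ∀ i j, ip.form (b i) (b j) = if i = j then 1 else 0 := hb
  simp only [ho, mul_ite, mul_one, mul_zero, Finset.sum_ite_eq']
  split_ifs with h
  · rfl
  · exact Finsupp.notMem_support_iff.1 h

/-- Orthonormal bases of a subspace and of its orthogonal complement combine to an orthonormal
basis. -/
theorem exists_isOrthonormal_sum [FiniteDimensional ℝ V] (ip : RealInnerProduct V)
    (P : Submodule ℝ V) {w : Basis ι ℝ (ip.form.orthogonal P)} {u : Basis κ ℝ P}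
    (hw : (ip.restrict _).IsOrthonormal w) (hu : (ip.restrict P).IsOrthonormal u) :
    ∃ b : Basis (ι ⊕ κ) ℝ V, ip.IsOrthonormal b ∧ (∀ i, b (Sum.inl i) = w i) ∧
      ∀ j, b (Sum.inr j) = u j := by
  have hrefl : ip.form.IsRefl := fun x y h => by rw [ip.symm, h]
  have hcompl : IsCompl P (ip.form.orthogonal P) := by
    refine (LinearMap.BilinForm.isCompl_orthogonal_iff_disjoint hrefl).2 ?_
    rw [Submodule.disjoint_def]
    intro x hx hx'
    exact ip.eq_zero_of_self_eq_zero (hx' x hx)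
  let b : Basis (ι ⊕ κ) ℝ V := (w.prod u).map (Submodule.prodEquivOfIsCompl _ _ hcompl.symm)
  have hbl : ∀ i, b (Sum.inl i) = w i := by intro i; simp [b]
  have hbr : ∀ j, b (Sum.inr j) = u j := by intro j; simp [b]
  have h0 : ∀ i j, ip.form (u j) (w i) = 0 := fun i j => (w i).2 (u j) (u j).2
  refine ⟨b, ?_, hbl, hbr⟩
  rintro (i | i) (j | j)
  · rw [hbl, hbl]
    have h := hw i j
    rw [restrict_form] at h
    simpa using h
  · rw [hbl, hbr, ip.symm, h0]
    simp
  · rw [hbl, hbr, h0]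
    simp
  · rw [hbr, hbr]
    have h := hu i j
    rw [restrict_form] at h
    simpa using h

variable [Fintype ι]

theorem IsOrthonormal.sum_form_smul {b : Basis ι ℝ V} (hb : ip.IsOrthonormal b) (x : V) :
    ∑ i, ip.form x (b i) • b i = x := by
  simp only [← hb.repr_eq, b.sum_repr]

theorem IsOrthonormal.form_eq_sum {b : Basis ι ℝ V} (hb : ip.IsOrthonormal b) (x y : V) :
    ip.form x y = ∑ i, ip.form x (b i) * ip.form y (b i) := by
  conv_lhs => rw [← hb.sum_form_smul y]
  simp only [map_sum, map_smul, smul_eq_mul]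
  exact Finset.sum_congr rfl fun i _ => mul_comm _ _

theorem IsOrthonormal.trace_eq {b : Basis ι ℝ V} (hb : ip.IsOrthonormal b) (T : End ℝ V) :
    LinearMap.trace ℝ V T = ∑ i, ip.form (T (b i)) (b i) := by
  rw [trace_eq_sum_repr b]
  simp only [hb.repr_eq]

theorem IsOrthonormal.ext {b : Basis ι ℝ V} (hb : ip.IsOrthonormal b) {x : V}
    (h : ∀ i, ip.form x (b i) = 0) : x = 0 := by
  rw [← hb.sum_form_smul x]
  simp [h]

/-- Transposition inside the contraction of a bilinear form with an operator. -/
theorem IsOrthonormal.sum_apply_adjoint {b : Basis ι ℝ V} (hb : ip.IsOrthonormal b) {D D' : End ℝ V}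
    (hD : ∀ x y, ip.form (D x) y = ip.form x (D' y)) (h : V →ₗ[ℝ] V →ₗ[ℝ] ℝ) :
    ∑ i, h (D (b i)) (b i) = ∑ i, h (b i) (D' (b i)) := by
  have h1 : ∀ i, h (D (b i)) (b i) = ∑ j, ip.form (D (b i)) (b j) * h (b j) (b i) := by
    intro i
    conv_lhs => rw [← hb.sum_form_smul (D (b i))]
    simp only [map_sum, map_smul, LinearMap.sum_apply, LinearMap.smul_apply, smul_eq_mul]
  have h2 : ∀ j, h (b j) (D' (b j)) = ∑ i, ip.form (D (b i)) (b j) * h (b j) (b i) := by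
    intro j
    conv_lhs => rw [← hb.sum_form_smul (D' (b j))]
    simp only [map_sum, map_smul, smul_eq_mul]
    refine Finset.sum_congr rfl fun i _ => ?_
    rw [hD, ip.symm]
  simp only [h1, h2]
  exact Finset.sum_comm

end Orthonormal

/-! ### Test identities for Einstein metric Lie algebras -/

section ActOnProduct

variable {𝔤 : Type*} [AddCommGroup 𝔤] [Module ℝ 𝔤]

/-- The natural action of an endomorphism on bilinear products. -/
def actOnProduct (D : End ℝ 𝔤) (γ : 𝔤 →ₗ[ℝ] 𝔤 →ₗ[ℝ] 𝔤) : 𝔤 →ₗ[ℝ] 𝔤 →ₗ[ℝ] 𝔤 :=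
  γ.compr₂ D - γ ∘ₗ D - γ.compl₂ D

theorem actOnProduct_apply (D : End ℝ 𝔤) (γ : 𝔤 →ₗ[ℝ] 𝔤 →ₗ[ℝ] 𝔤) (x y : 𝔤) :
    actOnProduct D γ x y = D (γ x y) - γ (D x) y - γ x (D y) := rfl

theorem sum_form_actOnProduct {ip : RealInnerProduct 𝔤} {ι : Type*}
    [Fintype ι] [DecidableEq ι] {b : Basis ι ℝ 𝔤} (hb : ip.IsOrthonormal b) {D D' : End ℝ 𝔤}
    (hD : ∀ x y, ip.form (D x) y = ip.form x (D' y)) (γ ν : 𝔤 →ₗ[ℝ] 𝔤 →ₗ[ℝ] 𝔤) :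
    ∑ i, ∑ j, ip.form (actOnProduct D γ (b i) (b j)) (ν (b i) (b j)) =
      ∑ i, ∑ j, ip.form (γ (b i) (b j)) (actOnProduct D' ν (b i) (b j)) := by
  have h1 : ∀ j, ∑ i, ip.form (γ (D (b i)) (b j)) (ν (b i) (b j)) =
      ∑ i, ip.form (γ (b i) (b j)) (ν (D' (b i)) (b j)) := fun j =>
    hb.sum_apply_adjoint hD (ip.form.compl₁₂ (γ.flip (b j)) (ν.flip (b j)))
  have h2 : ∀ i, ∑ j, ip.form (γ (b i) (D (b j))) (ν (b i) (b j)) =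
      ∑ j, ip.form (γ (b i) (b j)) (ν (b i) (D' (b j))) := fun i =>
    hb.sum_apply_adjoint hD (ip.form.compl₁₂ (γ (b i)) (ν (b i)))
  simp only [actOnProduct_apply, map_sub, LinearMap.sub_apply, Finset.sum_sub_distrib, hD, h2]
  congr 2
  rw [Finset.sum_comm]
  simp only [h1]
  exact Finset.sum_comm

end ActOnProduct

theorem coboundary_id {𝔤 : Type*} [LieRing 𝔤] [LieAlgebra ℝ 𝔤] (x y : 𝔤) :
    coboundary LinearMap.id x y = ⁅x, y⁆ := by
  simp only [coboundary, LinearMap.id_apply]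
  abel

section TestIdentities

variable {𝔤 : Type*} [LieRing 𝔤] [LieAlgebra ℝ 𝔤] [FiniteDimensional ℝ 𝔤] (ip : RealInnerProduct 𝔤)
  {ι : Type*} [Fintype ι] [DecidableEq ι]

theorem form_meanCurvature (x : 𝔤) :
    ip.form ip.meanCurvature x = LinearMap.trace ℝ 𝔤 (LieAlgebra.ad ℝ 𝔤 x) := by
  have h := (ip.form.toDual ip.nondegenerate).apply_symm_apply
    (LinearMap.trace ℝ 𝔤 ∘ₗ (LieAlgebra.ad ℝ 𝔤 : 𝔤 →ₗ[ℝ] End ℝ 𝔤))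
  exact congrArg (fun f : Dual ℝ 𝔤 => f x) h

variable {ip}

theorem trace_operatorOf_mul {b : Basis ι ℝ 𝔤} (hb : ip.IsOrthonormal b)
    (β : LinearMap.BilinForm ℝ 𝔤) (A : End ℝ 𝔤) :
    LinearMap.trace ℝ 𝔤 (ip.operatorOf β * A) = ∑ i, β (A (b i)) (b i) := by
  simp only [hb.trace_eq, Module.End.mul_apply, form_operatorOf]

theorem trace_symmPart_mul {b : Basis ι ℝ 𝔤} (hb : ip.IsOrthonormal b) (D A : End ℝ 𝔤) :
    LinearMap.trace ℝ 𝔤 (ip.symmPart D * A) =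
      1 / 2 * ∑ i, (ip.form (D (A (b i))) (b i) + ip.form (A (b i)) (D (b i))) := by
  rw [hb.trace_eq, Finset.mul_sum]
  refine Finset.sum_congr rfl fun i _ => ?_
  simp only [symmPart, Module.End.mul_apply, LinearMap.smul_apply, LinearMap.add_apply, map_smul,
    map_add, smul_eq_mul, form_adjoint]

/-- The defining identity of the Ricci operator of an Einstein metric Lie algebra. -/
theorem einstein_identity {c : ℝ} (hc : ip.ricciOperator = c • LinearMap.id) (A : End ℝ 𝔤) :
    c * LinearMap.trace ℝ 𝔤 A +
      LinearMap.trace ℝ 𝔤 (ip.symmPart (LieAlgebra.ad ℝ 𝔤 ip.meanCurvature) * A) +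
      1 / 2 * LinearMap.trace ℝ 𝔤 (ip.operatorOf (killingForm ℝ 𝔤) * A) =
      -(1 / 4) * ip.xi A LinearMap.id := by
  have h := ip.isRicciOperator_ricciOperator A
  rw [hc, add_mul, add_mul, map_add, map_add, smul_mul_assoc, smul_mul_assoc, map_smul, map_smul,
    smul_eq_mul, smul_eq_mul] at h
  exact h

/-- The Einstein identity for the operator that is diagonal in an orthonormal basis. -/
theorem einstein_diagonal {c : ℝ} (hc : ip.ricciOperator = c • LinearMap.id) {b : Basis ι ℝ 𝔤}
    (hb : ip.IsOrthonormal b) (lam : ι → ℝ) :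
    c * ∑ i, lam i + ∑ i, lam i * ip.form ⁅ip.meanCurvature, b i⁆ (b i) +
      1 / 2 * ∑ i, lam i * killingForm ℝ 𝔤 (b i) (b i) =
      1 / 4 * ∑ i, ∑ j, ∑ k, ip.form ⁅b i, b j⁆ (b k) ^ 2 * (lam k - lam i - lam j) := by
  set A : End ℝ 𝔤 := b.constr ℝ fun i => lam i • b i
  have hA : ∀ i, A (b i) = lam i • b i := fun i => b.constr_basis ℝ _ i
  have ho : ∀ i j, ip.form (b i) (b j) = if i = j then 1 else 0 := hb
  have hAform : ∀ x k, ip.form (A x) (b k) = lam k * ip.form x (b k) := by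
    intro x k
    conv_lhs => rw [← hb.sum_form_smul x]
    simp only [map_sum, map_smul, hA, LinearMap.sum_apply, LinearMap.smul_apply, smul_eq_mul, ho,
      mul_ite, mul_one, mul_zero, Finset.sum_ite_eq', Finset.mem_univ, if_true]
    exact mul_comm _ _
  have h := einstein_identity hc A
  rw [hb.trace_eq, trace_symmPart_mul hb, trace_operatorOf_mul hb, ip.xi_eq_sum hb] at h
  have h1 : ∑ i, ip.form (A (b i)) (b i) = ∑ i, lam i := by
    refine Finset.sum_congr rfl fun i _ => ?_
    rw [hAform, ho, if_pos rfl, mul_one]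
  have h2 : 1 / 2 * ∑ i, (ip.form (LieAlgebra.ad ℝ 𝔤 ip.meanCurvature (A (b i))) (b i) +
      ip.form (A (b i)) (LieAlgebra.ad ℝ 𝔤 ip.meanCurvature (b i))) =
      ∑ i, lam i * ip.form ⁅ip.meanCurvature, b i⁆ (b i) := by
    rw [Finset.mul_sum]
    refine Finset.sum_congr rfl fun i _ => ?_
    rw [hA, LieAlgebra.ad_apply, LieAlgebra.ad_apply, lie_smul, map_smul, map_smul,
      LinearMap.smul_apply, LinearMap.smul_apply, smul_eq_mul, smul_eq_mul,
      ip.symm (b i)]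
    ring
  have h3 : ∑ i, killingForm ℝ 𝔤 (A (b i)) (b i) = ∑ i, lam i * killingForm ℝ 𝔤 (b i) (b i) := by
    refine Finset.sum_congr rfl fun i _ => ?_
    rw [hA, map_smul, LinearMap.smul_apply, smul_eq_mul]
  have h4 : ∀ i j, ip.form (coboundary A (b i) (b j)) (coboundary LinearMap.id (b i) (b j)) =
      -∑ k, ip.form ⁅b i, b j⁆ (b k) ^ 2 * (lam k - lam i - lam j) := by
    intro i j
    rw [coboundary_id, hb.form_eq_sum, ← Finset.sum_neg_distrib]
    refine Finset.sum_congr rfl fun k _ => ?_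
    simp only [coboundary, hA, smul_lie, lie_smul, map_add, map_neg, map_smul, LinearMap.add_apply,
      LinearMap.neg_apply, LinearMap.smul_apply, smul_eq_mul, hAform]
    ring
  rw [h1, h2, h3] at h
  simp only [h4, Finset.sum_neg_distrib] at h
  rw [h]
  ring

/-- The Einstein identity for the derivation `ad H`. -/
theorem einstein_meanCurvature {c : ℝ} (hc : ip.ricciOperator = c • LinearMap.id) {b : Basis ι ℝ 𝔤}
    (hb : ip.IsOrthonormal b) :
    c * ip.form ip.meanCurvature ip.meanCurvature +
      1 / 4 * ∑ i, ∑ j, (ip.form ⁅ip.meanCurvature, b i⁆ (b j) +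
        ip.form ⁅ip.meanCurvature, b j⁆ (b i)) ^ 2 = 0 := by
  have h := einstein_identity hc (LieAlgebra.ad ℝ 𝔤 ip.meanCurvature)
  rw [trace_symmPart_mul hb, trace_operatorOf_mul hb] at h
  have hH := ip.form_meanCurvature ip.meanCurvature
  set H := ip.meanCurvature
  have h1 : ip.xi (LieAlgebra.ad ℝ 𝔤 H) LinearMap.id = 0 := by
    rw [ip.xi_eq_sum hb]
    refine Finset.sum_eq_zero fun i _ => Finset.sum_eq_zero fun j _ => ?_
    have h2 : coboundary (LieAlgebra.ad ℝ 𝔤 H) (b i) (b j) = 0 := by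
      rw [coboundary, LieAlgebra.ad_apply, LieAlgebra.ad_apply, LieAlgebra.ad_apply,
        leibniz_lie H (b i) (b j)]
      abel
    rw [h2, map_zero, LinearMap.zero_apply]
  have h2 : ∀ i, killingForm ℝ 𝔤 ⁅H, b i⁆ (b i) = 0 := by
    intro i
    have h3 : killingForm ℝ 𝔤 ⁅b i, H⁆ (b i) = killingForm ℝ 𝔤 (b i) ⁅H, b i⁆ :=
      LieModule.traceForm_apply_lie_apply ℝ 𝔤 𝔤 (b i) H (b i)
    have h4 : killingForm ℝ 𝔤 ⁅H, b i⁆ (b i) = killingForm ℝ 𝔤 (b i) ⁅H, b i⁆ :=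
      LieModule.traceForm_comm ℝ 𝔤 𝔤 _ _
    rw [← lie_skew (b i) H, map_neg, LinearMap.neg_apply] at h3
    linarith
  have h3 : ∀ i, ip.form ⁅H, ⁅H, b i⁆⁆ (b i) =
      ∑ j, ip.form ⁅H, b i⁆ (b j) * ip.form ⁅H, b j⁆ (b i) := by
    intro i
    conv_lhs => rw [← hb.sum_form_smul ⁅H, b i⁆]
    simp only [lie_sum, lie_smul, map_sum, map_smul, LinearMap.sum_apply, LinearMap.smul_apply,
      smul_eq_mul]
  rw [h1, ← hH] at h
  simp only [h2, Finset.sum_const_zero, mul_zero, add_zero, LieAlgebra.ad_apply, h3] at h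
  have h5 : ∀ i, ip.form ⁅H, b i⁆ ⁅H, b i⁆ =
      ∑ j, ip.form ⁅H, b i⁆ (b j) * ip.form ⁅H, b i⁆ (b j) := fun i => hb.form_eq_sum _ _
  simp only [h5, ← Finset.sum_add_distrib] at h
  have h6 : ∑ i, ∑ j, ip.form ⁅H, b i⁆ (b j) ^ 2 = ∑ i, ∑ j, ip.form ⁅H, b j⁆ (b i) ^ 2 :=
    Finset.sum_comm
  have h7 : ∑ i, ∑ j, (ip.form ⁅H, b i⁆ (b j) + ip.form ⁅H, b j⁆ (b i)) ^ 2 =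
      2 * ∑ i, ∑ j, (ip.form ⁅H, b i⁆ (b j) * ip.form ⁅H, b j⁆ (b i) +
        ip.form ⁅H, b i⁆ (b j) * ip.form ⁅H, b i⁆ (b j)) := by
    have h8 : ∀ x y : ℝ, (x + y) ^ 2 = x ^ 2 + 2 * (x * y) + y ^ 2 := fun x y => by ring
    simp only [h8, Finset.sum_add_distrib, ← h6, ← Finset.mul_sum, ← sq]
    ring
  rw [h7]
  linarith

/-- The form `Ξ` on the commutator of an operator with its adjoint. -/
theorem xi_commutator {b : Basis ι ℝ 𝔤} (hb : ip.IsOrthonormal b) {D D' : End ℝ 𝔤}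
    (hD : ∀ x y, ip.form (D x) y = ip.form x (D' y)) :
    ip.xi (D * D' - D' * D) LinearMap.id =
      (∑ i, ∑ j, ip.form (coboundary D (b i) (b j)) (coboundary D (b i) (b j))) -
      ∑ i, ∑ j, ip.form (coboundary D' (b i) (b j)) (coboundary D' (b i) (b j)) := by
  let μ : 𝔤 →ₗ[ℝ] 𝔤 →ₗ[ℝ] 𝔤 := (LieAlgebra.ad ℝ 𝔤 : 𝔤 →ₗ[ℝ] End ℝ 𝔤)
  have hμ : ∀ x y, μ x y = ⁅x, y⁆ := fun x y => rfl
  have hcob : ∀ A x y, coboundary A x y = -actOnProduct A μ x y := by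
    intro A x y
    rw [actOnProduct_apply, coboundary, hμ, hμ, hμ]
    abel
  have hD' : ∀ x y, ip.form (D' x) y = ip.form x (D y) := fun x y => by
    rw [ip.symm, ← hD, ip.symm]
  have hcomm : ∀ x y, actOnProduct (D * D' - D' * D) μ x y =
      actOnProduct D (actOnProduct D' μ) x y - actOnProduct D' (actOnProduct D μ) x y := by
    intro x y
    simp only [actOnProduct_apply, LinearMap.sub_apply, Module.End.mul_apply, map_sub]
    abel
  rw [ip.xi_eq_sum hb]
  simp only [coboundary_id]
  simp only [← hμ, hcob, map_neg, LinearMap.neg_apply, neg_neg, hcomm, map_sub,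
    LinearMap.sub_apply, Finset.sum_sub_distrib, Finset.sum_neg_distrib]
  rw [sum_form_actOnProduct hb hD (actOnProduct D' μ) μ,
    sum_form_actOnProduct hb hD' (actOnProduct D μ) μ]
  ring

end TestIdentities

end RealInnerProduct

/-! ### Bases adapted to an ideal -/

namespace RealInnerProduct

section AdaptedToIdeal

theorem eq_zero_of_sum_le_zero {ι κ τ : Type*} [Fintype ι] [Fintype κ] [Fintype τ]
    {f : ι → κ → τ → ℝ} (h0 : ∀ i j k, 0 ≤ f i j k) (h : ∑ i, ∑ j, ∑ k, f i j k ≤ 0) (i : ι) (j : κ)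
    (k : τ) : f i j k = 0 := by
  refine le_antisymm (le_trans ?_ h) (h0 i j k)
  calc f i j k ≤ ∑ k, f i j k :=
        Finset.single_le_sum (fun k _ => h0 i j k) (Finset.mem_univ k)
    _ ≤ ∑ j, ∑ k, f i j k := Finset.single_le_sum (f := fun j => ∑ k, f i j k)
        (fun j _ => Finset.sum_nonneg fun k _ => h0 i j k) (Finset.mem_univ j)
    _ ≤ ∑ i, ∑ j, ∑ k, f i j k := Finset.single_le_sum (f := fun i => ∑ j, ∑ k, f i j k)
        (fun i _ => Finset.sum_nonneg fun j _ => Finset.sum_nonneg fun k _ => h0 i j k)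
        (Finset.mem_univ i)

variable {𝔤 : Type*} [LieRing 𝔤] [LieAlgebra ℝ 𝔤] (ip : RealInnerProduct 𝔤) {ι κ : Type*}
  [DecidableEq ι] [DecidableEq κ]

/-- An orthonormal basis of a metric Lie algebra that splits into a basis of the ideal `N`, indexed by
`κ`, and a basis of its orthogonal complement, indexed by `ι`. -/
structure SplitsAlong (N : LieIdeal ℝ 𝔤) (b : Basis (ι ⊕ κ) ℝ 𝔤) : Prop where
  orthonormal : ip.IsOrthonormal b
  inr_mem : ∀ j, b (Sum.inr j) ∈ N
  form_inl : ∀ i, ∀ x ∈ N, ip.form x (b (Sum.inl i)) = 0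

theorem exists_splitsAlong [FiniteDimensional ℝ 𝔤] (N : LieIdeal ℝ 𝔤) {u : Basis κ ℝ N}
    (hu : (ip.restrict N.toSubmodule).IsOrthonormal u) :
    ∃ b : Basis (Fin (finrank ℝ (ip.form.orthogonal N.toSubmodule)) ⊕ κ) ℝ 𝔤,
      ip.SplitsAlong N b ∧ ∀ j, b (Sum.inr j) = u j := by
  obtain ⟨w, hw⟩ := (ip.restrict (ip.form.orthogonal N.toSubmodule)).exists_isOrthonormal
  obtain ⟨b, hb, hl, hr⟩ := exists_isOrthonormal_sum ip N.toSubmodule hw hu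
  refine ⟨b, ⟨hb, fun j => ?_, fun i x hx => ?_⟩, hr⟩
  · rw [hr]
    exact (u j).2
  · rw [hl]
    exact (w i).2 x hx

variable {ip} {N : LieIdeal ℝ 𝔤} {b : Basis (ι ⊕ κ) ℝ 𝔤}

theorem SplitsAlong.form_inl_left (h : ip.SplitsAlong N b) (i : ι) {x : 𝔤} (hx : x ∈ N) :
    ip.form (b (Sum.inl i)) x = 0 := by
  rw [ip.symm, h.form_inl i x hx]

variable [Fintype ι] [Fintype κ]

theorem SplitsAlong.mem_of_form_inl (h : ip.SplitsAlong N b) {x : 𝔤}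
    (hx : ∀ i, ip.form x (b (Sum.inl i)) = 0) : x ∈ N := by
  rw [← h.orthonormal.sum_form_smul x, Fintype.sum_sum_type]
  simp only [hx, zero_smul, Finset.sum_const_zero, zero_add]
  exact sum_mem fun j _ => N.smul_mem _ (h.inr_mem j)

theorem SplitsAlong.sum_inr (h : ip.SplitsAlong N b) {x : 𝔤} (hx : x ∈ N) :
    ∑ j, ip.form x (b (Sum.inr j)) • b (Sum.inr j) = x := by
  conv_rhs => rw [← h.orthonormal.sum_form_smul x, Fintype.sum_sum_type]
  simp [h.form_inl _ x hx]

theorem SplitsAlong.killingForm_inl (h : ip.SplitsAlong N b) (hN : ∀ x y : 𝔤, ⁅x, y⁆ ∈ N) (x : 𝔤) :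
    killingForm ℝ 𝔤 x x = ∑ j, ∑ k, ip.form ⁅x, b (Sum.inr j)⁆ (b (Sum.inr k)) *
      ip.form ⁅x, b (Sum.inr k)⁆ (b (Sum.inr j)) := by
  rw [killingForm_apply_apply, h.orthonormal.trace_eq, Fintype.sum_sum_type]
  have h1 : ∀ i, ip.form ((LieAlgebra.ad ℝ 𝔤 x ∘ₗ LieAlgebra.ad ℝ 𝔤 x) (b (Sum.inl i)))
      (b (Sum.inl i)) = 0 := fun i => h.form_inl i _ (hN _ _)
  rw [Finset.sum_eq_zero fun i _ => h1 i, zero_add]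
  refine Finset.sum_congr rfl fun j _ => ?_
  rw [LinearMap.comp_apply, LieAlgebra.ad_apply, LieAlgebra.ad_apply]
  conv_lhs => rw [← h.sum_inr (hN x (b (Sum.inr j)))]
  simp only [lie_sum, lie_smul, map_sum, map_smul, LinearMap.sum_apply, LinearMap.smul_apply,
    smul_eq_mul]

variable [FiniteDimensional ℝ 𝔤] [LieRing.IsNilpotent N]

/-- The Einstein identity for an operator that is diagonal in a basis that splits along an ideal which
contains the derived algebra. -/
theorem SplitsAlong.einstein_diagonal (h : ip.SplitsAlong N b) (hN : ∀ x y : 𝔤, ⁅x, y⁆ ∈ N) {c : ℝ}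
    (hc : ip.ricciOperator = c • LinearMap.id) (α : ι → ℝ) (lam : κ → ℝ) :
    c * (∑ i, α i + ∑ j, lam j) +
      ∑ j, lam j * ip.form ⁅ip.meanCurvature, b (Sum.inr j)⁆ (b (Sum.inr j)) +
      1 / 2 * ∑ i, α i * killingForm ℝ 𝔤 (b (Sum.inl i)) (b (Sum.inl i)) =
    1 / 4 * (∑ i, ∑ i', ∑ k, ip.form ⁅b (Sum.inl i), b (Sum.inl i')⁆ (b (Sum.inr k)) ^ 2 *
        (lam k - α i - α i') +
      2 * ∑ i, ∑ j, ∑ k, ip.form ⁅b (Sum.inl i), b (Sum.inr j)⁆ (b (Sum.inr k)) ^ 2 *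
        (lam k - α i - lam j) +
      ∑ j, ∑ k, ∑ l, ip.form ⁅b (Sum.inr j), b (Sum.inr k)⁆ (b (Sum.inr l)) ^ 2 *
        (lam l - lam j - lam k)) := by
  have h1 := RealInnerProduct.einstein_diagonal hc h.orthonormal (Sum.elim α lam)
  have h2 : ∀ x y i, ip.form ⁅x, y⁆ (b (Sum.inl i)) = 0 := fun x y i => h.form_inl i _ (hN x y)
  have h3 : ∀ j y, killingForm ℝ 𝔤 (b (Sum.inr j)) y = 0 := fun j y =>
    killingForm_eq_zero_of_mem_ideal (h.inr_mem j) y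
  simp only [Fintype.sum_sum_type, Sum.elim_inl, Sum.elim_inr, h2, h3, mul_zero, add_zero, zero_add,
    Finset.sum_const_zero, ne_eq, OfNat.ofNat_ne_zero, not_false_eq_true, zero_pow, zero_mul,
    Finset.sum_add_distrib] at h1
  have h4 : ∑ j, ∑ i, ∑ k, ip.form ⁅b (Sum.inr j), b (Sum.inl i)⁆ (b (Sum.inr k)) ^ 2 *
      (lam k - lam j - α i) = ∑ i, ∑ j, ∑ k,
        ip.form ⁅b (Sum.inl i), b (Sum.inr j)⁆ (b (Sum.inr k)) ^ 2 * (lam k - α i - lam j) := by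
    rw [Finset.sum_comm]
    refine Finset.sum_congr rfl fun i _ => Finset.sum_congr rfl fun j _ =>
      Finset.sum_congr rfl fun k _ => ?_
    rw [← lie_skew, map_neg, LinearMap.neg_apply]
    ring
  rw [h4] at h1
  linarith

/-- The Einstein constant is nonnegative as soon as some nonzero subspace of the center of `N` is
invariant under the whole algebra and orthogonal to the symmetric part of `ad H`. -/
theorem nonneg_of_central (hN : ∀ x y : 𝔤, ⁅x, y⁆ ∈ N) {c : ℝ}
    (hc : ip.ricciOperator = c • LinearMap.id) {Z : Submodule ℝ 𝔤} (hZN : Z ≤ N.toSubmodule)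
    (hZ0 : Z ≠ ⊥) (hcomm : ∀ z ∈ Z, ∀ y ∈ N, ⁅z, y⁆ = 0) (hinv : ∀ x : 𝔤, ∀ z ∈ Z, ⁅x, z⁆ ∈ Z)
    (hH : ∀ z ∈ Z, ip.form ⁅ip.meanCurvature, z⁆ z = 0) : 0 ≤ c := by
  classical
  obtain ⟨u, hu, hadapt⟩ := (ip.restrict N.toSubmodule).exists_isOrthonormal_adaptedTo
    (n := finrank ℝ N.toSubmodule) rfl (S := {Z.comap N.toSubmodule.subtype})
    (Set.subsingleton_singleton.isChain)
  obtain ⟨b, hb, hbu⟩ := ip.exists_splitsAlong N hu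
  have hsub : ∀ z ∈ Z, ∀ j, ip.form z (b (Sum.inr j)) ≠ 0 → b (Sum.inr j) ∈ Z := by
    intro z hz j hj
    have h1 := hadapt _ rfl ⟨z, hZN hz⟩ hz j
    rw [hu.repr_eq, restrict_form, ← hbu] at h1
    have h2 := h1 hj
    rw [Submodule.mem_comap] at h2
    rw [hbu]
    exact h2
  set lam : Fin (finrank ℝ N.toSubmodule) → ℝ := fun j => if b (Sum.inr j) ∈ Z then 1 else 0
  have hlam0 : ∀ j, 0 ≤ lam j := fun j => by
    simp only [lam]
    split_ifs <;> norm_num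
  have h1 := hb.einstein_diagonal hN hc 0 lam
  have h2 : ∀ j, lam j * ip.form ⁅ip.meanCurvature, b (Sum.inr j)⁆ (b (Sum.inr j)) = 0 := by
    intro j
    simp only [lam]
    split_ifs with hj
    · rw [hH _ hj, mul_zero]
    · rw [zero_mul]
  simp only [h2, Pi.zero_apply, zero_mul, Finset.sum_const_zero, mul_zero, add_zero, zero_add,
    sub_zero] at h1
  have h3 : 0 ≤ ∑ i, ∑ i', ∑ k, ip.form ⁅b (Sum.inl i), b (Sum.inl i')⁆ (b (Sum.inr k)) ^ 2 *
      lam k := Finset.sum_nonneg fun i _ => Finset.sum_nonneg fun i' _ =>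
    Finset.sum_nonneg fun k _ => mul_nonneg (sq_nonneg _) (hlam0 k)
  have h4 : 0 ≤ ∑ i, ∑ j, ∑ k, ip.form ⁅b (Sum.inl i), b (Sum.inr j)⁆ (b (Sum.inr k)) ^ 2 *
      (lam k - lam j) := by
    refine Finset.sum_nonneg fun i _ => Finset.sum_nonneg fun j _ => Finset.sum_nonneg fun k _ => ?_
    by_cases hj : b (Sum.inr j) ∈ Z
    · by_cases h0 : ip.form ⁅b (Sum.inl i), b (Sum.inr j)⁆ (b (Sum.inr k)) = 0
      · simp [h0]
      · have hk := hsub _ (hinv (b (Sum.inl i)) _ hj) k h0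
        simp [lam, hj, hk]
    · have h5 : lam j = 0 := if_neg hj
      rw [h5, sub_zero]
      exact mul_nonneg (sq_nonneg _) (hlam0 k)
  have h5 : 0 ≤ ∑ j, ∑ k, ∑ l, ip.form ⁅b (Sum.inr j), b (Sum.inr k)⁆ (b (Sum.inr l)) ^ 2 *
      (lam l - lam j - lam k) := by
    refine Finset.sum_nonneg fun j _ => Finset.sum_nonneg fun k _ => Finset.sum_nonneg fun l _ => ?_
    by_cases hj : b (Sum.inr j) ∈ Z
    · rw [hcomm _ hj _ (hb.inr_mem k)]
      simp
    by_cases hk : b (Sum.inr k) ∈ Z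
    · rw [← lie_skew, hcomm _ hk _ (hb.inr_mem j)]
      simp
    have h6 : lam j = 0 := if_neg hj
    have h7 : lam k = 0 := if_neg hk
    rw [h6, h7, sub_zero, sub_zero]
    exact mul_nonneg (sq_nonneg _) (hlam0 l)
  have h6 : 0 < ∑ j, lam j := by
    obtain ⟨z, hz, hz0⟩ := Submodule.exists_mem_ne_zero_of_ne_bot hZ0
    have h7 : ∃ j, ip.form z (b (Sum.inr j)) ≠ 0 := by
      by_contra! h8
      apply hz0
      rw [← hb.sum_inr (hZN hz)]
      simp [h8]
    obtain ⟨j, hj⟩ := h7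
    refine Finset.sum_pos' (fun j _ => hlam0 j) ⟨j, Finset.mem_univ j, ?_⟩
    have h8 : lam j = 1 := if_pos (hsub z hz j hj)
    rw [h8]
    exact one_pos
  by_contra! hneg
  have h7 := mul_neg_of_neg_of_pos hneg h6
  linarith

/-- A nonzero subalgebra of a nilpotent ideal has a nonzero center. -/
theorem exists_central_of_le_nilpotent {𝔤 : Type*} [LieRing 𝔤] [LieAlgebra ℝ 𝔤] {N : LieIdeal ℝ 𝔤}
    [LieRing.IsNilpotent N] {P : Submodule ℝ 𝔤} (hP : P ≤ N.toSubmodule)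
    (hlie : ∀ x ∈ P, ∀ y ∈ P, ⁅x, y⁆ ∈ P) (h0 : P ≠ ⊥) :
    ∃ z ∈ P, z ≠ 0 ∧ ∀ y ∈ P, ⁅z, y⁆ = 0 := by
  let Q : LieSubalgebra ℝ 𝔤 := { P with lie_mem' := fun {x y} hx hy => hlie x hx y hy }
  let f : Q →ₗ⁅ℝ⁆ N :=
    { toFun := fun x => ⟨x, hP x.2⟩
      map_add' := fun x y => rfl
      map_smul' := fun c x => rfl
      map_lie' := fun {x y} => rfl }
  have hf : Function.Injective f := fun x y hxy => Subtype.ext (congrArg (fun z : N => (z : 𝔤)) hxy)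
  have hnil : LieRing.IsNilpotent Q := hf.lieAlgebra_isNilpotent
  obtain ⟨z, hz, hz0⟩ := Submodule.exists_mem_ne_zero_of_ne_bot h0
  have hnt : Nontrivial Q := ⟨⟨⟨z, hz⟩, 0, fun h => hz0 (congrArg (fun t : Q => (t : 𝔤)) h)⟩⟩
  have := LieModule.nontrivial_max_triv_of_isNilpotent ℝ Q Q
  obtain ⟨⟨⟨x, hx⟩, hx'⟩, hx0⟩ := exists_ne (0 : LieModule.maxTrivSubmodule ℝ Q Q)
  refine ⟨x, hx, fun h => hx0 (Subtype.ext (Subtype.ext h)), fun y hy => ?_⟩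
  rw [LieModule.mem_maxTrivSubmodule] at hx'
  have h1 := congrArg (fun t : Q => (t : 𝔤)) (hx' ⟨y, hy⟩)
  change ⁅y, x⁆ = 0 at h1
  rw [← lie_skew, h1, neg_zero]

end AdaptedToIdeal

/-! ### Unimodular Einstein metric Lie algebras -/

section Unimodular

variable {𝔤 : Type*} [LieRing 𝔤] [LieAlgebra ℝ 𝔤] {ip : RealInnerProduct 𝔤}
  {ι κ : Type*} [DecidableEq ι] [DecidableEq κ] [Fintype ι] [Fintype κ]
  {N : LieIdeal ℝ 𝔤} {b : Basis (ι ⊕ κ) ℝ 𝔤}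

theorem SplitsAlong.isStandard_of_flat (h : ip.SplitsAlong N b) (hN : ∀ x y : 𝔤, ⁅x, y⁆ ∈ N)
    (haa : ∀ i i', ⁅b (Sum.inl i), b (Sum.inl i')⁆ = 0)
    (hnn : ∀ j k, ⁅b (Sum.inr j), b (Sum.inr k)⁆ = 0)
    (han : ∀ i j k, ip.form ⁅b (Sum.inl i), b (Sum.inr j)⁆ (b (Sum.inr k)) +
      ip.form ⁅b (Sum.inl i), b (Sum.inr k)⁆ (b (Sum.inr j)) = 0) : ip.IsStandard := by
  have hskew : ∀ i k x, ip.form ⁅b (Sum.inl i), x⁆ (b (Sum.inr k)) =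
      -ip.form x ⁅b (Sum.inl i), b (Sum.inr k)⁆ := by
    intro i k x
    have h1 : ip.form.flip (b (Sum.inr k)) ∘ₗ LieAlgebra.ad ℝ 𝔤 (b (Sum.inl i)) =
        -ip.form.flip ⁅b (Sum.inl i), b (Sum.inr k)⁆ := by
      refine b.ext ?_
      rintro (i' | j)
      · change ip.form ⁅b (Sum.inl i), b (Sum.inl i')⁆ (b (Sum.inr k)) =
          -ip.form (b (Sum.inl i')) ⁅b (Sum.inl i), b (Sum.inr k)⁆
        rw [haa, h.form_inl_left i' (hN _ _)]
        simp
      · change ip.form ⁅b (Sum.inl i), b (Sum.inr j)⁆ (b (Sum.inr k)) =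
          -ip.form (b (Sum.inr j)) ⁅b (Sum.inl i), b (Sum.inr k)⁆
        rw [ip.symm (b (Sum.inr j))]
        linarith [han i j k]
    exact congrArg (fun f : 𝔤 →ₗ[ℝ] ℝ => f x) h1
  have hker : ∀ X : 𝔤, (∀ Z ∈ LieAlgebra.derivedSeries ℝ 𝔤 1, ip.form X Z = 0) →
      ∀ i, ⁅b (Sum.inl i), X⁆ = 0 := by
    intro X hX i
    refine h.orthonormal.ext ?_
    rintro (k | k)
    · exact h.form_inl k _ (hN _ _)
    · rw [hskew, hX _ (lie_mem_derivedSeries_one _ _), neg_zero]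
  intro X Y hX hY
  -- both arguments may be replaced by their components in `N`
  have h1 : ∀ Z : 𝔤, (∀ i, ⁅b (Sum.inl i), Z⁆ = 0) →
      ⁅X, Z⁆ = ∑ j, ip.form X (b (Sum.inr j)) • ⁅b (Sum.inr j), Z⁆ := by
    intro Z hZ
    conv_lhs => rw [← h.orthonormal.sum_form_smul X, Fintype.sum_sum_type]
    simp [add_lie, sum_lie, hZ]
  have h2 : ∀ j, ⁅b (Sum.inr j), Y⁆ =
      ∑ i, ip.form Y (b (Sum.inl i)) • ⁅b (Sum.inr j), b (Sum.inl i)⁆ := by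
    intro j
    conv_lhs => rw [← h.orthonormal.sum_form_smul Y, Fintype.sum_sum_type]
    simp [lie_add, lie_sum, hnn]
  have h3 : ∀ i, ⁅X, b (Sum.inl i)⁆ = 0 := fun i => by
    rw [← lie_skew, hker X hX i, neg_zero]
  have h4 : ∀ i, ∑ j, ip.form X (b (Sum.inr j)) • ⁅b (Sum.inr j), b (Sum.inl i)⁆ = 0 := fun i => by
    rw [← h1 _ (fun i' => haa i' i), h3]
  rw [h1 Y (hker Y hY)]
  simp only [h2, Finset.smul_sum]
  rw [Finset.sum_comm]
  refine Finset.sum_eq_zero fun i _ => ?_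
  simp only [smul_comm (ip.form X _), ← Finset.smul_sum]
  rw [h4, smul_zero]

variable [FiniteDimensional ℝ 𝔤]

theorem SplitsAlong.flat_of_nonneg [LieRing.IsNilpotent N] (h : ip.SplitsAlong N b)
    (hN : ∀ x y : 𝔤, ⁅x, y⁆ ∈ N) {c : ℝ} (hc : ip.ricciOperator = c • LinearMap.id)
    (hH : ip.meanCurvature = 0) (hpos : 0 ≤ c) :
    (∀ i i', ⁅b (Sum.inl i), b (Sum.inl i')⁆ = 0) ∧ (∀ j k, ⁅b (Sum.inr j), b (Sum.inr k)⁆ = 0) ∧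
      ∀ i j k, ip.form ⁅b (Sum.inl i), b (Sum.inr j)⁆ (b (Sum.inr k)) +
        ip.form ⁅b (Sum.inl i), b (Sum.inr k)⁆ (b (Sum.inr j)) = 0 := by
  -- the test operators are the orthogonal projections onto the complement of `N` and onto `N`
  have ha := h.einstein_diagonal hN hc 1 0
  have hn := h.einstein_diagonal hN hc 0 1
  simp only [hH, zero_lie, map_zero, LinearMap.zero_apply, mul_zero, Finset.sum_const_zero, add_zero,
    zero_add, Pi.zero_apply, Pi.one_apply, Finset.sum_const, Finset.card_univ, nsmul_eq_mul, mul_one,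
    one_mul, h.killingForm_inl hN, zero_mul, sub_zero, sub_self, zero_sub, mul_neg, neg_sub_left,
    Finset.sum_neg_distrib, ← Finset.sum_mul] at ha hn
  have hE : ∑ i, ∑ j, ∑ k, (ip.form ⁅b (Sum.inl i), b (Sum.inr j)⁆ (b (Sum.inr k)) +
        ip.form ⁅b (Sum.inl i), b (Sum.inr k)⁆ (b (Sum.inr j))) ^ 2 =
      2 * ∑ i, ∑ j, ∑ k, ip.form ⁅b (Sum.inl i), b (Sum.inr j)⁆ (b (Sum.inr k)) ^ 2 +
      2 * ∑ i, ∑ j, ∑ k, ip.form ⁅b (Sum.inl i), b (Sum.inr j)⁆ (b (Sum.inr k)) *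
        ip.form ⁅b (Sum.inl i), b (Sum.inr k)⁆ (b (Sum.inr j)) := by
    have h1 : ∀ i, ∑ j, ∑ k, ip.form ⁅b (Sum.inl i), b (Sum.inr j)⁆ (b (Sum.inr k)) ^ 2 =
        ∑ j, ∑ k, ip.form ⁅b (Sum.inl i), b (Sum.inr k)⁆ (b (Sum.inr j)) ^ 2 := fun i =>
      Finset.sum_comm
    simp only [add_sq, Finset.sum_add_distrib, mul_assoc, ← Finset.mul_sum, ← h1]
    ring
  have hV0 : 0 ≤ ∑ i, ∑ i', ∑ k, ip.form ⁅b (Sum.inl i), b (Sum.inl i')⁆ (b (Sum.inr k)) ^ 2 := by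
    positivity
  have hE0 : 0 ≤ ∑ i, ∑ j, ∑ k, (ip.form ⁅b (Sum.inl i), b (Sum.inr j)⁆ (b (Sum.inr k)) +
      ip.form ⁅b (Sum.inl i), b (Sum.inr k)⁆ (b (Sum.inr j))) ^ 2 := by
    positivity
  have hcp : 0 ≤ c * (Fintype.card ι : ℝ) := by positivity
  have hcd : 0 ≤ c * (Fintype.card κ : ℝ) := by positivity
  have hV : ∑ i, ∑ i', ∑ k, ip.form ⁅b (Sum.inl i), b (Sum.inl i')⁆ (b (Sum.inr k)) ^ 2 ≤ 0 := by
    linarith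
  have hQ : ∑ j, ∑ k, ∑ l, ip.form ⁅b (Sum.inr j), b (Sum.inr k)⁆ (b (Sum.inr l)) ^ 2 ≤ 0 := by
    linarith
  have hE' : ∑ i, ∑ j, ∑ k, (ip.form ⁅b (Sum.inl i), b (Sum.inr j)⁆ (b (Sum.inr k)) +
      ip.form ⁅b (Sum.inl i), b (Sum.inr k)⁆ (b (Sum.inr j))) ^ 2 ≤ 0 := by
    linarith
  refine ⟨fun i i' => h.orthonormal.ext ?_, fun j k => h.orthonormal.ext ?_, fun i j k => ?_⟩
  · rintro (k | k)
    · exact h.form_inl k _ (hN _ _)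
    · exact (pow_eq_zero_iff two_ne_zero).1 <|
        eq_zero_of_sum_le_zero (fun _ _ _ => sq_nonneg _) hV i i' k
  · rintro (l | l)
    · exact h.form_inl l _ (hN _ _)
    · exact (pow_eq_zero_iff two_ne_zero).1 <|
        eq_zero_of_sum_le_zero (fun _ _ _ => sq_nonneg _) hQ j k l
  · exact (pow_eq_zero_iff two_ne_zero).1 <|
      eq_zero_of_sum_le_zero (fun _ _ _ => sq_nonneg _) hE' i j k

/-- A unimodular Einstein solvable metric Lie algebra is flat: the complement of the nilradical and
the nilradical are abelian, and the former acts on the latter by skew operators. Such an inner product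
is standard. -/
theorem isStandard_of_meanCurvature_eq_zero [LieRing.IsNilpotent N] (hN : ∀ x y : 𝔤, ⁅x, y⁆ ∈ N)
    (hip : ip.IsEinstein) (hH : ip.meanCurvature = 0) : ip.IsStandard := by
  obtain ⟨c, hc⟩ := hip
  intro X Y hX hY
  rcases eq_or_ne N ⊥ with hbot | hbot
  · have h1 := hN X Y
    rwa [hbot, LieSubmodule.mem_bot] at h1
  obtain ⟨u, hu⟩ := (ip.restrict N.toSubmodule).exists_isOrthonormal
  obtain ⟨b, hb, -⟩ := ip.exists_splitsAlong N hu
  have hpos : 0 ≤ c := by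
    let Z : Submodule ℝ 𝔤 :=
      { carrier := {z | z ∈ N ∧ ∀ y ∈ N, ⁅z, y⁆ = 0}
        add_mem' := fun {x y} hx hy => ⟨N.add_mem hx.1 hy.1, fun t ht => by
          rw [add_lie, hx.2 t ht, hy.2 t ht, add_zero]⟩
        zero_mem' := ⟨N.zero_mem, fun t _ => zero_lie t⟩
        smul_mem' := fun r x hx => ⟨N.smul_mem r hx.1, fun t ht => by
          rw [smul_lie, hx.2 t ht, smul_zero]⟩ }
    refine nonneg_of_central hN hc (Z := Z) (fun z hz => hz.1) ?_ (fun z hz => hz.2) ?_ ?_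
    · obtain ⟨z, hz, hz0, hzc⟩ := exists_central_of_le_nilpotent (N := N) (P := N.toSubmodule) le_rfl
        (fun x _ y _ => hN x y) (fun h => hbot ((LieSubmodule.toSubmodule_eq_bot N).1 h))
      exact fun h => hz0 ((Submodule.eq_bot_iff _).1 h z ⟨hz, hzc⟩)
    · intro x z hz
      refine ⟨hN x z, fun y hy => ?_⟩
      rw [lie_lie, hz.2 y hy, lie_zero, hz.2 _ (hN x y), sub_zero]
    · intro z _
      rw [hH, zero_lie, map_zero, LinearMap.zero_apply]
  obtain ⟨haa, hnn, han⟩ := hb.flat_of_nonneg hN hc hH hpos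
  exact hb.isStandard_of_flat hN haa hnn han X Y hX hY

end Unimodular

end RealInnerProduct

/-! ### Rigidity of the optimal weights -/

namespace RealInnerProduct

section Rigidity

variable {𝔤 : Type*} [LieRing 𝔤] [LieAlgebra ℝ 𝔤] [FiniteDimensional ℝ 𝔤] {ip : RealInnerProduct 𝔤}
  {N : LieIdeal ℝ 𝔤} [LieRing.IsNilpotent N]

/-- The trace inequality of optimal weights and the Einstein identities for the weights and for `ad H`
add up to the equality case of the Cauchy–Schwarz inequality. -/
theorem SplitsAlong.rigidity {ι κ : Type*} [DecidableEq ι] [DecidableEq κ] [Fintype ι] [Fintype κ]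
    {b : Basis (ι ⊕ κ) ℝ 𝔤} (h : ip.SplitsAlong N b) (hN : ∀ x y : 𝔤, ⁅x, y⁆ ∈ N) {c : ℝ}
    (hc : ip.ricciOperator = c • LinearMap.id) (hH : ip.meanCurvature ≠ 0) {lam : κ → ℝ}
    (hnonneg : ∀ j, 0 ≤ lam j) (hsq : ∑ j, lam j ^ 2 = ∑ j, lam j)
    (hbracket : ∀ i j l, ip.form ⁅b (Sum.inr i), b (Sum.inr j)⁆ (b (Sum.inr l)) ≠ 0 →
      lam i + lam j ≤ lam l)
    (hder : ∀ (x : 𝔤) i j, ip.form ⁅x, b (Sum.inr j)⁆ (b (Sum.inr i)) ≠ 0 → lam j ≤ lam i)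
    (htrace : ∀ x : 𝔤, 0 ≤ ∑ j, (lam j - 1) * ip.form ⁅x, b (Sum.inr j)⁆ (b (Sum.inr j))) :
    ∃ r : ℝ, 0 < r ∧ c = -r ∧
      (∀ x y, ip.form ⁅ip.meanCurvature, b x⁆ (b y) + ip.form ⁅ip.meanCurvature, b y⁆ (b x) =
        2 * r * if x = y then Sum.elim (fun _ => (0 : ℝ)) lam x else 0) ∧
      (∀ i i' k, ip.form ⁅b (Sum.inl i), b (Sum.inl i')⁆ (b (Sum.inr k)) ^ 2 * lam k = 0) ∧
      (∀ i j k, ip.form ⁅b (Sum.inl i), b (Sum.inr j)⁆ (b (Sum.inr k)) ^ 2 * (lam k - lam j) = 0) ∧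
      ∀ j k l, ip.form ⁅b (Sum.inr j), b (Sum.inr k)⁆ (b (Sum.inr l)) ^ 2 *
        (lam l - lam j - lam k) = 0 := by
  have hdiag := h.einstein_diagonal hN hc 0 lam
  have hmean := einstein_meanCurvature hc h.orthonormal
  have hnorm := ip.form_meanCurvature ip.meanCurvature
  have hpos := ip.pos _ hH
  set H := ip.meanCurvature
  simp only [Pi.zero_apply, zero_mul, Finset.sum_const_zero, mul_zero, add_zero, zero_add,
    sub_zero] at hdiag
  have hV : ∀ i i' k, 0 ≤ ip.form ⁅b (Sum.inl i), b (Sum.inl i')⁆ (b (Sum.inr k)) ^ 2 * lam k :=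
    fun i i' k => mul_nonneg (sq_nonneg _) (hnonneg k)
  have hD : ∀ i j k, 0 ≤ ip.form ⁅b (Sum.inl i), b (Sum.inr j)⁆ (b (Sum.inr k)) ^ 2 *
      (lam k - lam j) := by
    intro i j k
    by_cases h0 : ip.form ⁅b (Sum.inl i), b (Sum.inr j)⁆ (b (Sum.inr k)) = 0
    · simp [h0]
    · exact mul_nonneg (sq_nonneg _) (sub_nonneg.2 (hder _ _ _ h0))
  have hB : ∀ j k l, 0 ≤ ip.form ⁅b (Sum.inr j), b (Sum.inr k)⁆ (b (Sum.inr l)) ^ 2 *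
      (lam l - lam j - lam k) := by
    intro j k l
    by_cases h0 : ip.form ⁅b (Sum.inr j), b (Sum.inr k)⁆ (b (Sum.inr l)) = 0
    · simp [h0]
    · exact mul_nonneg (sq_nonneg _) (by linarith [hbracket _ _ _ h0])
  have hV' := Finset.sum_nonneg fun i (_ : i ∈ Finset.univ) => Finset.sum_nonneg fun i'
    (_ : i' ∈ Finset.univ) => Finset.sum_nonneg fun k (_ : k ∈ Finset.univ) => hV i i' k
  have hD' := Finset.sum_nonneg fun i (_ : i ∈ Finset.univ) => Finset.sum_nonneg fun i'
    (_ : i' ∈ Finset.univ) => Finset.sum_nonneg fun k (_ : k ∈ Finset.univ) => hD i i' k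
  have hB' := Finset.sum_nonneg fun i (_ : i ∈ Finset.univ) => Finset.sum_nonneg fun i'
    (_ : i' ∈ Finset.univ) => Finset.sum_nonneg fun k (_ : k ∈ Finset.univ) => hB i i' k
  set p : ℝ := ∑ j, lam j with hp
  set τ : ℝ := ∑ j, lam j * ip.form ⁅H, b (Sum.inr j)⁆ (b (Sum.inr j)) with hτ
  set n : ℝ := ip.form H H
  -- `Tr (ad H) = ⟨H, H⟩` enters the trace inequality
  have hτn : n ≤ τ := by
    have h1 := htrace H
    rw [h.orthonormal.trace_eq, Fintype.sum_sum_type] at hnorm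
    simp only [LieAlgebra.ad_apply, h.form_inl _ _ (hN _ _), Finset.sum_const_zero, zero_add] at hnorm
    simp only [sub_mul, one_mul, Finset.sum_sub_distrib, ← hnorm] at h1
    linarith
  have hτ0 : 0 < τ := by linarith
  have hp0 : 0 < p := by
    refine lt_of_le_of_ne (Finset.sum_nonneg fun j _ => hnonneg j) fun h0 => hτ0.ne' ?_
    have h1 := (Finset.sum_eq_zero_iff_of_nonneg fun j _ => hnonneg j).1 h0.symm
    exact Finset.sum_eq_zero fun j hj => by rw [h1 j hj, zero_mul]
  set r := τ / p with hr
  have hr0 : 0 < r := div_pos hτ0 hp0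
  have hrp : r * p = τ := div_mul_cancel₀ _ hp0.ne'
  -- the distance of the symmetric part of `ad H` to `r` times the weight operator
  have hdist : ∑ x, ∑ y, (ip.form ⁅H, b x⁆ (b y) + ip.form ⁅H, b y⁆ (b x) -
      2 * r * if x = y then Sum.elim (fun _ => (0 : ℝ)) lam x else 0) ^ 2 = -4 * (c * n) - 4 * r * τ := by
    have h1 : ∀ x y, (ip.form ⁅H, b x⁆ (b y) + ip.form ⁅H, b y⁆ (b x) -
        2 * r * if x = y then Sum.elim (fun _ => (0 : ℝ)) lam x else 0) ^ 2 =
        (ip.form ⁅H, b x⁆ (b y) + ip.form ⁅H, b y⁆ (b x)) ^ 2 +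
          if x = y then 4 * r ^ 2 * Sum.elim (fun _ => (0 : ℝ)) lam x ^ 2 -
            8 * r * (Sum.elim (fun _ => (0 : ℝ)) lam x * ip.form ⁅H, b x⁆ (b x)) else 0 := by
      intro x y
      split_ifs with hxy
      · subst hxy
        ring
      · ring
    simp only [h1, Finset.sum_add_distrib, Finset.sum_ite_eq, Finset.mem_univ, if_true,
      Finset.sum_sub_distrib, ← Finset.mul_sum,
      Fintype.sum_sum_type (fun x => Sum.elim (fun _ => (0 : ℝ)) lam x ^ 2),
      Fintype.sum_sum_type (fun x => Sum.elim (fun _ => (0 : ℝ)) lam x * ip.form ⁅H, b x⁆ (b x)),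
      Sum.elim_inl,
      Sum.elim_inr, zero_mul, Finset.sum_const_zero, zero_add, ne_eq,
      OfNat.ofNat_ne_zero, not_false_eq_true, zero_pow, hsq, ← hτ]
    have h2 : 4 * r ^ 2 * p = 4 * r * τ := by rw [← hrp]; ring
    rw [h2]
    linarith
  have hcr : -c ≤ r := by
    rw [hr, le_div_iff₀ hp0]
    linarith
  have h1 : 0 ≤ (r + c) * n := mul_nonneg (by linarith) hpos.le
  have h2 : 0 ≤ r * (τ - n) := mul_nonneg hr0.le (by linarith)
  have h3 : 0 ≤ ∑ x, ∑ y, (ip.form ⁅H, b x⁆ (b y) + ip.form ⁅H, b y⁆ (b x) -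
      2 * r * if x = y then Sum.elim (fun _ => (0 : ℝ)) lam x else 0) ^ 2 :=
    Finset.sum_nonneg fun x _ => Finset.sum_nonneg fun y _ => sq_nonneg _
  have h4 : r + c = 0 := by
    have h5 : (r + c) * n = 0 := by
      rw [hdist] at h3
      linarith
    exact (mul_eq_zero.1 h5).resolve_right hpos.ne'
  have h5 : c = -r := by linarith
  have h6 : c * p + τ = 0 := by rw [h5, ← hrp]; ring
  refine ⟨r, hr0, h5, fun x y => ?_, eq_zero_of_sum_le_zero hV (by linarith),
    eq_zero_of_sum_le_zero hD (by linarith), eq_zero_of_sum_le_zero hB (by linarith)⟩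
  have h7 : ∑ x, ∑ y, (ip.form ⁅H, b x⁆ (b y) + ip.form ⁅H, b y⁆ (b x) -
      2 * r * if x = y then Sum.elim (fun _ => (0 : ℝ)) lam x else 0) ^ 2 ≤ 0 := by
    rw [hdist, h5]
    have : r * τ = r * n := by
      rw [hdist, h5] at h3
      linarith
    linarith
  have h8 := eq_zero_of_sum_le_zero (κ := ι ⊕ κ) (τ := Unit) (f := fun x y _ => (ip.form ⁅H, b x⁆ (b y) +
    ip.form ⁅H, b y⁆ (b x) - 2 * r * if x = y then Sum.elim (fun _ => (0 : ℝ)) lam x else 0) ^ 2)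
    (fun _ _ _ => sq_nonneg _) (by simpa using h7) x y ()
  have h9 := (pow_eq_zero_iff two_ne_zero).1 h8
  linarith

/-- If the mean curvature vector of an Einstein solvable metric Lie algebra does not vanish, then, up
to a positive factor, the symmetric part of `ad H` is a positive semidefinite derivation that vanishes
on the orthogonal complement of the nilradical. -/
theorem exists_derivation_of_meanCurvature_ne_zero (hN : ∀ x y : 𝔤, ⁅x, y⁆ ∈ N) {c : ℝ}
    (hc : ip.ricciOperator = c • LinearMap.id) (hH : ip.meanCurvature ≠ 0) :
    ∃ (r : ℝ) (L : End ℝ 𝔤), 0 < r ∧ c = -r ∧ (∀ x y, L ⁅x, y⁆ = ⁅L x, y⁆ + ⁅x, L y⁆) ∧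
      (∀ x y, ip.form (L x) y = ip.form x (L y)) ∧
      (∀ x, (∀ y ∈ N, ip.form x y = 0) → L x = 0) ∧
      (∀ x, ip.form (L x) x = 0 → L x = 0) ∧
      ∀ x y, ip.form ⁅ip.meanCurvature, x⁆ y + ip.form x ⁅ip.meanCurvature, y⁆ =
        2 * r * ip.form (L x) y := by
  obtain ⟨u, lam, hu, hopt⟩ := exists_isOptimalBasis (𝔫 := N) (ip.restrict N.toSubmodule)
  obtain ⟨b, hb, hbu⟩ := ip.exists_splitsAlong N hu
  have hrepr : ∀ (x : N) j, u.repr x j = ip.form x (b (Sum.inr j)) := by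
    intro x j
    rw [hbu]
    exact hu.repr_eq x j
  let δ : 𝔤 → End ℝ N := fun x => LieModule.toEnd ℝ 𝔤 N x
  have hδ : ∀ x y z, δ x ⁅y, z⁆ = ⁅δ x y, z⁆ + ⁅y, δ x z⁆ := fun x y z =>
    Subtype.ext (leibniz_lie x (y : 𝔤) (z : 𝔤))
  have hδu : ∀ x i j, u.repr (δ x (u j)) i = ip.form ⁅x, b (Sum.inr j)⁆ (b (Sum.inr i)) := by
    intro x i j
    rw [hrepr, hbu j]
    rfl
  obtain ⟨r, hr, hcr, hS, hV, hD, hB⟩ := hb.rigidity hN hc hH hopt.nonneg hopt.sum_sq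
    (fun i j l hne => hopt.bracket i j l (by
      rw [hrepr]
      rw [hbu i, hbu j] at hne
      exact hne))
    (fun x i j hne => hopt.derivation (δ x) (hδ x) i j (by rwa [hδu]))
    (fun x => by simpa only [hδu] using hopt.trace_le (δ x) (hδ x))
  set Λ : Fin (finrank ℝ (ip.form.orthogonal N.toSubmodule)) ⊕ Fin (finrank ℝ N) → ℝ :=
    Sum.elim (fun _ => (0 : ℝ)) lam
  have hΛ0 : ∀ i, 0 ≤ Λ i := by
    rintro (i | j)
    · exact le_rfl
    · exact hopt.nonneg j
  let L : End ℝ 𝔤 := b.constr ℝ fun i => Λ i • b i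
  have hL : ∀ i, L (b i) = Λ i • b i := fun i => b.constr_basis ℝ _ i
  have ho : ∀ i j, ip.form (b i) (b j) = if i = j then 1 else 0 := hb.orthonormal
  have hLform : ∀ x i, ip.form (L x) (b i) = Λ i * ip.form x (b i) := by
    intro x i
    conv_lhs => rw [← hb.orthonormal.sum_form_smul x]
    simp only [map_sum, map_smul, hL, LinearMap.sum_apply, LinearMap.smul_apply, smul_eq_mul, ho,
      mul_ite, mul_one, mul_zero, Finset.sum_ite_eq', Finset.mem_univ, if_true]
    exact mul_comm _ _
  have hLsum : ∀ x y, ip.form (L x) y = ∑ i, Λ i * (ip.form x (b i) * ip.form y (b i)) := by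
    intro x y
    rw [hb.orthonormal.form_eq_sum]
    exact Finset.sum_congr rfl fun i _ => by rw [hLform]; ring
  have hbasis : ∀ x y k, ip.form ⁅b x, b y⁆ (b k) * (Λ k - Λ x - Λ y) = 0 := by
    have hsq : ∀ s t : ℝ, s ^ 2 * t = 0 → s * t = 0 := by
      intro s t hst
      rcases mul_eq_zero.1 hst with h1 | h1
      · rw [(pow_eq_zero_iff two_ne_zero).1 h1, zero_mul]
      · rw [h1, mul_zero]
    rintro (x | x) (y | y) (k | k)
    all_goals try rw [hb.form_inl _ _ (hN _ _), zero_mul]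
    · simpa [Λ] using hsq _ _ (hV x y k)
    · simpa [Λ] using hsq _ _ (hD x y k)
    · rw [← lie_skew, map_neg, LinearMap.neg_apply, neg_mul, neg_eq_zero]
      simpa [Λ] using hsq _ _ (hD y x k)
    · exact hsq _ _ (hB x y k)
  refine ⟨r, L, hr, hcr, ?_, ?_, ?_, ?_, ?_⟩
  · have h1 : ∀ i j, L ⁅b i, b j⁆ = ⁅L (b i), b j⁆ + ⁅b i, L (b j)⁆ := by
      intro i j
      rw [← sub_eq_zero]
      refine hb.orthonormal.ext fun k => ?_
      rw [map_sub, LinearMap.sub_apply, hLform, map_add, LinearMap.add_apply, hL, hL, smul_lie,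
        lie_smul, map_smul, map_smul, LinearMap.smul_apply, LinearMap.smul_apply, smul_eq_mul,
        smul_eq_mul]
      linarith [hbasis i j k]
    intro x y
    let μ : 𝔤 →ₗ[ℝ] 𝔤 →ₗ[ℝ] 𝔤 := (LieAlgebra.ad ℝ 𝔤 : 𝔤 →ₗ[ℝ] End ℝ 𝔤)
    have h2 : μ.compr₂ L = μ ∘ₗ L + μ.compl₂ L := by
      refine b.ext fun i => b.ext fun j => ?_
      exact h1 i j
    exact congrArg (fun f : 𝔤 →ₗ[ℝ] 𝔤 →ₗ[ℝ] 𝔤 => f x y) h2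
  · intro x y
    rw [ip.symm x, hLsum, hLsum]
    exact Finset.sum_congr rfl fun i _ => by ring
  · intro x hx
    refine hb.orthonormal.ext ?_
    rintro (i | j)
    · rw [hLform]
      exact zero_mul _
    · rw [hLform, hx _ (hb.inr_mem j), mul_zero]
  · intro x hx
    rw [hLsum] at hx
    have h1 := (Finset.sum_eq_zero_iff_of_nonneg fun i _ =>
      mul_nonneg (hΛ0 i) (mul_self_nonneg _)).1 hx
    refine hb.orthonormal.ext fun i => ?_
    rw [hLform]
    have h2 := h1 i (Finset.mem_univ i)
    rw [← mul_assoc] at h2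
    rcases mul_eq_zero.1 h2 with h3 | h3
    · exact h3
    · rw [h3, mul_zero]
  · have h1 : ip.form ∘ₗ LieAlgebra.ad ℝ 𝔤 ip.meanCurvature +
        ip.form.compl₂ (LieAlgebra.ad ℝ 𝔤 ip.meanCurvature) = (2 * r) • (ip.form ∘ₗ L) := by
      refine b.ext fun i => b.ext fun j => ?_
      change ip.form ⁅ip.meanCurvature, b i⁆ (b j) + ip.form (b i) ⁅ip.meanCurvature, b j⁆ =
        2 * r * ip.form (L (b i)) (b j)
      rw [ip.symm (b i), hS, hL, map_smul, LinearMap.smul_apply, ho, smul_eq_mul]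
      split_ifs <;> simp
    intro x y
    exact congrArg (fun f : 𝔤 →ₗ[ℝ] 𝔤 →ₗ[ℝ] ℝ => f x y) h1

end Rigidity

end RealInnerProduct

/-! ### The Hilbert–Schmidt inner product -/

namespace RealInnerProduct

section HilbertSchmidt

variable {V : Type*} [AddCommGroup V] [Module ℝ V]

/-- Bessel's inequality. -/
theorem sum_form_sq_le {κ : Type*} [Fintype κ] [DecidableEq κ] (ip : RealInnerProduct V) {e : κ → V}
    (he : ∀ i j, ip.form (e i) (e j) = if i = j then 1 else 0) (x : V) :
    ∑ i, ip.form x (e i) ^ 2 ≤ ip.form x x := by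
  have h1 := ip.self_nonneg (x - ∑ i, ip.form x (e i) • e i)
  have h2 : ip.form (x - ∑ i, ip.form x (e i) • e i) (x - ∑ i, ip.form x (e i) • e i) =
      ip.form x x - ∑ i, ip.form x (e i) ^ 2 := by
    simp only [map_sub, LinearMap.sub_apply, map_sum, map_smul, LinearMap.sum_apply,
      LinearMap.smul_apply, smul_eq_mul, he, mul_ite, mul_one, mul_zero,
      Finset.sum_ite_eq', Finset.mem_univ, if_true, ip.symm _ x, sq, sub_self,
      Finset.sum_const_zero, sub_zero]
  rw [h2] at h1
  linarith

variable [FiniteDimensional ℝ V] (ip : RealInnerProduct V)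

/-- The Hilbert–Schmidt inner product `⟨A, B⟩ = Tr (A^* B)` on endomorphisms. -/
noncomputable def hilbertSchmidt : RealInnerProduct (End ℝ V) where
  form := LinearMap.mk₂ ℝ
    (fun A B => ∑ i, ip.form (A (ip.orthonormalBasis i)) (B (ip.orthonormalBasis i)))
    (fun A A' B => by simp [Finset.sum_add_distrib])
    (fun c A B => by simp [Finset.mul_sum])
    (fun A B B' => by simp [Finset.sum_add_distrib])
    (fun c A B => by simp [Finset.mul_sum])
  symm A B := by
    simp only [LinearMap.mk₂_apply]
    exact Finset.sum_congr rfl fun i _ => ip.symm _ _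
  pos A hA := by
    rw [LinearMap.mk₂_apply]
    refine lt_of_le_of_ne (Finset.sum_nonneg fun i _ => ip.self_nonneg _) fun h => hA ?_
    refine ip.orthonormalBasis.ext fun i => ip.eq_zero_of_self_eq_zero ?_
    exact (Finset.sum_eq_zero_iff_of_nonneg fun i _ => ip.self_nonneg _).1 h.symm i
      (Finset.mem_univ i)

variable {ip}

theorem hilbertSchmidt_eq_sum {ι : Type*} [Fintype ι] [DecidableEq ι] {b : Basis ι ℝ V}
    (hb : ip.IsOrthonormal b) (A B : End ℝ V) :
    ip.hilbertSchmidt.form A B = ∑ i, ip.form (A (b i)) (B (b i)) :=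
  ip.sum_eq_sum ip.isOrthonormal_orthonormalBasis hb (ip.form.compl₁₂ A B)

theorem form_eq_form_adjoint (A : End ℝ V) (x y : V) :
    ip.form (A x) y = ip.form x (ip.adjoint A y) := by
  rw [ip.symm x, form_adjoint, ip.symm]

theorem hilbertSchmidt_eq_trace (A B : End ℝ V) :
    ip.hilbertSchmidt.form A B = LinearMap.trace ℝ V (ip.adjoint A * B) := by
  have hb := ip.isOrthonormal_orthonormalBasis
  rw [hilbertSchmidt_eq_sum hb, hb.trace_eq]
  refine Finset.sum_congr rfl fun i _ => ?_
  rw [Module.End.mul_apply, form_adjoint, ip.symm]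

theorem hilbertSchmidt_adjoint_left (A B : End ℝ V) :
    ip.hilbertSchmidt.form (ip.adjoint A) B = LinearMap.trace ℝ V (A * B) := by
  have hb := ip.isOrthonormal_orthonormalBasis
  rw [hilbertSchmidt_eq_sum hb, hb.trace_eq]
  refine Finset.sum_congr rfl fun i _ => ?_
  rw [form_adjoint, Module.End.mul_apply, ip.symm]

/-- An operator that normalizes a space `𝒟` of endomorphisms has larger commutators with the adjoints
of `𝒟` than with `𝒟` itself: the matrix of `ad E` on `𝒟` is also, up to a sign and transposition, the
matrix of the compression of `ad E` to the space of adjoints. -/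
theorem sum_commutator_le {κ : Type*} [Fintype κ] [DecidableEq κ] {𝒟 : Submodule ℝ (End ℝ V)}
    {D : Basis κ ℝ 𝒟} (hD : (ip.hilbertSchmidt.restrict 𝒟).IsOrthonormal D) {E : End ℝ V}
    (hE : ∀ A ∈ 𝒟, E * A - A * E ∈ 𝒟) :
    ∑ p, ip.hilbertSchmidt.form (E * D p - D p * E) (E * D p - D p * E) ≤
      ∑ p, ip.hilbertSchmidt.form (E * ip.adjoint (D p) - ip.adjoint (D p) * E)
        (E * ip.adjoint (D p) - ip.adjoint (D p) * E) := by
  have ho : ∀ p q, ip.hilbertSchmidt.form (D p : End ℝ V) (D q) = if p = q then 1 else 0 := hD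
  have ho' : ∀ p q, ip.hilbertSchmidt.form (ip.adjoint (D p)) (ip.adjoint (D q)) =
      if p = q then 1 else 0 := by
    intro p q
    rw [hilbertSchmidt_adjoint_left, LinearMap.trace_mul_comm, ← hilbertSchmidt_eq_trace, ho]
    simp only [eq_comm]
  have h1 : ∀ p q, ip.hilbertSchmidt.form (E * ip.adjoint (D p) - ip.adjoint (D p) * E)
      (ip.adjoint (D q)) = -ip.hilbertSchmidt.form (E * (D q : End ℝ V) - D q * E) (D p) := by
    intro p q
    rw [ip.hilbertSchmidt.symm, hilbertSchmidt_adjoint_left, ip.hilbertSchmidt.symm _ (D p : End ℝ V),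
      hilbertSchmidt_eq_trace, mul_sub, mul_sub, map_sub, map_sub, neg_sub, ← mul_assoc,
      ← mul_assoc, ← mul_assoc, ← mul_assoc]
    congr 1
    · rw [LinearMap.trace_mul_comm, ← mul_assoc]
    · rw [mul_assoc, LinearMap.trace_mul_comm]
  have h2 : ∀ q, ip.hilbertSchmidt.form (E * D q - D q * E) (E * D q - D q * E) =
      ∑ p, ip.hilbertSchmidt.form (E * (D q : End ℝ V) - D q * E) (D p) ^ 2 := by
    intro q
    have h3 := hD.form_eq_sum ⟨_, hE _ (D q).2⟩ ⟨_, hE _ (D q).2⟩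
    simp only [restrict_form] at h3
    rw [h3]
    exact Finset.sum_congr rfl fun p _ => (sq _).symm
  calc ∑ q, ip.hilbertSchmidt.form (E * D q - D q * E) (E * D q - D q * E) =
        ∑ q, ∑ p, ip.hilbertSchmidt.form (E * (D q : End ℝ V) - D q * E) (D p) ^ 2 :=
        Finset.sum_congr rfl fun q _ => h2 q
    _ = ∑ p, ∑ q, ip.hilbertSchmidt.form (E * ip.adjoint (D p) - ip.adjoint (D p) * E)
        (ip.adjoint (D q)) ^ 2 := by
        rw [Finset.sum_comm]
        simp only [h1, neg_sq]
    _ ≤ _ := Finset.sum_le_sum fun p _ => ip.hilbertSchmidt.sum_form_sq_le ho' _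

/-- A nilpotent operator that commutes with its self-commutator `[D^*, D]` vanishes. -/
theorem eq_zero_of_commute_commutator {D : End ℝ V} (hnil : IsNilpotent D)
    (hcomm : (ip.adjoint D * D - D * ip.adjoint D) * D =
      D * (ip.adjoint D * D - D * ip.adjoint D)) : D = 0 := by
  set D' := ip.adjoint D with hD'
  set M := D' * D - D * D' with hM
  have hself : ∀ x y, ip.form (M x) y = ip.form x (M y) := by
    intro x y
    simp only [hM, LinearMap.sub_apply, Module.End.mul_apply, map_sub]
    rw [hD', form_adjoint ip D (D x) y, form_eq_form_adjoint D (ip.adjoint D x) y,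
      ← form_eq_form_adjoint D x (D y), ← form_adjoint ip D x (ip.adjoint D y)]
  have hadj : ip.adjoint M = M := by
    refine LinearMap.ext fun x => ?_
    rw [← sub_eq_zero]
    refine ip.isOrthonormal_orthonormalBasis.ext fun i => ?_
    rw [map_sub, LinearMap.sub_apply, form_adjoint, hself, sub_self]
  have hM0 : M = 0 := by
    refine ip.hilbertSchmidt.eq_zero_of_self_eq_zero ?_
    rw [hilbertSchmidt_eq_trace, hadj]
    nth_rewrite 2 [hM]
    rw [mul_sub, map_sub, ← mul_assoc, ← mul_assoc, hcomm, sub_eq_zero, LinearMap.trace_mul_comm,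
      ← mul_assoc]
  have hcD : Commute D' D := sub_eq_zero.1 (hM.symm.trans hM0)
  refine ip.hilbertSchmidt.eq_zero_of_self_eq_zero ?_
  rw [hilbertSchmidt_eq_trace]
  exact (LinearMap.isNilpotent_trace_of_isNilpotent (hcD.isNilpotent_mul_left hnil)).eq_zero

end HilbertSchmidt

end RealInnerProduct

/-! ### The kernel of the weight derivation in the nilradical -/

namespace RealInnerProduct

section RestrictedAd

variable {𝔤 : Type*} [LieRing 𝔤] [LieAlgebra ℝ 𝔤] {ip : RealInnerProduct 𝔤} {ι κ : Type*}
  {N : LieIdeal ℝ 𝔤} {b : Basis (ι ⊕ κ) ℝ 𝔤}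

/-- The adjoint action on the span of the vectors `b (inr j)`, extended by zero to the span of the
vectors `b (inl i)`. -/
noncomputable def restrictedAd (b : Basis (ι ⊕ κ) ℝ 𝔤) : 𝔤 →ₗ[ℝ] End ℝ 𝔤 :=
  (LinearMap.lcomp ℝ 𝔤 (b.constr ℝ (Sum.elim (fun _ => 0) fun j => b (Sum.inr j)))) ∘ₗ
    (LieAlgebra.ad ℝ 𝔤 : 𝔤 →ₗ[ℝ] End ℝ 𝔤)

theorem restrictedAd_inl (X : 𝔤) (i : ι) : restrictedAd b X (b (Sum.inl i)) = 0 := by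
  change ⁅X, b.constr ℝ _ (b (Sum.inl i))⁆ = 0
  rw [b.constr_basis, Sum.elim_inl, lie_zero]

theorem restrictedAd_inr (X : 𝔤) (j : κ) :
    restrictedAd b X (b (Sum.inr j)) = ⁅X, b (Sum.inr j)⁆ := by
  change ⁅X, b.constr ℝ _ (b (Sum.inr j))⁆ = _
  rw [b.constr_basis, Sum.elim_inr]

theorem restrictedAd_mem (hN : ∀ x y : 𝔤, ⁅x, y⁆ ∈ N) (X y : 𝔤) : restrictedAd b X y ∈ N := hN _ _

variable [DecidableEq ι] [DecidableEq κ] [Fintype ι] [Fintype κ]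

theorem SplitsAlong.restrictedAd_apply (h : ip.SplitsAlong N b) (X : 𝔤) {y : 𝔤} (hy : y ∈ N) :
    restrictedAd b X y = ⁅X, y⁆ := by
  rw [← h.sum_inr hy]
  simp only [map_sum, map_smul, restrictedAd_inr, lie_sum, lie_smul]

variable [FiniteDimensional ℝ 𝔤]

theorem SplitsAlong.adjoint_inl (h : ip.SplitsAlong N b) {D : End ℝ 𝔤} (hD : ∀ y, D y ∈ N) (i : ι) :
    ip.adjoint D (b (Sum.inl i)) = 0 := by
  refine h.orthonormal.ext fun k => ?_
  rw [form_adjoint, h.form_inl_left i (hD _)]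

theorem SplitsAlong.adjoint_mem (h : ip.SplitsAlong N b) {D : End ℝ 𝔤}
    (hD : ∀ i, D (b (Sum.inl i)) = 0) (y : 𝔤) : ip.adjoint D y ∈ N := by
  refine h.mem_of_form_inl fun i => ?_
  rw [form_adjoint, hD, map_zero]

/-- The square norm of the coboundary of an operator which vanishes on the complement of `N` and takes
values in `N`. -/
theorem SplitsAlong.sum_form_coboundary (h : ip.SplitsAlong N b) {D : End ℝ 𝔤}
    (hD0 : ∀ i, D (b (Sum.inl i)) = 0) (hDN : ∀ y, D y ∈ N) :
    ∑ x, ∑ y, ip.form (coboundary D (b x) (b y)) (coboundary D (b x) (b y)) =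
      (∑ i, ∑ i', ip.form (D ⁅b (Sum.inl i), b (Sum.inl i')⁆) (D ⁅b (Sum.inl i), b (Sum.inl i')⁆)) +
      2 * ∑ i, ip.hilbertSchmidt.form
        (restrictedAd b (b (Sum.inl i)) * D - D * restrictedAd b (b (Sum.inl i)))
        (restrictedAd b (b (Sum.inl i)) * D - D * restrictedAd b (b (Sum.inl i))) +
      ∑ j, ∑ k, ip.form (coboundary D (b (Sum.inr j)) (b (Sum.inr k)))
        (coboundary D (b (Sum.inr j)) (b (Sum.inr k))) := by
  have h1 : ∀ i i', coboundary D (b (Sum.inl i)) (b (Sum.inl i')) =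
      -D ⁅b (Sum.inl i), b (Sum.inl i')⁆ := by
    intro i i'
    rw [coboundary, hD0, hD0, zero_lie, lie_zero, add_zero, add_zero]
  have h2 : ∀ i j, coboundary D (b (Sum.inl i)) (b (Sum.inr j)) =
      (restrictedAd b (b (Sum.inl i)) * D - D * restrictedAd b (b (Sum.inl i))) (b (Sum.inr j)) := by
    intro i j
    rw [coboundary, hD0, zero_lie, add_zero, LinearMap.sub_apply, Module.End.mul_apply,
      Module.End.mul_apply, h.restrictedAd_apply _ (hDN _), restrictedAd_inr]
    abel
  have h3 : ∀ i j, coboundary D (b (Sum.inr j)) (b (Sum.inl i)) =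
      -coboundary D (b (Sum.inl i)) (b (Sum.inr j)) := by
    intro i j
    rw [coboundary, coboundary, ← lie_skew, ← lie_skew (D (b (Sum.inr j))),
      ← lie_skew (b (Sum.inr j)) (D _), map_neg]
    abel
  have h4 : ∀ i i', (restrictedAd b (b (Sum.inl i)) * D - D * restrictedAd b (b (Sum.inl i)))
      (b (Sum.inl i')) = 0 := by
    intro i i'
    rw [LinearMap.sub_apply, Module.End.mul_apply, Module.End.mul_apply, hD0, restrictedAd_inl,
      map_zero, map_zero, sub_zero]
  simp only [Fintype.sum_sum_type, hilbertSchmidt_eq_sum h.orthonormal, h4, h3, h2, h1, map_neg,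
    LinearMap.neg_apply, neg_neg, map_zero, Finset.sum_const_zero, zero_add, Finset.sum_add_distrib]
  rw [Finset.sum_comm (s := (Finset.univ : Finset κ)) (t := (Finset.univ : Finset ι))]
  ring

end RestrictedAd

section Kernel

variable {𝔤 : Type*} [LieRing 𝔤] [LieAlgebra ℝ 𝔤]

/-- The center of the subalgebra `N ⊓ ker L`. -/
def kerCenter (N : LieIdeal ℝ 𝔤) (L : End ℝ 𝔤) : Submodule ℝ 𝔤 where
  carrier := {z | z ∈ N ∧ L z = 0 ∧ ∀ y ∈ N, L y = 0 → ⁅z, y⁆ = 0}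
  add_mem' := fun {x y} hx hy => ⟨N.add_mem hx.1 hy.1, by rw [map_add, hx.2.1, hy.2.1, add_zero],
    fun t ht ht' => by rw [add_lie, hx.2.2 t ht ht', hy.2.2 t ht ht', add_zero]⟩
  zero_mem' := ⟨N.zero_mem, map_zero L, fun t _ _ => zero_lie t⟩
  smul_mem' := fun r x hx => ⟨N.smul_mem r hx.1, by rw [map_smul, hx.2.1, smul_zero],
    fun t ht ht' => by rw [smul_lie, hx.2.2 t ht ht', smul_zero]⟩

theorem lie_mem_kerCenter {N : LieIdeal ℝ 𝔤} {L : End ℝ 𝔤}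
    (hL : ∀ x y, L ⁅x, y⁆ = ⁅L x, y⁆ + ⁅x, L y⁆) {w z : 𝔤} (hw : L w = 0) (hz : z ∈ kerCenter N L) :
    ⁅w, z⁆ ∈ kerCenter N L := by
  refine ⟨lie_mem_right ℝ 𝔤 N w z hz.1, ?_, fun y hy hy' => ?_⟩
  · rw [hL, hw, hz.2.1, zero_lie, lie_zero, add_zero]
  · have h1 : L ⁅w, y⁆ = 0 := by rw [hL, hw, hy', zero_lie, lie_zero, add_zero]
    rw [lie_lie, hz.2.2 y hy hy', lie_zero, hz.2.2 _ (lie_mem_right ℝ 𝔤 N w y hy) h1, sub_zero]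

variable [FiniteDimensional ℝ 𝔤] {ip : RealInnerProduct 𝔤}
  {ι κ : Type*} [DecidableEq ι] [DecidableEq κ] [Fintype ι] [Fintype κ] {N : LieIdeal ℝ 𝔤}
  {b : Basis (ι ⊕ κ) ℝ 𝔤} [LieRing.IsNilpotent N]

/-- The Einstein identity for the self-commutator of an operator that commutes with the symmetric part
of `ad H`: the coboundaries of the operator and of its adjoint have the same norm. -/
theorem SplitsAlong.sum_form_coboundary_adjoint (h : ip.SplitsAlong N b) {c : ℝ}
    (hc : ip.ricciOperator = c • LinearMap.id) {r : ℝ} {L : End ℝ 𝔤}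
    (hLH : ∀ x y, ip.form ⁅ip.meanCurvature, x⁆ y + ip.form x ⁅ip.meanCurvature, y⁆ =
      2 * r * ip.form (L x) y) {D : End ℝ 𝔤} (hD0 : ∀ i, D (b (Sum.inl i)) = 0)
    (hDN : ∀ y, D y ∈ N) (hDL : L * D = D * L) :
    ∑ x, ∑ y, ip.form (coboundary D (b x) (b y)) (coboundary D (b x) (b y)) =
      ∑ x, ∑ y, ip.form (coboundary (ip.adjoint D) (b x) (b y))
        (coboundary (ip.adjoint D) (b x) (b y)) := by
  set D' := ip.adjoint D
  have hD'N : ∀ y, D' y ∈ N := h.adjoint_mem hD0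
  have h1 := einstein_identity hc (D * D' - D' * D)
  have h2 : LinearMap.trace ℝ 𝔤 (D * D' - D' * D) = 0 := by
    rw [map_sub, LinearMap.trace_mul_comm, sub_self]
  have h3 : LinearMap.trace ℝ 𝔤 (ip.operatorOf (killingForm ℝ 𝔤) * (D * D' - D' * D)) = 0 := by
    rw [trace_operatorOf_mul h.orthonormal]
    refine Finset.sum_eq_zero fun i _ => killingForm_eq_zero_of_mem_ideal (N := N) ?_ _
    exact N.sub_mem (hDN _) (hD'N _)
  have h4 : LinearMap.trace ℝ 𝔤 (ip.symmPart (LieAlgebra.ad ℝ 𝔤 ip.meanCurvature) *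
      (D * D' - D' * D)) = 0 := by
    have h5 : ∀ A : End ℝ 𝔤, LinearMap.trace ℝ 𝔤
        (ip.symmPart (LieAlgebra.ad ℝ 𝔤 ip.meanCurvature) * A) = r * LinearMap.trace ℝ 𝔤 (L * A) := by
      intro A
      rw [trace_symmPart_mul h.orthonormal, h.orthonormal.trace_eq]
      simp only [LieAlgebra.ad_apply, hLH, Module.End.mul_apply, ← Finset.mul_sum]
      ring
    rw [h5, mul_sub, map_sub, ← mul_assoc L, hDL, mul_assoc, LinearMap.trace_mul_comm ℝ D, mul_assoc,
      sub_self, mul_zero]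
  rw [h2, h3, h4, xi_commutator h.orthonormal (form_eq_form_adjoint D)] at h1
  linarith

/-- The center of `N ⊓ ker L` acts trivially on `N`. An orthonormal basis `D` of the space `𝒟` of the
operators by which it acts is tested in the Einstein identity: the coboundaries of `D` consist of the
commutators with `ad w`, for `w` orthogonal to `N`, and these are not longer than those of `D^*`. So
the remaining part of the coboundary of `D^*` vanishes, which says that `D^*` is a derivation of `N`.
Then `[D^*, D]` is inner and commutes with `D`, hence the nilpotent operator `D` is normal. -/
theorem SplitsAlong.lie_eq_zero_of_mem_kerCenter (h : ip.SplitsAlong N b)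
    (hN : ∀ x y : 𝔤, ⁅x, y⁆ ∈ N) {c : ℝ} (hc : ip.ricciOperator = c • LinearMap.id) {r : ℝ}
    {L : End ℝ 𝔤} (hL : ∀ x y, L ⁅x, y⁆ = ⁅L x, y⁆ + ⁅x, L y⁆)
    (hLsymm : ∀ x y, ip.form (L x) y = ip.form x (L y)) (hL0 : ∀ i, L (b (Sum.inl i)) = 0)
    (hLH : ∀ x y, ip.form ⁅ip.meanCurvature, x⁆ y + ip.form x ⁅ip.meanCurvature, y⁆ =
      2 * r * ip.form (L x) y) {z y : 𝔤} (hz : z ∈ kerCenter N L) (hy : y ∈ N) : ⁅z, y⁆ = 0 := by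
  set 𝒟 : Submodule ℝ (End ℝ 𝔤) := (kerCenter N L).map (restrictedAd b)
  obtain ⟨D, hD⟩ := (ip.hilbertSchmidt.restrict 𝒟).exists_isOrthonormal
  choose X hX hXD using fun p => Submodule.mem_map.1 (D p).2
  have hLN : ∀ x, L x ∈ N := fun x => h.mem_of_form_inl fun i => by rw [hLsymm, hL0, map_zero]
  have hD0 : ∀ p i, (D p : End ℝ 𝔤) (b (Sum.inl i)) = 0 := fun p i => by
    rw [← hXD, restrictedAd_inl]
  have hDN : ∀ p x, (D p : End ℝ 𝔤) x ∈ N := fun p x => by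
    rw [← hXD]
    exact restrictedAd_mem hN _ _
  have hDapp : ∀ p, ∀ x ∈ N, (D p : End ℝ 𝔤) x = ⁅X p, x⁆ := fun p x hx => by
    rw [← hXD, h.restrictedAd_apply _ hx]
  have hDL : ∀ p, L * D p = D p * L := by
    intro p
    refine b.ext ?_
    rintro (i | j)
    · rw [Module.End.mul_apply, Module.End.mul_apply, hD0, hL0, map_zero, map_zero]
    · rw [Module.End.mul_apply, Module.End.mul_apply, hDapp p _ (h.inr_mem j), hDapp p _ (hLN _), hL,
        (hX p).2.1, zero_lie, zero_add]
  have hD'0 : ∀ p i, ip.adjoint (D p : End ℝ 𝔤) (b (Sum.inl i)) = 0 := fun p =>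
    h.adjoint_inl (hDN p)
  have hD'N : ∀ p x, ip.adjoint (D p : End ℝ 𝔤) x ∈ N := fun p => h.adjoint_mem (hD0 p)
  have hD'L : ∀ p x, L x = 0 → L (ip.adjoint (D p : End ℝ 𝔤) x) = 0 := by
    intro p x hx
    refine h.orthonormal.ext fun i => ?_
    have h1 : (D p : End ℝ 𝔤) (L (b i)) = L ((D p : End ℝ 𝔤) (b i)) :=
      (congrArg (fun A : End ℝ 𝔤 => A (b i)) (hDL p)).symm
    rw [hLsymm, form_adjoint, h1, ← hLsymm, hx, map_zero, LinearMap.zero_apply]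
  -- `ad w` normalizes `𝒟` for `w` orthogonal to `N`
  have hnorm : ∀ i, ∀ A ∈ 𝒟, restrictedAd b (b (Sum.inl i)) * A - A * restrictedAd b (b (Sum.inl i)) ∈
      𝒟 := by
    rintro i _ ⟨x, hx, rfl⟩
    refine ⟨_, lie_mem_kerCenter hL (hL0 i) hx, ?_⟩
    refine b.ext ?_
    rintro (k | k)
    · simp only [LinearMap.sub_apply, Module.End.mul_apply, restrictedAd_inl, map_zero, sub_zero]
    · rw [LinearMap.sub_apply, Module.End.mul_apply, Module.End.mul_apply, restrictedAd_inr,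
        restrictedAd_inr, restrictedAd_inr, h.restrictedAd_apply _ (hN _ _),
        h.restrictedAd_apply _ (hN _ _), lie_lie]
  have hle : ∑ p, ∑ i, ip.hilbertSchmidt.form
      (restrictedAd b (b (Sum.inl i)) * D p - D p * restrictedAd b (b (Sum.inl i)))
      (restrictedAd b (b (Sum.inl i)) * D p - D p * restrictedAd b (b (Sum.inl i))) ≤
      ∑ p, ∑ i, ip.hilbertSchmidt.form
      (restrictedAd b (b (Sum.inl i)) * ip.adjoint (D p) -
        ip.adjoint (D p) * restrictedAd b (b (Sum.inl i)))
      (restrictedAd b (b (Sum.inl i)) * ip.adjoint (D p) -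
        ip.adjoint (D p) * restrictedAd b (b (Sum.inl i))) := by
    rw [Finset.sum_comm]
    conv_rhs => rw [Finset.sum_comm]
    exact Finset.sum_le_sum fun i _ => sum_commutator_le hD (hnorm i)
  have hcob : ∀ p, 2 * ∑ i, ip.hilbertSchmidt.form
      (restrictedAd b (b (Sum.inl i)) * D p - D p * restrictedAd b (b (Sum.inl i)))
      (restrictedAd b (b (Sum.inl i)) * D p - D p * restrictedAd b (b (Sum.inl i))) =
      (∑ i, ∑ i', ip.form (ip.adjoint (D p) ⁅b (Sum.inl i), b (Sum.inl i')⁆)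
        (ip.adjoint (D p) ⁅b (Sum.inl i), b (Sum.inl i')⁆)) +
      2 * ∑ i, ip.hilbertSchmidt.form
      (restrictedAd b (b (Sum.inl i)) * ip.adjoint (D p) -
        ip.adjoint (D p) * restrictedAd b (b (Sum.inl i)))
      (restrictedAd b (b (Sum.inl i)) * ip.adjoint (D p) -
        ip.adjoint (D p) * restrictedAd b (b (Sum.inl i))) +
      ∑ j, ∑ k, ip.form (coboundary (ip.adjoint (D p)) (b (Sum.inr j)) (b (Sum.inr k)))
        (coboundary (ip.adjoint (D p)) (b (Sum.inr j)) (b (Sum.inr k))) := by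
    intro p
    have h1 := h.sum_form_coboundary_adjoint hc hLH (hD0 p) (hDN p) (hDL p)
    rw [h.sum_form_coboundary (hD0 p) (hDN p), h.sum_form_coboundary (hD'0 p) (hD'N p)] at h1
    have h2 : ∀ i i', (D p : End ℝ 𝔤) ⁅b (Sum.inl i), b (Sum.inl i')⁆ = 0 := by
      intro i i'
      rw [hDapp p _ (hN _ _)]
      refine (hX p).2.2 _ (hN _ _) ?_
      rw [hL, hL0, hL0, zero_lie, lie_zero, add_zero]
    have h3 : ∀ j k, coboundary (D p : End ℝ 𝔤) (b (Sum.inr j)) (b (Sum.inr k)) = 0 := by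
      intro j k
      rw [coboundary, hDapp p _ (hN _ _), hDapp p _ (h.inr_mem j), hDapp p _ (h.inr_mem k),
        leibniz_lie (X p)]
      abel
    simp only [h2, h3, map_zero, Finset.sum_const_zero, zero_add, add_zero] at h1
    exact h1
  have hsum : ∑ p, ∑ j, ∑ k, ip.form (coboundary (ip.adjoint (D p)) (b (Sum.inr j)) (b (Sum.inr k)))
      (coboundary (ip.adjoint (D p)) (b (Sum.inr j)) (b (Sum.inr k))) ≤ 0 := by
    have h1 := Finset.sum_congr (rfl : Finset.univ = Finset.univ) fun p _ => hcob p
    have h2 : 0 ≤ ∑ p, ∑ i, ∑ i', ip.form (ip.adjoint (D p) ⁅b (Sum.inl i), b (Sum.inl i')⁆)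
        (ip.adjoint (D p) ⁅b (Sum.inl i), b (Sum.inl i')⁆) :=
      Finset.sum_nonneg fun p _ => Finset.sum_nonneg fun i _ => Finset.sum_nonneg fun i' _ =>
        ip.self_nonneg _
    simp only [Finset.sum_add_distrib, ← Finset.mul_sum] at h1
    linarith
  have hcob0 : ∀ p, ∀ x ∈ N, ∀ k, coboundary (ip.adjoint (D p)) x (b (Sum.inr k)) = 0 := by
    intro p x hx k
    let μ : 𝔤 →ₗ[ℝ] 𝔤 →ₗ[ℝ] 𝔤 := (LieAlgebra.ad ℝ 𝔤 : 𝔤 →ₗ[ℝ] End ℝ 𝔤)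
    let f : 𝔤 →ₗ[ℝ] 𝔤 := -(ip.adjoint (D p) ∘ₗ μ.flip (b (Sum.inr k))) +
      μ.flip (b (Sum.inr k)) ∘ₗ ip.adjoint (D p) + μ.flip (ip.adjoint (D p) (b (Sum.inr k)))
    have hf : ∀ t, coboundary (ip.adjoint (D p)) t (b (Sum.inr k)) = f t := fun t => rfl
    rw [hf, ← h.sum_inr hx, map_sum]
    refine Finset.sum_eq_zero fun j _ => ?_
    rw [map_smul, ← hf, ip.eq_zero_of_self_eq_zero (eq_zero_of_sum_le_zero
      (fun _ _ _ => ip.self_nonneg _) hsum p j k), smul_zero]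
  have hDzero : ∀ p, (D p : End ℝ 𝔤) = 0 := by
    intro p
    have hM : ip.adjoint (D p) * D p - D p * ip.adjoint (D p) =
        restrictedAd b (ip.adjoint (D p) (X p)) := by
      refine b.ext ?_
      rintro (i | k)
      · rw [LinearMap.sub_apply, Module.End.mul_apply, Module.End.mul_apply, hD0, hD'0, map_zero,
          map_zero, sub_zero, restrictedAd_inl]
      · have h1 := hcob0 p (X p) (hX p).1 k
        rw [coboundary, add_assoc, neg_add_eq_zero] at h1
        rw [LinearMap.sub_apply, Module.End.mul_apply, Module.End.mul_apply,
          hDapp p _ (h.inr_mem k), hDapp p _ (hD'N p _), h1, restrictedAd_inr, add_sub_cancel_right]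
    refine eq_zero_of_commute_commutator (ip := ip) ?_ ?_
    · obtain ⟨k, hk⟩ := isNilpotent_ad_of_mem_ideal (hX p).1
      have hpow : ∀ (j : ℕ), ∀ x ∈ N, ((D p : End ℝ 𝔤) ^ j) x = (LieAlgebra.ad ℝ 𝔤 (X p) ^ j) x := by
        intro j
        induction j with
        | zero => intro x _; rfl
        | succ j ih =>
          intro x hx
          rw [pow_succ, pow_succ, Module.End.mul_apply, Module.End.mul_apply, hDapp p x hx,
            ih _ (hN _ _), LieAlgebra.ad_apply]
      refine ⟨k + 1, LinearMap.ext fun x => ?_⟩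
      rw [pow_succ, Module.End.mul_apply, hpow k _ (hDN p x), hk]
      rfl
    · rw [hM]
      have h0 : ⁅ip.adjoint (D p : End ℝ 𝔤) (X p), X p⁆ = 0 := by
        rw [← lie_skew, (hX p).2.2 _ (hD'N p _) (hD'L p _ (hX p).2.1), neg_zero]
      refine b.ext ?_
      rintro (i | k)
      · rw [Module.End.mul_apply, Module.End.mul_apply, hD0, restrictedAd_inl, map_zero, map_zero]
      · rw [Module.End.mul_apply, Module.End.mul_apply, hDapp p _ (h.inr_mem k),
          h.restrictedAd_apply _ (hN _ _), restrictedAd_inr, hDapp p _ (hN _ _),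
          leibniz_lie (ip.adjoint (D p : End ℝ 𝔤) (X p)), h0, zero_lie, zero_add]
  have hz0 : (⟨restrictedAd b z, Submodule.mem_map_of_mem hz⟩ : 𝒟) = 0 := by
    refine hD.ext fun p => ?_
    rw [restrict_form, hDzero, map_zero]
  have hz1 : restrictedAd b z = 0 := congrArg Subtype.val hz0
  rw [← h.restrictedAd_apply z hy, hz1, LinearMap.zero_apply]

/-- The weight derivation `L` is injective on the nilradical: otherwise the center of `N ⊓ ker L`, which
is central in `N`, would force the Einstein constant to be nonnegative. -/
theorem SplitsAlong.eq_zero_of_mem_ker (h : ip.SplitsAlong N b) (hN : ∀ x y : 𝔤, ⁅x, y⁆ ∈ N) {c : ℝ}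
    (hc : ip.ricciOperator = c • LinearMap.id) (hc0 : c < 0) {r : ℝ}
    {L : End ℝ 𝔤} (hL : ∀ x y, L ⁅x, y⁆ = ⁅L x, y⁆ + ⁅x, L y⁆)
    (hLsymm : ∀ x y, ip.form (L x) y = ip.form x (L y)) (hL0 : ∀ i, L (b (Sum.inl i)) = 0)
    (hLH : ∀ x y, ip.form ⁅ip.meanCurvature, x⁆ y + ip.form x ⁅ip.meanCurvature, y⁆ =
      2 * r * ip.form (L x) y) {x : 𝔤} (hx : x ∈ N) (hx0 : L x = 0) : x = 0 := by
  by_contra hne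
  have htriv : ∀ z ∈ kerCenter N L, ∀ y ∈ N, ⁅z, y⁆ = 0 := fun z hz y hy =>
    h.lie_eq_zero_of_mem_kerCenter hN hc hL hLsymm hL0 hLH hz hy
  refine hc0.not_ge (nonneg_of_central hN hc (Z := kerCenter N L) (fun z hz => hz.1) ?_ htriv ?_ ?_)
  · obtain ⟨z, hz, hz0, hzc⟩ := exists_central_of_le_nilpotent (N := N)
      (P := N.toSubmodule ⊓ LinearMap.ker L) inf_le_left
      (fun x hx y hy => ⟨hN x y, LinearMap.mem_ker.2 (by
        rw [hL, LinearMap.mem_ker.1 hx.2, LinearMap.mem_ker.1 hy.2, zero_lie,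
          lie_zero, add_zero])⟩)
      (fun hbot => hne ((Submodule.eq_bot_iff _).1 hbot x ⟨hx, hx0⟩))
    refine fun hbot => hz0 ((Submodule.eq_bot_iff _).1 hbot z ⟨hz.1, hz.2, fun y hy hy' => ?_⟩)
    exact hzc y ⟨hy, hy'⟩
  · intro t z hz
    rw [← h.orthonormal.sum_form_smul t, sum_lie]
    refine sum_mem fun i _ => ?_
    rw [smul_lie]
    refine Submodule.smul_mem _ _ ?_
    rcases i with i | j
    · exact lie_mem_kerCenter hL (hL0 i) hz
    · rw [← lie_skew, htriv z hz _ (h.inr_mem j), neg_zero]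
      exact zero_mem _
  · intro z hz
    have h1 := hLH z z
    rw [hz.2.1, map_zero, LinearMap.zero_apply, mul_zero, ip.symm z] at h1
    linarith

/-- An Einstein inner product on a solvable Lie algebra that is not unimodular is standard. -/
theorem isStandard_of_meanCurvature_ne_zero (hN : ∀ x y : 𝔤, ⁅x, y⁆ ∈ N) (hip : ip.IsEinstein)
    (hH : ip.meanCurvature ≠ 0) : ip.IsStandard := by
  obtain ⟨c, hc⟩ := hip
  obtain ⟨r, L, hr, hcr, hL, hLsymm, hLperp, hLpos, hLH⟩ :=
    exists_derivation_of_meanCurvature_ne_zero hN hc hH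
  obtain ⟨u, hu⟩ := (ip.restrict N.toSubmodule).exists_isOrthonormal
  obtain ⟨b, hb, -⟩ := ip.exists_splitsAlong N hu
  have hker : ∀ X : 𝔤, (∀ Z ∈ LieAlgebra.derivedSeries ℝ 𝔤 1, ip.form X Z = 0) → L X = 0 := by
    intro X hX
    refine hLpos X ?_
    have h1 := hLH X X
    rw [ip.symm _ X, hX _ (lie_mem_derivedSeries_one _ _), add_zero] at h1
    exact (mul_eq_zero.1 h1.symm).resolve_left (by positivity)
  intro X Y hX hY
  refine hb.eq_zero_of_mem_ker hN hc (by linarith) hL hLsymm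
    (fun i => hLperp _ fun y hy => hb.form_inl_left i hy) hLH (hN X Y) ?_
  rw [hL, hker X hX, hker Y hY, zero_lie, lie_zero, add_zero]

end Kernel

end RealInnerProduct

theorem theorem4 {𝔫 : Type*} [LieRing 𝔫] [LieAlgebra ℝ 𝔫] [FiniteDimensional ℝ 𝔫]
    [LieRing.IsNilpotent 𝔫]
    (hgen : finrank ℝ 𝔫 ≤ finrank ℝ (LieAlgebra.derivedSeries ℝ 𝔫 1) + 3)
    {𝔤 : Type*} [LieRing 𝔤] [LieAlgebra ℝ 𝔤] [FiniteDimensional ℝ 𝔤] [LieAlgebra.IsSolvable 𝔤]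
    (N : LieIdeal ℝ 𝔤) (hN : IsNilradical N) (e : 𝔫 ≃ₗ⁅ℝ⁆ N)
    (ip : RealInnerProduct 𝔤) (hip : ip.IsEinstein) :
    ip.IsStandard := by
  have hnil : LieRing.IsNilpotent N := hN.1
  by_cases hH : ip.meanCurvature = 0
  · exact RealInnerProduct.isStandard_of_meanCurvature_eq_zero hN.lie_mem hip hH
  · exact RealInnerProduct.isStandard_of_meanCurvature_ne_zero hN.lie_mem hip hH
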